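/- Let $n\in\mathbb N$, $\mathbb C_0=\mathbb C\setminus\{0\}$, and consider on the half-line $x\ge 0$ the system $$y'=\big(\lambda\rho(x)B+A(x)+C(x,\lambda)\big)y,\qquad y=[y_j(x)]_{j=1}^n,\qquad (1)$$ with spectral parameter $\lambda\in\mathbb C_0$, under the following assumptions. (I) $\rho$ is real-valued, $\rho\in L[0,T)$ for every $T>0$, $\rho(x)>0$ for a.e. $x\ge0$, and $B=\mathrm{diag}\{b_j\}_{j=1}^n$ with $b_j\in\mathbb C$ constant. (II) $A(x)=[a_{jk}(x)]_{j,k=1}^n$ with $a_{jk}\in L[0,\infty)$. (III) $C(x,\lambda)=[c_{jk}(x,\lambda)]_{j,k=1}^n$, where each $\lambda\mapsto c_{jk}(\cdot,\lambda)$ is a holomorphic mapping of $\mathbb C_0$ to $L[0,\infty)$, and $\|C(\cdot,\lambda)\|_{L[0,\infty)}\to0$ as $\lambda\to\infty$, where $\|C(\cdot,\lambda)\|_{L[\alpha,\infty)}:=\max_{j,k}\|c_{jk}(\cdot,\lambda)\|_{L[\alpha,\infty)}$. Solutions of linear systems are understood as vector functions with components absolutely continuous on $[0,T]$ for every $T>0$,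 satisfying the system for a.e. $x\ge 0$. A fundamental system of solutions (FSS) of (1) is an $n\times n$ matrix whose columns are solutions of (1), linearly independent on $[0,\infty)$. Put $p(x)=\int_0^x\rho(t)\,dt$, and let $D(x)=[d_{jk}(x)]_{j,k=1}^n$ with $d_{jk}=a_{jk}$ if $b_j=b_k$ and $d_{jk}=0$ otherwise. The lines $\mathrm{Re}(\lambda b_j)=\mathrm{Re}(\lambda b_l)$ with $b_j\ne b_l$ split $\mathbb C_0$ into finitely many open sectors, the connected components of the complement of these lines in $\mathbb C_0$ (the only one is $\mathbb C_0$ itself if all $b_j$ coincide). Fix one of them, $\Gamma_\kappa$, and suppose that $b_1,\dots,b_n$ are numbered so that $$\mathrm{Re}(\lambda b_1)\ge\mathrm{Re}(\lambda b_2)\ge\dots\ge\mathrm{Re}(\lambda b_n),\qquad\lambda\in\overline{\Gamma_\kappa}.$$ **Theorem.** For every $\alpha\ge0$ the initial-value problem $M_\alpha'(x)=D(x)M_\alpha(x)$, $x\ge0$, $M_\alpha(\alpha)=I$, has a unique solution $M_\alpha=[m_{jk}(x)]_{j,k=1}^n$, and there exists $\lambda_\alpha>0$ such that, with $\Gamma_\kappa^\alpha:=\{\lambda\in\Gamma_\kappa:|\lambda|>\lambda_\alpha\}$,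 for $\lambda\in\overline{\Gamma_\kappa^\alpha}$ there exists an FSS $Y_\alpha(x,\lambda)=[y_{jk}(x,\lambda)]_{j,k=1}^n$ of (1) with the following properties. 1. For $j,k=1,\dots,n$, $\lambda\in\overline{\Gamma_\kappa^\alpha}$ and $x\ge\alpha$, $$y_{jk}(x,\lambda)=e^{\lambda b_k(p(x)-p(\alpha))}\big(m_{jk}(x)+s_{jk}(x,\lambda)\big),$$ where $s_{jk}(x,\lambda)\to0$ as $\lambda\to\infty$, $\lambda\in\overline{\Gamma_\kappa^\alpha}$, uniformly in $x\ge\alpha$. 2. For each fixed $x\ge0$, the functions $\lambda\mapsto y_{jk}(x,\lambda)$, $j,k=1,\dots,n$, are continuous on $\overline{\Gamma_\kappa^\alpha}$ and analytic in $\Gamma_\kappa^\alpha$. 3. For $\lambda\in\overline{\Gamma_\kappa^\alpha}$ and $1\le k\le j\le n$, $y_{jk}(\alpha,\lambda)=\delta_{jk}$, where $\delta_{jk}$ is the Kronecker delta. Moreover, the numbers $\lambda_\alpha$ can be chosen so that $\lambda_\alpha\to0$ as $\alpha\to\infty$ whenever the following condition holds: there is $\varphi(\alpha)>0$, $\alpha\ge0$,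 such that $\varphi(\alpha)\to0$ and $\sup_{|\lambda|\ge\varphi(\alpha)}\|C(\cdot,\lambda)\|_{L[\alpha,\infty)}\to0$ as $\alpha\to\infty$. -/

import Mathlib

open MeasureTheory Set Filter Topology

/-- The space `L[0, ∞)` of (classes of) complex-valued Lebesgue-summable functions on the
half-line. -/
abbrev HalfLineL1 : Type := Lp ℂ 1 (volume.restrict (Ici (0 : ℝ)))

/-- The punctured plane `λ ≠ 0` without the lines `Re (λ b_j) = Re (λ b_l)`, `b_j ≠ b_l`. -/
def sectorRegion {n : ℕ} (b : Fin n → ℂ) : Set ℂ :=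
  {z : ℂ | z ≠ 0 ∧ ∀ j l : Fin n, b j ≠ b l → (z * b j).re ≠ (z * b l).re}

/-- `Γ` is one of the sectors into which the lines `Re (λ b_j) = Re (λ b_l)`, `b_j ≠ b_l`,
split the plane, that is, a connected component of the complement of these lines in `ℂ ∖ {0}`.
If all the `b_j` coincide there are no lines, and the only "sector" is `ℂ ∖ {0}`. -/
def IsSector {n : ℕ} (b : Fin n → ℂ) (Γ : Set ℂ) : Prop :=
  ∃ z ∈ sectorRegion b, Γ = connectedComponentIn (sectorRegion b) z

/-- The truncated sector `{λ ∈ Γ : |λ| > r}`. -/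
def truncatedSector (Γ : Set ℂ) (r : ℝ) : Set ℂ := {z ∈ Γ | r < ‖z‖}

/-- `p(x) = ∫_0^x ρ(t) dt`. -/
noncomputable def primitiveFun (ρ : ℝ → ℝ) (x : ℝ) : ℝ := ∫ t in (0 : ℝ)..x, ρ t

/-- The coefficient matrix `λ ρ(x) B + A(x) + C(x, λ)`, `B = diag(b_1, …, b_n)`. -/
noncomputable def systemMatrix {n : ℕ} (ρ : ℝ → ℝ) (b : Fin n → ℂ)
    (A : ℝ → Matrix (Fin n) (Fin n) ℂ) (C : Fin n → Fin n → ℂ → HalfLineL1)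
    (z : ℂ) (x : ℝ) : Matrix (Fin n) (Fin n) ℂ :=
  (z * (ρ x : ℂ)) • Matrix.diagonal b + A x + Matrix.of fun j k => C j k z x

open Classical in
/-- The matrix `D(x)`: its entries are `a_{jk}(x)` if `b_j = b_k`, and `0` otherwise. -/
noncomputable def blockPart {n : ℕ} (b : Fin n → ℂ) (A : ℝ → Matrix (Fin n) (Fin n) ℂ)
    (x : ℝ) : Matrix (Fin n) (Fin n) ℂ :=
  Matrix.of fun j k => if b j = b k then A x j k else 0

/-- `y` is a solution of `y' = G(x) y` on the half-line `x ≥ 0`: its components are absolutely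
continuous on `[0, T]` for every `T > 0`, and the equation holds for almost every `x ≥ 0`. -/
def IsSolution {n : ℕ} (G : ℝ → Matrix (Fin n) (Fin n) ℂ) (y : ℝ → Fin n → ℂ) : Prop :=
  (∀ T > 0, ∀ j, AbsolutelyContinuousOnInterval (fun x => y x j) 0 T) ∧
  ∀ᵐ x ∂(volume.restrict (Ici (0 : ℝ))), ∀ j,
    HasDerivAt (fun t => y t j) ((G x).mulVec (y x) j) x

/-- The `n` columns of `Y` form a fundamental system of solutions of `y' = G(x) y`: they are
solutions, linearly independent as vector functions on `[0, ∞)`. -/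
def IsFundamentalSystem {n : ℕ} (G : ℝ → Matrix (Fin n) (Fin n) ℂ)
    (Y : ℝ → Matrix (Fin n) (Fin n) ℂ) : Prop :=
  (∀ k, IsSolution G (fun x j => Y x j k)) ∧
  LinearIndependent ℂ (fun (k : Fin n) (x : Ici (0 : ℝ)) (j : Fin n) => Y (x : ℝ) j k)

/-- `M` solves the matrix initial-value problem `M' = G(x) M`, `x ≥ 0`, `M(α) = I`. -/
def IsMatrixIVPSolution {n : ℕ} (G : ℝ → Matrix (Fin n) (Fin n) ℂ) (α : ℝ)
    (M : ℝ → Matrix (Fin n) (Fin n) ℂ) : Prop :=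
  (∀ k, IsSolution G (fun x j => M x j k)) ∧ M α = 1

/-- `‖C(·, λ)‖_{L[α, ∞)}`, the maximum over the entries of their norms in `L[α, ∞)`, `α ≥ 0`. -/
noncomputable def tailNorm {n : ℕ} (C : Fin n → Fin n → ℂ → HalfLineL1) (α : ℝ) (z : ℂ) :
    ENNReal :=
  ⨆ (j : Fin n) (k : Fin n), eLpNorm (C j k z : ℝ → ℂ) 1 (volume.restrict (Ici α))

/-- There is `φ(α) > 0`, `α ≥ 0`, with `φ(α) → 0` and
`sup_{|λ| ≥ φ(α)} ‖C(·, λ)‖_{L[α, ∞)} → 0` as `α → ∞`. -/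
def TailCondition {n : ℕ} (C : Fin n → Fin n → ℂ → HalfLineL1) : Prop :=
  ∃ φ : ℝ → ℝ, (∀ α, 0 ≤ α → 0 < φ α) ∧ Tendsto φ atTop (𝓝 0) ∧
    Tendsto (fun α => ⨆ (z : ℂ) (_ : φ α ≤ ‖z‖), tailNorm C α z) atTop (𝓝 0)

/-! Let M solve M' = DM, M(α) = I. Since D is block diagonal with respect to equal b_j, so are M and
its inverse N, and M commutes with B. Substituting y = e^{λ b_k (p(x) - p(α))} M u in the k-th
column turns the system into u_j' = λ(b_j - b_k)ρ u_j + (Ru)_j with R = N(A - D + C)M = Q + P(λ).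
Here Q does not depend on λ and vanishes wherever b_j = b_l, and the L¹ norm of P(λ) is controlled
by that of C (`exists_gauged_system`).

A bounded u close to the unit vector e_k is sought from u = e_k + Ku on [α, ∞). The operator K
integrates from α to x when k ≤ j and from x to infinity when j < k. The ordering of Re(λ b_j) then
bounds every exponential in the kernel by 1 on the closed sector (`norm_halfKernel_le`).

K itself need not be small, but K² is small for large λ. Indeed Kw solves the differential equation
with source Rw, so applying the kernel's exponential gives a function φ with φ' = λ(b_l - b_j)ρφ +
g. It is integrated against Q_{jl}, which vanishes unless b_l ≠ b_j. A Riemann-Lebesgue argument,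
approximating Q_{jl} in L¹ by ρh with h smooth and integrating by parts, makes the integral small
uniformly in x and in the sector, boundary included (`exists_oscillation_bound`,
`exists_halfKernel_contraction`). So the Neumann series converges geometrically. The vector e_k
solves the homogeneous equation, hence Ke_k tends to 0 by the same estimate, and this is the
remainder s_{jk}.

Each term of the series is continuous and holomorphic in λ, and uniform convergence passes this to
the sum. A Volterra series extends the columns to [0, α]. At x = α the integrals with k ≤ j run over
an empty interval, so Y(α) is unitriangular; this gives property 3 and linear independence.

For the last claim, when α is large the L¹ tails of A, and of C for |λ| ≥ φ(α), are so small that K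
itself has norm at most 1/2. No further lower bound on |λ| is needed, and λ_α = φ(α) is admissible.
-/

/-! ### Calculus of absolutely continuous functions. -/

/-- `f` is absolutely continuous on the interval with endpoints `a`, `b` and `f'` is its summable
almost everywhere derivative. -/
structure HasACDeriv (f f' : ℝ → ℂ) (a b : ℝ) : Prop where
  ac : AbsolutelyContinuousOnInterval f a b
  intervalIntegrable : IntervalIntegrable f' volume a b
  hasDerivAt : ∀ᵐ x, x ∈ uIcc a b → HasDerivAt f (f' x) x

theorem AbsolutelyContinuousOnInterval.congr_on {f g : ℝ → ℂ} {a b : ℝ}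
    (hf : AbsolutelyContinuousOnInterval f a b) (h : EqOn f g (uIcc a b)) :
    AbsolutelyContinuousOnInterval g a b := by
  refine Tendsto.congr' ?_ hf
  filter_upwards [mem_inf_of_right (mem_principal_self _)] with E hE
  refine Finset.sum_congr rfl fun i hi => ?_
  rw [h (hE.1 i hi).1, h (hE.1 i hi).2]

namespace HasACDeriv

variable {f f' g g' : ℝ → ℂ} {a b c d : ℝ}

theorem mono (h : HasACDeriv f f' a b) (hcd : uIcc c d ⊆ uIcc a b) : HasACDeriv f f' c d where
  ac := h.ac.mono hcd
  intervalIntegrable := h.intervalIntegrable.mono_set hcd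
  hasDerivAt := by
    filter_upwards [h.hasDerivAt] with x hx hxc using hx (hcd hxc)

theorem continuousOn (h : HasACDeriv f f' a b) : ContinuousOn f (uIcc a b) := h.ac.continuousOn

theorem const (z : ℂ) (a b : ℝ) : HasACDeriv (fun _ => z) (fun _ => 0) a b where
  ac := (contDiff_const.contDiffOn).absolutelyContinuousOnInterval
  intervalIntegrable := by simp
  hasDerivAt := by
    filter_upwards with x _ using hasDerivAt_const x z

theorem add (hf : HasACDeriv f f' a b) (hg : HasACDeriv g g' a b) :
    HasACDeriv (fun x => f x + g x) (fun x => f' x + g' x) a b where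
  ac := hf.ac.add hg.ac
  intervalIntegrable := hf.intervalIntegrable.add hg.intervalIntegrable
  hasDerivAt := by
    filter_upwards [hf.hasDerivAt, hg.hasDerivAt] with x h1 h2 hx using (h1 hx).add (h2 hx)

theorem mul (hf : HasACDeriv f f' a b) (hg : HasACDeriv g g' a b) :
    HasACDeriv (fun x => f x * g x) (fun x => f' x * g x + f x * g' x) a b where
  ac := hf.ac.smul hg.ac
  intervalIntegrable := (hf.intervalIntegrable.mul_continuousOn hg.continuousOn).add
    (hg.intervalIntegrable.continuousOn_mul hf.continuousOn)
  hasDerivAt := by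
    filter_upwards [hf.hasDerivAt, hg.hasDerivAt] with x h1 h2 hx using (h1 hx).mul (h2 hx)

theorem const_mul (z : ℂ) (hf : HasACDeriv f f' a b) :
    HasACDeriv (fun x => z * f x) (fun x => z * f' x) a b := by
  simpa using (HasACDeriv.const z a b).mul hf

theorem neg (hf : HasACDeriv f f' a b) :
    HasACDeriv (fun x => -f x) (fun x => -f' x) a b := by
  simpa using hf.const_mul (-1)

theorem sub (hf : HasACDeriv f f' a b) (hg : HasACDeriv g g' a b) :
    HasACDeriv (fun x => f x - g x) (fun x => f' x - g' x) a b := by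
  simpa [sub_eq_add_neg] using hf.add hg.neg

theorem sum {ι : Type*} (s : Finset ι) {F F' : ι → ℝ → ℂ}
    (h : ∀ i ∈ s, HasACDeriv (F i) (F' i) a b) :
    HasACDeriv (fun x => ∑ i ∈ s, F i x) (fun x => ∑ i ∈ s, F' i x) a b := by
  classical
  induction s using Finset.induction_on with
  | empty => simpa using HasACDeriv.const 0 a b
  | insert i s hi ih =>
    simp only [Finset.sum_insert hi]
    exact (h i (by simp)).add (ih fun j hj => h j (by simp [hj]))

theorem congr_deriv (hf : HasACDeriv f f' a b) (h : ∀ᵐ x, x ∈ uIcc a b → f' x = g' x) :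
    HasACDeriv f g' a b where
  ac := hf.ac
  intervalIntegrable := by
    refine hf.intervalIntegrable.congr_ae ?_
    rw [EventuallyEq, ae_restrict_iff' measurableSet_uIoc]
    filter_upwards [h] with x hx hx' using hx (uIoc_subset_uIcc hx')
  hasDerivAt := by
    filter_upwards [h, hf.hasDerivAt] with x h1 h2 hx
    exact h1 hx ▸ h2 hx

theorem congr (hf : HasACDeriv f f' a b) (h : EqOn f g (uIcc a b)) :
    HasACDeriv g f' a b where
  ac := by
    exact hf.ac.congr_on h
  intervalIntegrable := hf.intervalIntegrable
  hasDerivAt := by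
    -- Equality on the closed interval is equality near interior points only, so the derivative
    -- transfers off the two endpoints, which form a null set.
    have h₂ : ∀ᵐ x : ℝ, x ≠ max a b := by simp [ae_iff, measure_singleton]
    have h₁ : ∀ᵐ x : ℝ, x ≠ min a b := by simp [ae_iff, measure_singleton]
    filter_upwards [hf.hasDerivAt, h₁, h₂] with x hx h3 h4 hxm
    refine (hx hxm).congr_of_eventuallyEq ?_
    have : x ∈ Ioo (min a b) (max a b) :=
      ⟨lt_of_le_of_ne hxm.1 (Ne.symm h3), lt_of_le_of_ne hxm.2 h4⟩
    filter_upwards [isOpen_Ioo.mem_nhds this] with y hy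
    exact (h ⟨hy.1.le, hy.2.le⟩).symm

theorem integral {g : ℝ → ℂ} (hg : IntervalIntegrable g volume a b) (hc : c ∈ uIcc a b) :
    HasACDeriv (fun x => ∫ t in c..x, g t) g a b where
  ac := by
    -- Absolute continuity of primitives is applied to the real and imaginary parts, which are then
    -- recombined with the constants 1 and i.
    have hre : IntervalIntegrable (fun x => (g x).re) volume a b := by
      rw [intervalIntegrable_iff] at *; exact hg.re
    have him : IntervalIntegrable (fun x => (g x).im) volume a b := by
      rw [intervalIntegrable_iff] at *; exact hg.im
    have h1 := (hre.absolutelyContinuousOnInterval_intervalIntegral hc).smul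
      (HasACDeriv.const (1 : ℂ) a b).ac
    have h2 := (him.absolutelyContinuousOnInterval_intervalIntegral hc).smul
      (HasACDeriv.const Complex.I a b).ac
    refine (h1.add h2).congr_on fun x hx => ?_
    have hint : IntervalIntegrable g volume c x := hg.mono_set (uIcc_subset_uIcc hc hx)
    have e1 := Complex.reCLM.intervalIntegral_comp_comm hint
    have e2 := Complex.imCLM.intervalIntegral_comp_comm hint
    simp only [Complex.reCLM_apply, Complex.imCLM_apply] at e1 e2
    simp [e1, e2, Complex.re_add_im]
  intervalIntegrable := hg
  hasDerivAt := by
    filter_upwards [hg.ae_hasDerivAt_integral] with x h1 hx using h1 hx c hc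

/-- Subtracting the primitive of `f'` leaves an absolutely continuous function with almost
everywhere vanishing derivative, and such a function is constant. -/
theorem integral_eq_sub (hf : HasACDeriv f f' a b) : ∫ x in a..b, f' x = f b - f a := by
  have h := hf.sub (HasACDeriv.integral hf.intervalIntegrable (c := a) left_mem_uIcc)
  obtain ⟨C, hC⟩ := h.ac.const_of_ae_hasDerivAt_zero (by
    filter_upwards [h.hasDerivAt] with x hx h' using by simpa using hx h')
  have h1 := hC a left_mem_uIcc
  have h2 := hC b right_mem_uIcc
  simp only [intervalIntegral.integral_same, sub_zero] at h1 h2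
  rw [h1, ← h2]; ring

theorem eq_of_deriv_zero (hf : HasACDeriv f (fun _ => 0) a b) : f b = f a := by
  have := hf.integral_eq_sub
  simp at this
  exact (sub_eq_zero.1 this.symm)

theorem cexp (hf : HasACDeriv f f' a b) :
    HasACDeriv (fun x => Complex.exp (f x)) (fun x => Complex.exp (f x) * f' x) a b where
  ac := by
    -- The range of `f` is bounded, and the exponential is Lipschitz on a ball containing it; a
    -- Lipschitz map preserves absolute continuity.
    obtain ⟨C, hC⟩ := hf.ac.exists_bound
    obtain ⟨K, hK⟩ := (Complex.contDiff_exp (𝕜 := ℝ) (n := 1)).contDiffOn.exists_lipschitzOnWith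
      (by simp) (convex_closedBall (0 : ℂ) C) (isCompact_closedBall _ _)
    have h1 : Tendsto (fun E : ℕ × (ℕ → ℝ × ℝ) =>
        (K : ℝ) * ∑ i ∈ Finset.range E.1, dist (f (E.2 i).1) (f (E.2 i).2))
      (AbsolutelyContinuousOnInterval.totalLengthFilter ⊓
        𝓟 (AbsolutelyContinuousOnInterval.disjWithin a b)) (𝓝 0) := by
      simpa using Tendsto.const_mul (K : ℝ) hf.ac
    refine squeeze_zero' (Eventually.of_forall fun E => Finset.sum_nonneg fun i _ => dist_nonneg)
      ?_ h1
    filter_upwards [mem_inf_of_right (mem_principal_self _)] with E hE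
    rw [Finset.mul_sum]
    refine Finset.sum_le_sum fun i hi => ?_
    exact hK.dist_le_mul _ (by simpa using hC _ (hE.1 i hi).1) _ (by simpa using hC _ (hE.1 i hi).2)
  intervalIntegrable := hf.intervalIntegrable.continuousOn_mul
    (Complex.continuous_exp.comp_continuousOn hf.continuousOn)
  hasDerivAt := by
    filter_upwards [hf.hasDerivAt] with x h1 hx using (h1 hx).cexp

end HasACDeriv

/-! ### A Riemann-Lebesgue lemma relative to the weight ρ. -/

section Oscillation

variable {ρ : ℝ → ℝ}

theorem aemeasurable_of_integrableOn_Ico (hρ_int : ∀ T > 0, IntegrableOn ρ (Ico 0 T)) :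
    AEMeasurable ρ (volume.restrict (Ici (0 : ℝ))) := by
  have h : Ici (0 : ℝ) = ⋃ n : ℕ, Ico (0 : ℝ) (n + 1) := by
    ext x
    simp only [mem_Ici, mem_iUnion, mem_Ico, exists_and_left, iff_self_and]
    intro _
    obtain ⟨n, hn⟩ := exists_nat_gt x
    exact ⟨n, by linarith⟩
  rw [h, aemeasurable_iUnion_iff]
  exact fun n => (hρ_int (n + 1) (by positivity)).aemeasurable

theorem intervalIntegrable_of_integrableOn_Ico (hρ_int : ∀ T > 0, IntegrableOn ρ (Ico 0 T))
    {a c : ℝ} (ha : 0 ≤ a) (hc : 0 ≤ c) : IntervalIntegrable ρ volume a c := by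
  rw [intervalIntegrable_iff]
  refine (hρ_int (max a c + 1) (by positivity)).mono_set fun x hx => ?_
  rw [uIoc, mem_Ioc] at hx
  exact ⟨(le_min ha hc).trans hx.1.le, by linarith [hx.2]⟩

/-- Functions of the form `ρ h` with smooth compactly supported `h` are dense in `L[0, ∞)`. -/
theorem exists_contDiff_integral_sub_mul_le (hρ_int : ∀ T > 0, IntegrableOn ρ (Ico 0 T))
    (hρ_pos : ∀ᵐ x ∂(volume.restrict (Ici (0 : ℝ))), 0 < ρ x) {q : ℝ → ℂ}
    (hq : IntegrableOn q (Ici 0)) {ε : ℝ} (hε : 0 < ε) :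
    ∃ h : ℝ → ℂ, HasCompactSupport h ∧ ContDiff ℝ 1 h ∧
      IntegrableOn (fun t => q t - ρ t * h t) (Ici 0) ∧
      ∫ t in Ici 0, ‖q t - ρ t * h t‖ ≤ ε := by
  -- In L¹ of the measure ρ dx, the distance from q/ρ to h is the integral of |q - ρh|. Local
  -- integrability of ρ makes the measure finite on compact sets, so smooth compactly supported
  -- functions are dense.
  set ν : Measure ℝ := (volume.restrict (Ici (0 : ℝ))).withDensity fun x => ENNReal.ofReal (ρ x)
    with hν
  have hm : AEMeasurable (fun x => ENNReal.ofReal (ρ x)) (volume.restrict (Ici (0 : ℝ))) :=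
    (aemeasurable_of_integrableOn_Ico hρ_int).ennreal_ofReal
  have hlt : ∀ᵐ x ∂(volume.restrict (Ici (0 : ℝ))), ENNReal.ofReal (ρ x) < ⊤ := by simp
  have : IsFiniteMeasureOnCompacts ν := by
    refine ⟨fun K hK => ?_⟩
    obtain ⟨T, hT⟩ := hK.bddAbove
    rw [hν, withDensity_apply _ hK.measurableSet, Measure.restrict_restrict hK.measurableSet]
    have hT' : (0 : ℝ) < |T| + 1 := by positivity
    refine lt_of_le_of_lt (lintegral_mono_set fun x hx => ?_) (hρ_int _ hT').lintegral_lt_top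
    exact ⟨hx.2, by have := hT hx.1; have := le_abs_self T; linarith⟩
  have key : ∀ᵐ x ∂(volume.restrict (Ici (0 : ℝ))), ∀ z : ℂ,
      (ENNReal.ofReal (ρ x)).toReal • (q x / ρ x - z) = q x - ρ x * z := by
    filter_upwards [hρ_pos] with x hx z
    rw [ENNReal.toReal_ofReal hx.le, Complex.real_smul]
    have : (ρ x : ℂ) ≠ 0 := by exact_mod_cast hx.ne'
    field_simp
  have hint : Integrable (fun x => q x / ρ x) ν := by
    rw [hν, integrable_withDensity_iff_integrable_smul₀' hm hlt]
    refine hq.congr ?_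
    filter_upwards [key] with x hx
    simpa using (hx 0).symm
  obtain ⟨h, h1, h2, h3⟩ := MemLp.exist_eLpNorm_sub_le (by simp) le_rfl
    (memLp_one_iff_integrable.2 hint) hε
  have hsub : Integrable (fun x => q x / ρ x - h x) ν :=
    hint.sub (h2.continuous.integrable_of_hasCompactSupport h1)
  refine ⟨h, h1, h2.of_le (by simp), ?_, ?_⟩
  · rw [hν, integrable_withDensity_iff_integrable_smul₀' hm hlt] at hsub
    refine hsub.congr ?_
    filter_upwards [key] with x hx using hx _
  · have e : ∫ t in Ici 0, ‖q t - ρ t * h t‖ = ∫ t, ‖q t / ρ t - h t‖ ∂ν := by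
      rw [hν, integral_withDensity_eq_integral_toReal_smul₀ hm hlt]
      refine integral_congr_ae ?_
      filter_upwards [key] with x hx
      rw [← hx (h x), norm_smul, smul_eq_mul, Real.norm_of_nonneg ENNReal.toReal_nonneg]
    rw [e, integral_norm_eq_lintegral_enorm hsub.aestronglyMeasurable]
    refine ENNReal.toReal_le_of_le_ofReal hε.le ?_
    rwa [eLpNorm_one_eq_lintegral_enorm] at h3

/-- A quantitative Riemann-Lebesgue lemma: `∫ φ q` is small for `φ' = μ ρ φ + g` with large `μ`. -/
theorem exists_oscillation_bound (hρ_int : ∀ T > 0, IntegrableOn ρ (Ico 0 T))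
    (hρ_pos : ∀ᵐ x ∂(volume.restrict (Ici (0 : ℝ))), 0 < ρ x) {q : ℝ → ℂ}
    (hq : IntegrableOn q (Ici 0)) {ε : ℝ} (hε : 0 < ε) :
    ∃ K : ℝ, 0 ≤ K ∧ ∀ (μ : ℂ) (φ g : ℝ → ℂ) (a c W G : ℝ), μ ≠ 0 → 0 ≤ a → a ≤ c →
      HasACDeriv φ (fun t => μ * ρ t * φ t + g t) a c → (∀ t ∈ Icc a c, ‖φ t‖ ≤ W) →
      IntervalIntegrable g volume a c → ∫ t in a..c, ‖g t‖ ≤ G →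
      ‖∫ t in a..c, φ t * q t‖ ≤ ε * W + K * (W + G) / ‖μ‖ := by
  obtain ⟨h, hs, hd, hi, hle⟩ := exists_contDiff_integral_sub_mul_le hρ_int hρ_pos hq hε
  obtain ⟨H, hH⟩ := hd.continuous.bounded_above_of_compact_support hs
  have hd' : Continuous (deriv h) := hd.continuous_deriv le_rfl
  have hdi : Integrable (deriv h) := hd'.integrable_of_hasCompactSupport hs.deriv
  have hH0 : 0 ≤ H := (norm_nonneg _).trans (hH 0)
  set H₁ := ∫ t, ‖deriv h t‖ with hH₁
  have hH₁0 : 0 ≤ H₁ := integral_nonneg fun _ => norm_nonneg _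
  -- 2H pays for the two boundary terms and for the integral of gh, and H₁ for the integral of φh'.
  -- The constant depends on q and ε only, not on μ or on the interval.
  refine ⟨2 * H + H₁, by positivity, fun μ φ g a c W G hμ ha hac hφ hW hg hG => ?_⟩
  have hW0 : 0 ≤ W := (norm_nonneg _).trans (hW a ⟨le_rfl, hac⟩)
  have hφc : ContinuousOn φ (uIcc a c) := hφ.continuousOn
  have hhc : ContinuousOn h (uIcc a c) := hd.continuous.continuousOn
  have hh : HasACDeriv h (deriv h) a c :=
    ⟨hd.contDiffOn.absolutelyContinuousOnInterval, hd'.intervalIntegrable _ _,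
      Eventually.of_forall fun x _ => (hd.differentiable one_ne_zero x).hasDerivAt⟩
  have hρi : IntervalIntegrable (fun t => (ρ t : ℂ)) volume a c := by
    have := intervalIntegrable_of_integrableOn_Ico hρ_int ha (ha.trans hac)
    rw [intervalIntegrable_iff] at *
    exact this.ofReal
  have hqi : IntervalIntegrable (fun t => q t - ρ t * h t) volume a c := by
    rw [intervalIntegrable_iff_integrableOn_Ioc_of_le hac]
    exact hi.mono_set fun x hx => ha.trans hx.1.le
  have hφρh : IntervalIntegrable (fun t => φ t * (ρ t * h t)) volume a c :=
    (hρi.mul_continuousOn hhc).continuousOn_mul hφc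
  have hφq : IntervalIntegrable (fun t => φ t * (q t - ρ t * h t)) volume a c :=
    hqi.continuousOn_mul hφc
  have hgh : IntervalIntegrable (fun t => g t * h t) volume a c := hg.mul_continuousOn hhc
  have hφh' : IntervalIntegrable (fun t => φ t * deriv h t) volume a c :=
    (hd'.intervalIntegrable _ _).continuousOn_mul hφc
  have e1 : ∫ t in a..c, φ t * q t =
      (∫ t in a..c, φ t * (q t - ρ t * h t)) + ∫ t in a..c, φ t * (ρ t * h t) := by
    rw [← intervalIntegral.integral_add hφq hφρh]
    congr 1; ext t; ring
  -- Integration by parts: (φh)' contains μρφh, so the oscillating integral equals 1/μ times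
  -- quantities bounded independently of μ.
  have e2 : μ * ∫ t in a..c, φ t * (ρ t * h t) =
      φ c * h c - φ a * h a - (∫ t in a..c, g t * h t) - ∫ t in a..c, φ t * deriv h t := by
    have := (hφ.mul hh).integral_eq_sub
    have e : ∀ t, (μ * ρ t * φ t + g t) * h t + φ t * deriv h t =
        μ * (φ t * (ρ t * h t)) + g t * h t + φ t * deriv h t := fun t => by ring
    simp only [e] at this
    rw [intervalIntegral.integral_add ((hφρh.const_mul μ).add hgh) hφh',
      intervalIntegral.integral_add (hφρh.const_mul μ) hgh,
      intervalIntegral.integral_const_mul] at this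
    rw [← this]; ring
  have b1 : ‖∫ t in a..c, φ t * (q t - ρ t * h t)‖ ≤ ε * W := by
    calc ‖∫ t in a..c, φ t * (q t - ρ t * h t)‖
        ≤ ∫ t in a..c, ‖q t - ρ t * h t‖ * W := by
          refine intervalIntegral.norm_integral_le_of_norm_le hac ?_ (hqi.norm.mul_const W)
          refine Eventually.of_forall fun t ht => ?_
          rw [norm_mul, mul_comm]
          exact mul_le_mul_of_nonneg_left (hW t ⟨ht.1.le, ht.2⟩) (norm_nonneg _)
      _ = (∫ t in Ioc a c, ‖q t - ρ t * h t‖) * W := by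
          rw [intervalIntegral.integral_mul_const, intervalIntegral.integral_of_le hac]
      _ ≤ ε * W := by
          refine mul_le_mul_of_nonneg_right (le_trans ?_ hle) hW0
          exact setIntegral_mono_set hi.norm (Eventually.of_forall fun _ => norm_nonneg _)
            (LE.le.eventuallyLE fun x hx => ha.trans hx.1.le)
  have b2 : ‖∫ t in a..c, g t * h t‖ ≤ G * H := by
    calc ‖∫ t in a..c, g t * h t‖ ≤ ∫ t in a..c, ‖g t‖ * H := by
          refine intervalIntegral.norm_integral_le_of_norm_le hac ?_ (hg.norm.mul_const H)
          refine Eventually.of_forall fun t ht => ?_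
          rw [norm_mul]
          exact mul_le_mul_of_nonneg_left (hH t) (norm_nonneg _)
      _ ≤ G * H := by
          rw [intervalIntegral.integral_mul_const]
          exact mul_le_mul_of_nonneg_right hG hH0
  have b3 : ‖∫ t in a..c, φ t * deriv h t‖ ≤ H₁ * W := by
    calc ‖∫ t in a..c, φ t * deriv h t‖ ≤ ∫ t in a..c, ‖deriv h t‖ * W := by
          refine intervalIntegral.norm_integral_le_of_norm_le hac ?_
            (((hd'.intervalIntegrable _ _).norm).mul_const W)
          refine Eventually.of_forall fun t ht => ?_
          rw [norm_mul, mul_comm]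
          exact mul_le_mul_of_nonneg_left (hW t ⟨ht.1.le, ht.2⟩) (norm_nonneg _)
      _ ≤ H₁ * W := by
          rw [intervalIntegral.integral_mul_const, intervalIntegral.integral_of_le hac]
          exact mul_le_mul_of_nonneg_right (setIntegral_le_integral hdi.norm
            (Eventually.of_forall fun _ => norm_nonneg _)) hW0
  have hG0 : 0 ≤ G := le_trans (intervalIntegral.integral_nonneg hac fun _ _ => norm_nonneg _) hG
  have b4 : ‖∫ t in a..c, φ t * (ρ t * h t)‖ ≤ (2 * H + H₁) * (W + G) / ‖μ‖ := by
    rw [le_div_iff₀ (norm_pos_iff.2 hμ), mul_comm, ← norm_mul, e2]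
    have c1 : ‖φ c * h c‖ ≤ W * H := by
      rw [norm_mul]; exact mul_le_mul (hW c ⟨hac, le_rfl⟩) (hH c) (norm_nonneg _) hW0
    have c2 : ‖φ a * h a‖ ≤ W * H := by
      rw [norm_mul]; exact mul_le_mul (hW a ⟨le_rfl, hac⟩) (hH a) (norm_nonneg _) hW0
    refine (norm_sub_le _ _).trans ?_
    have := (norm_sub_le (φ c * h c - φ a * h a) (∫ t in a..c, g t * h t))
    have := norm_sub_le (φ c * h c) (φ a * h a)
    have : 0 ≤ H * G + H₁ * G := by positivity
    nlinarith
  rw [e1]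
  exact (norm_add_le _ _).trans (add_le_add b1 b4)

end Oscillation

/-! ### Continuity and holomorphy of integrals whose L¹ factor depends on the parameter. -/

section ParametricIntegrals

variable {Λ : Set ℂ} {f : ℂ → ℝ → ℂ} {F : ℂ → HalfLineL1} {B : ℝ}

theorem integrable_bounded_mul {φ : ℝ → ℂ} (hm : Measurable φ) (hB : ∀ t, ‖φ t‖ ≤ B)
    {g : ℝ → ℂ} (hg : IntegrableOn g (Ici 0)) : IntegrableOn (fun t => φ t * g t) (Ici 0) :=
  hg.bdd_mul hm.aestronglyMeasurable (Eventually.of_forall hB)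

theorem HalfLineL1.integrableOn (g : HalfLineL1) : IntegrableOn (g : ℝ → ℂ) (Ici 0) :=
  L1.integrable_coeFn g

theorem HalfLineL1.measurable (g : HalfLineL1) : Measurable (g : ℝ → ℂ) :=
  (Lp.stronglyMeasurable g).measurable

theorem norm_integral_bounded_mul_le {φ : ℝ → ℂ} (hB : ∀ t, ‖φ t‖ ≤ B) (g : HalfLineL1) :
    ‖∫ t in Ici 0, φ t * g t‖ ≤ B * ‖g‖ := by
  rw [L1.norm_eq_integral_norm, ← integral_const_mul]
  refine norm_integral_le_of_norm_le (g.integrableOn.norm.const_mul B) ?_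
  refine Eventually.of_forall fun t => ?_
  rw [norm_mul]
  exact mul_le_mul_of_nonneg_right (hB t) (norm_nonneg _)

/-- Integration against a fixed bounded function, as a functional on `L[0, ∞)`. -/
noncomputable def boundedPairing (φ : ℝ → ℂ) (hm : Measurable φ) (hB : ∀ t, ‖φ t‖ ≤ B) :
    HalfLineL1 →L[ℂ] ℂ :=
  LinearMap.mkContinuous
    { toFun := fun g => ∫ t in Ici 0, φ t * g t
      map_add' := fun g h => by
        rw [← integral_add (integrable_bounded_mul hm hB g.integrableOn)
          (integrable_bounded_mul hm hB h.integrableOn)]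
        refine integral_congr_ae ?_
        filter_upwards [Lp.coeFn_add g h] with t ht
        rw [ht, Pi.add_apply, mul_add]
      map_smul' := fun c g => by
        rw [RingHom.id_apply, smul_eq_mul, ← integral_const_mul]
        refine integral_congr_ae ?_
        filter_upwards [Lp.coeFn_smul c g] with t ht
        rw [ht, Pi.smul_apply, smul_eq_mul]; ring } B
    fun g => norm_integral_bounded_mul_le hB g

/-- `F z` is split as `F z₀` plus an increment. With the fixed factor `F z₀` dominated convergence
applies, and the increment contributes at most B times its L¹ norm. -/
theorem continuousOn_integral_mul (hB : ∀ z ∈ Λ, ∀ t, ‖f z t‖ ≤ B)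
    (hm : ∀ z, Measurable (f z)) (hf : ∀ t, ContinuousOn (fun z => f z t) Λ)
    (hF : ContinuousOn F Λ) :
    ContinuousOn (fun z => ∫ t in Ici 0, f z t * F z t) Λ := by
  intro z₀ hz₀
  have h1 : Tendsto (fun z => ∫ t in Ici 0, f z t * F z₀ t) (𝓝[Λ] z₀)
      (𝓝 (∫ t in Ici 0, f z₀ t * F z₀ t)) := by
    refine tendsto_integral_filter_of_dominated_convergence (fun t => B * ‖F z₀ t‖) ?_ ?_ ?_ ?_
    · exact Eventually.of_forall fun z =>
        ((hm z).mul (F z₀).measurable).aestronglyMeasurable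
    · filter_upwards [self_mem_nhdsWithin] with z hz
      refine Eventually.of_forall fun t => ?_
      rw [norm_mul]
      exact mul_le_mul_of_nonneg_right (hB z hz t) (norm_nonneg _)
    · exact (F z₀).integrableOn.norm.const_mul B
    · exact Eventually.of_forall fun t => (hf t z₀ hz₀).mul_const _
  have h2 : Tendsto (fun z => ∫ t in Ici 0, f z t * (F z - F z₀ : HalfLineL1) t) (𝓝[Λ] z₀)
      (𝓝 0) := by
    have h3 : Tendsto (fun z => B * ‖F z - F z₀‖) (𝓝[Λ] z₀) (𝓝 0) := by
      have := (hF z₀ hz₀).sub_const (F z₀)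
      simpa using this.norm.const_mul B
    refine squeeze_zero_norm' ?_ h3
    filter_upwards [self_mem_nhdsWithin] with z hz using norm_integral_bounded_mul_le (hB z hz) _
  have h4 := h1.add h2
  rw [add_zero] at h4
  refine h4.congr' ?_
  filter_upwards [self_mem_nhdsWithin] with z hz
  rw [← integral_add (integrable_bounded_mul (hm z) (hB z hz) (F z₀).integrableOn)
    (integrable_bounded_mul (hm z) (hB z hz) (HalfLineL1.integrableOn _))]
  refine integral_congr_ae ?_
  filter_upwards [Lp.coeFn_sub (F z) (F z₀)] with t ht
  rw [ht, Pi.sub_apply]; ring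

/-- The product is expanded around `z₀` as f(z₀)F(z) + f(z)F(z₀) + (f(z) - f(z₀))(F(z) - F(z₀)) -
f(z₀)F(z₀). The first term is a bounded functional of F, the second is differentiated under the
integral, and the third is o(z - z₀) because f is Lipschitz in z uniformly in t and F is continuous.
-/
theorem differentiableOn_integral_mul (hΛ : IsOpen Λ) (hB : ∀ z ∈ Λ, ∀ t, ‖f z t‖ ≤ B)
    (hm : ∀ z, Measurable (f z)) (hf : ∀ t, DifferentiableOn ℂ (fun z => f z t) Λ)
    (hF : DifferentiableOn ℂ F Λ) :
    DifferentiableOn ℂ (fun z => ∫ t in Ici 0, f z t * F z t) Λ := by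
  intro z₀ hz₀
  obtain ⟨δ, hδ, hball⟩ : ∃ δ > 0, Metric.closedBall z₀ (2 * δ) ⊆ Λ := by
    obtain ⟨ε, hε, h⟩ := Metric.isOpen_iff.1 hΛ z₀ hz₀
    exact ⟨ε / 4, by positivity, (Metric.closedBall_subset_ball (by linarith)).trans h⟩
  have hsub : Metric.ball z₀ δ ⊆ Λ :=
    Metric.ball_subset_closedBall.trans ((Metric.closedBall_subset_closedBall (by linarith)).trans
      hball)
  -- Cauchy's estimate on discs of radius δ; the closed disc of radius 2δ was placed inside Λ to
  -- make room for them.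
  have hderiv : ∀ t, ∀ z ∈ Metric.ball z₀ δ, ‖deriv (fun z => f z t) z‖ ≤ B / δ := by
    intro t z hz
    have hzb : Metric.closedBall z δ ⊆ Λ := by
      refine (Metric.closedBall_subset_closedBall' ?_).trans hball
      have := Metric.mem_ball.1 hz
      linarith
    refine Complex.norm_deriv_le_of_forall_mem_sphere_norm_le hδ ?_ fun w hw =>
      hB w (hzb (Metric.sphere_subset_closedBall hw)) t
    exact DifferentiableOn.diffContOnCl_ball ((hf t).mono hzb) le_rfl |>.mono le_rfl
  have hlip : ∀ t, ∀ z ∈ Metric.ball z₀ δ, ‖f z t - f z₀ t‖ ≤ B / δ * ‖z - z₀‖ := by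
    intro t z hz
    exact (convex_ball z₀ δ).norm_image_sub_le_of_norm_deriv_le
      (fun w hw => (hf t).differentiableAt (hΛ.mem_nhds (hsub hw))) (hderiv t)
      (Metric.mem_ball_self hδ) hz
  have d1 : DifferentiableAt ℂ (fun z => ∫ t in Ici 0, f z₀ t * F z t) z₀ :=
    (boundedPairing (f z₀) (hm z₀) (hB z₀ hz₀)).differentiableAt.comp z₀
      (hF.differentiableAt (hΛ.mem_nhds hz₀))
  have d2 : DifferentiableAt ℂ (fun z => ∫ t in Ici 0, f z t * F z₀ t) z₀ := by
    -- The z-derivative is measurable in t as a pointwise limit of difference quotients along a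
    -- sequence of increments.
    have hmd : Measurable fun t => deriv (fun z => f z t) z₀ := by
      obtain ⟨u, hu⟩ : ∃ u : ℕ → ℂ, (∀ k, u k ≠ 0) ∧ Tendsto u atTop (𝓝 0) :=
        ⟨fun k => ((1 / ((k : ℝ) + 1) : ℝ) : ℂ), fun k => by
          simpa using by exact_mod_cast (Nat.succ_ne_zero k), by
          have := (tendsto_one_div_add_atTop_nhds_zero_nat (𝕜 := ℝ))
          exact_mod_cast (Complex.continuous_ofReal.tendsto 0).comp this⟩
      refine measurable_of_tendsto_metrizable (f := fun k t =>
        (u k)⁻¹ * (f (z₀ + u k) t - f z₀ t)) (fun k => by fun_prop) ?_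
      rw [tendsto_pi_nhds]
      intro t
      have hd := ((hf t).differentiableAt (hΛ.mem_nhds hz₀)).hasDerivAt
      rw [hasDerivAt_iff_tendsto_slope_zero] at hd
      refine hd.comp (tendsto_nhdsWithin_iff.2 ⟨hu.2, Eventually.of_forall hu.1⟩)
    refine (hasDerivAt_integral_of_dominated_loc_of_deriv_le
      (F := fun z t => f z t * F z₀ t) (F' := fun z t => deriv (fun z => f z t) z * F z₀ t)
      (bound := fun t => B / δ * ‖F z₀ t‖) (Metric.ball_mem_nhds z₀ hδ) ?_ ?_ ?_ ?_ ?_ ?_).2.differentiableAt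
    · exact Eventually.of_forall fun z => ((hm z).mul (F z₀).measurable).aestronglyMeasurable
    · exact integrable_bounded_mul (hm z₀) (hB z₀ hz₀) (F z₀).integrableOn
    · exact (hmd.mul (F z₀).measurable).aestronglyMeasurable
    · refine Eventually.of_forall fun t z hz => ?_
      rw [norm_mul]
      exact mul_le_mul_of_nonneg_right (hderiv t z hz) (norm_nonneg _)
    · exact (F z₀).integrableOn.norm.const_mul _
    · refine Eventually.of_forall fun t z hz => ?_
      exact ((hf t).differentiableAt (hΛ.mem_nhds (hsub hz))).hasDerivAt.mul_const _
  have d3 : DifferentiableAt ℂ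
      (fun z => ∫ t in Ici 0, (f z t - f z₀ t) * (F z - F z₀ : HalfLineL1) t) z₀ := by
    refine HasDerivAt.differentiableAt (f' := 0) ?_
    rw [hasDerivAt_iff_isLittleO]
    have hc : Tendsto (fun z => B / δ * ‖F z - F z₀‖) (𝓝 z₀) (𝓝 0) := by
      have := ((hF.differentiableAt (hΛ.mem_nhds hz₀)).continuousAt.tendsto).sub_const (F z₀)
      simpa using this.norm.const_mul (B / δ)
    rw [Asymptotics.isLittleO_iff]
    intro c hc0
    filter_upwards [Metric.ball_mem_nhds z₀ hδ, hc.eventually_lt_const hc0] with z hz hzc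
    simp only [sub_self, zero_mul, integral_zero, sub_zero, smul_zero]
    refine (norm_integral_bounded_mul_le (hlip · z hz) _).trans ?_
    rw [mul_right_comm]
    exact mul_le_mul_of_nonneg_right hzc.le (norm_nonneg _)
  refine (((d1.add d2).add d3).sub_const (∫ t in Ici 0, f z₀ t * F z₀ t)).congr_of_eventuallyEq
    ?_ |>.differentiableWithinAt
  filter_upwards [hΛ.mem_nhds hz₀] with z hz
  simp only [Pi.add_apply]
  have i1 := integrable_bounded_mul (hm z₀) (hB z₀ hz₀) (F z).integrableOn
  have i2 := integrable_bounded_mul (hm z) (hB z hz) (F z₀).integrableOn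
  have i3 := integrable_bounded_mul (hm z₀) (hB z₀ hz₀) (F z₀).integrableOn
  have i4 := integrable_bounded_mul ((hm z).sub (hm z₀)) (B := B + B)
    (fun t => (norm_sub_le _ _).trans (add_le_add (hB z hz t) (hB z₀ hz₀ t)))
    (F z - F z₀).integrableOn
  simp only [Pi.sub_apply] at i4
  have i5 : IntegrableOn (fun t => f z₀ t * F z t + f z t * F z₀ t) (Ici 0) := i1.add i2
  have i6 : IntegrableOn (fun t => f z₀ t * F z t + f z t * F z₀ t +
    (f z t - f z₀ t) * (F z - F z₀ : HalfLineL1) t) (Ici 0) := i5.add i4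
  rw [← integral_add i1 i2, ← integral_add i5 i4, ← integral_sub i6 i3]
  refine integral_congr_ae ?_
  filter_upwards [Lp.coeFn_sub (F z) (F z₀)] with t ht
  simp only [ht, Pi.sub_apply]; ring

end ParametricIntegrals

/-! ### Neumann series for integral equations and their dependence on a parameter. -/

section Neumann

variable {n : ℕ}

/-- The integral operator `(K w)_j(x) = ∫_0^∞ E_j(x, t) (R(t) w(t))_j dt`. -/
noncomputable def kernelOp (E : Fin n → ℝ → ℝ → ℂ) (R : Fin n → Fin n → ℝ → ℂ)
    (w : ℝ → Fin n → ℂ) (x : ℝ) (j : Fin n) : ℂ :=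
  ∫ t in Ici 0, E j x t * ∑ l, R j l t * w t l

/-- The terms of the Neumann series of `w = w₀ + K w`. -/
noncomputable def neumannTerm (E : Fin n → ℝ → ℝ → ℂ) (R : Fin n → Fin n → ℝ → ℂ)
    (w₀ : ℝ → Fin n → ℂ) : ℕ → ℝ → Fin n → ℂ
  | 0 => w₀
  | m + 1 => kernelOp E R (neumannTerm E R w₀ m)

/-- The sum of the Neumann series of `w = w₀ + K w`. -/
noncomputable def neumannSum (E : Fin n → ℝ → ℝ → ℂ) (R : Fin n → Fin n → ℝ → ℂ)
    (w₀ : ℝ → Fin n → ℂ) (x : ℝ) (j : Fin n) : ℂ :=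
  ∑' m, neumannTerm E R w₀ m x j

/-- The sum of the absolute values of the entries of a matrix function. -/
noncomputable def entrySum (R : Fin n → Fin n → ℝ → ℂ) (t : ℝ) : ℝ := ∑ j, ∑ l, ‖R j l t‖

theorem entrySum_nonneg (R : Fin n → Fin n → ℝ → ℂ) (t : ℝ) : 0 ≤ entrySum R t :=
  Finset.sum_nonneg fun _ _ => Finset.sum_nonneg fun _ _ => norm_nonneg _

theorem integrableOn_entrySum {R : Fin n → Fin n → ℝ → ℂ} {S : Set ℝ}
    (hR : ∀ j l, IntegrableOn (R j l) S) : IntegrableOn (entrySum R) S :=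
  integrable_finsetSum _ fun j _ => integrable_finsetSum _ fun l _ => (hR j l).norm

theorem norm_sum_mul_le {R : Fin n → Fin n → ℝ → ℂ} {v : Fin n → ℂ} {c t : ℝ}
    (hv : ∀ l, ‖v l‖ ≤ c) (j : Fin n) : ‖∑ l, R j l t * v l‖ ≤ entrySum R t * c := by
  have hc : 0 ≤ c := (norm_nonneg _).trans (hv j)
  calc ‖∑ l, R j l t * v l‖ ≤ ∑ l, ‖R j l t‖ * c := by
        refine norm_sum_le_of_le _ fun l _ => ?_
        rw [norm_mul]
        exact mul_le_mul_of_nonneg_left (hv l) (norm_nonneg _)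
    _ = (∑ l, ‖R j l t‖) * c := by rw [Finset.sum_mul]
    _ ≤ entrySum R t * c := by
        refine mul_le_mul_of_nonneg_right ?_ hc
        exact Finset.single_le_sum (f := fun j => ∑ l, ‖R j l t‖)
          (fun _ _ => Finset.sum_nonneg fun _ _ => norm_nonneg _) (Finset.mem_univ j)

section Fixed

variable {E : Fin n → ℝ → ℝ → ℂ} {R : Fin n → Fin n → ℝ → ℂ} {w₀ w : ℝ → Fin n → ℂ}
  {S : Set ℝ} {B D : ℝ}

theorem measurable_kernelOp (hE : ∀ j, Measurable (Function.uncurry (E j)))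
    (hR : ∀ j l, Measurable (R j l)) (hw : ∀ l, Measurable fun t => w t l) (j : Fin n) :
    Measurable fun x => kernelOp E R w x j := by
  refine StronglyMeasurable.measurable ?_
  unfold kernelOp
  refine StronglyMeasurable.integral_prod_right (f := fun x t => E j x t * ∑ l, R j l t * w t l) ?_
  refine Measurable.stronglyMeasurable ?_
  refine (hE j).mul ?_
  refine Finset.measurable_sum _ fun l _ => ?_
  exact ((hR j l).comp measurable_snd).mul ((hw l).comp measurable_snd)

theorem measurable_neumannTerm (hE : ∀ j, Measurable (Function.uncurry (E j)))
    (hR : ∀ j l, Measurable (R j l)) (hw : ∀ l, Measurable fun t => w₀ t l) (m : ℕ) (j : Fin n) :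
    Measurable fun x => neumannTerm E R w₀ m x j := by
  induction m generalizing j with
  | zero => exact hw j
  | succ m ih => exact measurable_kernelOp hE hR ih j

theorem summable_neumannTerm (hD : ∀ m, ∀ x ∈ S, ∀ j, ‖neumannTerm E R w₀ m x j‖ ≤ D * (1 / 2) ^ m)
    {x : ℝ} (hx : x ∈ S) (j : Fin n) : Summable fun m => neumannTerm E R w₀ m x j :=
  Summable.of_norm_bounded (summable_geometric_two.mul_left D) fun m => hD m x hx j

theorem norm_neumannSum_le (hD : ∀ m, ∀ x ∈ S, ∀ j, ‖neumannTerm E R w₀ m x j‖ ≤ D * (1 / 2) ^ m)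
    {x : ℝ} (hx : x ∈ S) (j : Fin n) : ‖neumannSum E R w₀ x j‖ ≤ 2 * D := by
  refine tsum_of_norm_bounded ?_ fun m => hD m x hx j
  simpa [mul_comm] using hasSum_geometric_two.mul_left D

theorem norm_neumannSum_sub_le (hD : ∀ m, ∀ x ∈ S, ∀ j, ‖neumannTerm E R w₀ m x j‖ ≤ D * (1 / 2) ^ m)
    {D' : ℝ} {x : ℝ} (hx : x ∈ S) (j : Fin n)
    (hD' : ∀ m, ‖neumannTerm E R w₀ (m + 1) x j‖ ≤ D' * (1 / 2) ^ m) :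
    ‖neumannSum E R w₀ x j - w₀ x j‖ ≤ 2 * D' := by
  have := (summable_neumannTerm hD hx j).tsum_eq_zero_add
  rw [neumannSum, this]
  simp only [neumannTerm, add_sub_cancel_left]
  refine tsum_of_norm_bounded ?_ hD'
  simpa [mul_comm] using hasSum_geometric_two.mul_left D'

/-- Convergence is known on `S` only. After cutting off with the indicator, the partial sums
converge everywhere, and measurability passes to the limit. -/
theorem measurable_indicator_neumannSum (hS : MeasurableSet S)
    (hE : ∀ j, Measurable (Function.uncurry (E j)))
    (hR : ∀ j l, Measurable (R j l)) (hw : ∀ l, Measurable fun t => w₀ t l)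
    (hD : ∀ m, ∀ x ∈ S, ∀ j, ‖neumannTerm E R w₀ m x j‖ ≤ D * (1 / 2) ^ m) (j : Fin n) :
    Measurable (S.indicator fun x => neumannSum E R w₀ x j) := by
  refine measurable_of_tendsto_metrizable (f := fun N => S.indicator fun x =>
    ∑ m ∈ Finset.range N, neumannTerm E R w₀ m x j) (fun N => ?_) ?_
  · exact (Finset.measurable_sum _ fun m _ => measurable_neumannTerm hE hR hw m j).indicator hS
  · rw [tendsto_pi_nhds]
    intro x
    by_cases hx : x ∈ S
    · simp only [indicator_of_mem hx]
      exact (summable_neumannTerm hD hx j).hasSum.tendsto_sum_nat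
    · simp [indicator_of_notMem hx]

/-- The Neumann series solves the integral equation. -/
theorem neumannSum_eq (hE : ∀ j, Measurable (Function.uncurry (E j)))
    (hR : ∀ j l, Measurable (R j l)) (hRi : ∀ j l, IntegrableOn (R j l) (Ici 0))
    (hw : ∀ l, Measurable fun t => w₀ t l)
    (hEB : ∀ x ∈ S, ∀ j t, ‖E j x t‖ ≤ B) (hES : ∀ x ∈ S, ∀ j, ∀ t ∉ S, E j x t = 0)
    (hD : ∀ m, ∀ x ∈ S, ∀ j, ‖neumannTerm E R w₀ m x j‖ ≤ D * (1 / 2) ^ m)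
    {x : ℝ} (hx : x ∈ S) (j : Fin n) :
    neumannSum E R w₀ x j = w₀ x j + kernelOp E R (neumannSum E R w₀) x j := by
  have h1 := (summable_neumannTerm hD hx j).tsum_eq_zero_add
  rw [neumannSum, h1]
  simp only [neumannTerm]
  congr 1
  have hB0 : 0 ≤ B := (norm_nonneg _).trans (hEB x hx j x)
  have hγ := integrableOn_entrySum hRi
  -- Sum and integral are interchanged with the majorant Bγ(t)D2^{-m}, γ being the entry sum of R.
  -- The kernel vanishes off `S`, so the series matters only where it is known to converge.
  refine (hasSum_integral_of_dominated_convergence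
    (fun m t => B * (entrySum R t * (D * (1 / 2) ^ m))) ?_ ?_ ?_ ?_ ?_).tsum_eq
  · intro m
    refine Measurable.aestronglyMeasurable ?_
    refine ((hE j).of_uncurry_left).mul ?_
    exact Finset.measurable_sum _ fun l _ => (hR j l).mul (measurable_neumannTerm hE hR hw m l)
  · intro m
    refine Eventually.of_forall fun t => ?_
    by_cases ht : t ∈ S
    · rw [norm_mul]
      exact mul_le_mul (hEB x hx j t) (norm_sum_mul_le (hD m t ht) j) (norm_nonneg _) hB0
    · rw [hES x hx j t ht, zero_mul, norm_zero]
      have hD0 : 0 ≤ D * (1 / 2) ^ m := (norm_nonneg _).trans (hD m x hx j)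
      have := entrySum_nonneg R t
      positivity
  · refine Eventually.of_forall fun t => ?_
    exact ((summable_geometric_two.mul_left D).mul_left _).mul_left _
  · simp_rw [tsum_mul_left]
    exact (hγ.mul_const _).const_mul _
  · refine Eventually.of_forall fun t => ?_
    by_cases ht : t ∈ S
    · refine HasSum.mul_left _ ?_
      exact hasSum_sum fun l _ => ((summable_neumannTerm hD ht l).hasSum).mul_left _
    · simp only [hES x hx j t ht, zero_mul]
      exact hasSum_zero

end Fixed

section Parameter

variable {E : ℂ → Fin n → ℝ → ℝ → ℂ} {R : Fin n → Fin n → ℂ → HalfLineL1}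
  {w₀ : ℂ → ℝ → Fin n → ℂ} {S : Set ℝ} {Λ : Set ℂ} {B D : ℝ}

/-- Each summand becomes a bounded function times a single L¹ class, which is the form that the
lemmas on parametric integrals accept. -/
theorem kernelOp_eq_sum {E : Fin n → ℝ → ℝ → ℂ} {R : Fin n → Fin n → HalfLineL1}
    {w : ℝ → Fin n → ℂ} (hE : ∀ j, Measurable (Function.uncurry (E j)))
    (hw : ∀ l, Measurable fun t => w t l) {x : ℝ} {j : Fin n}
    (hB : ∀ l t, ‖E j x t * w t l‖ ≤ B) :
    kernelOp E (fun j l => R j l) w x j = ∑ l, ∫ t in Ici 0, (E j x t * w t l) * R j l t := by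
  unfold kernelOp
  have hi : ∀ l ∈ Finset.univ, Integrable (fun t => (E j x t * w t l) * R j l t)
      (volume.restrict (Ici 0)) := fun l _ =>
    integrable_bounded_mul ((hE j).of_uncurry_left.mul (hw l)) (hB l) (R j l).integrableOn
  rw [← integral_finsetSum _ hi]
  congr 1; ext t
  rw [Finset.mul_sum]
  exact Finset.sum_congr rfl fun l _ => by ring

theorem norm_kernel_mul_le {E : Fin n → ℝ → ℝ → ℂ} {w : ℝ → Fin n → ℂ} {c : ℝ}
    (hEB : ∀ x ∈ S, ∀ j t, ‖E j x t‖ ≤ B) (hES : ∀ x ∈ S, ∀ j, ∀ t ∉ S, E j x t = 0)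
    (hw : ∀ x ∈ S, ∀ j, ‖w x j‖ ≤ c) {x : ℝ} (hx : x ∈ S) (j l : Fin n) (t : ℝ) :
    ‖E j x t * w t l‖ ≤ B * c := by
  have hB0 : 0 ≤ B := (norm_nonneg _).trans (hEB x hx j t)
  have hc0 : 0 ≤ c := (norm_nonneg _).trans (hw x hx j)
  by_cases ht : t ∈ S
  · rw [norm_mul]
    exact mul_le_mul (hEB x hx j t) (hw t ht l) (norm_nonneg _) hB0
  · rw [hES x hx j t ht, zero_mul, norm_zero]; positivity

theorem continuousOn_neumannTerm (hE : ∀ z j, Measurable (Function.uncurry (E z j)))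
    (hw : ∀ z l, Measurable fun t => w₀ z t l)
    (hEB : ∀ z ∈ Λ, ∀ x ∈ S, ∀ j t, ‖E z j x t‖ ≤ B)
    (hES : ∀ z, ∀ x ∈ S, ∀ j, ∀ t ∉ S, E z j x t = 0)
    (hD : ∀ z ∈ Λ, ∀ m, ∀ x ∈ S, ∀ j,
      ‖neumannTerm (E z) (fun j l => R j l z) (w₀ z) m x j‖ ≤ D * (1 / 2) ^ m)
    (hEc : ∀ x ∈ S, ∀ j t, ContinuousOn (fun z => E z j x t) Λ)
    (hwc : ∀ x ∈ S, ∀ j, ContinuousOn (fun z => w₀ z x j) Λ)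
    (hRc : ∀ j l, ContinuousOn (R j l) Λ) (m : ℕ) {x : ℝ} (hx : x ∈ S) (j : Fin n) :
    ContinuousOn (fun z => neumannTerm (E z) (fun j l => R j l z) (w₀ z) m x j) Λ := by
  induction m generalizing x j with
  | zero => exact hwc x hx j
  | succ m ih =>
    have hm : ∀ z l, Measurable fun t => neumannTerm (E z) (fun j l => R j l z) (w₀ z) m t l :=
      fun z l => measurable_neumannTerm (hE z) (fun j l => (R j l z).measurable) (hw z) m l
    have hb : ∀ z ∈ Λ, ∀ l t, ‖E z j x t * neumannTerm (E z) (fun j l => R j l z) (w₀ z) m t l‖ ≤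
        B * (D * (1 / 2) ^ m) := fun z hz l t =>
      norm_kernel_mul_le (hEB z hz) (hES z) (hD z hz m) hx j l t
    have key : ContinuousOn (fun z => ∑ l, ∫ t in Ici 0,
        (E z j x t * neumannTerm (E z) (fun j l => R j l z) (w₀ z) m t l) * R j l z t) Λ := by
      refine continuousOn_finsetSum _ fun l _ => ?_
      refine continuousOn_integral_mul (fun z hz t => hb z hz l t)
        (fun z => (hE z j).of_uncurry_left.mul (hm z l)) (fun t => ?_) (hRc j l)
      by_cases ht : t ∈ S
      · exact (hEc x hx j t).mul (ih ht l)
      · simp only [hES _ x hx j t ht, zero_mul]; exact continuousOn_const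
    refine key.congr fun z hz => ?_
    exact kernelOp_eq_sum (R := fun j l => R j l z) (hE z) (hm z) (hb z hz)

theorem differentiableOn_neumannTerm (hΛ : IsOpen Λ)
    (hE : ∀ z j, Measurable (Function.uncurry (E z j)))
    (hw : ∀ z l, Measurable fun t => w₀ z t l)
    (hEB : ∀ z ∈ Λ, ∀ x ∈ S, ∀ j t, ‖E z j x t‖ ≤ B)
    (hES : ∀ z, ∀ x ∈ S, ∀ j, ∀ t ∉ S, E z j x t = 0)
    (hD : ∀ z ∈ Λ, ∀ m, ∀ x ∈ S, ∀ j,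
      ‖neumannTerm (E z) (fun j l => R j l z) (w₀ z) m x j‖ ≤ D * (1 / 2) ^ m)
    (hEc : ∀ x ∈ S, ∀ j t, DifferentiableOn ℂ (fun z => E z j x t) Λ)
    (hwc : ∀ x ∈ S, ∀ j, DifferentiableOn ℂ (fun z => w₀ z x j) Λ)
    (hRc : ∀ j l, DifferentiableOn ℂ (R j l) Λ) (m : ℕ) {x : ℝ} (hx : x ∈ S) (j : Fin n) :
    DifferentiableOn ℂ (fun z => neumannTerm (E z) (fun j l => R j l z) (w₀ z) m x j) Λ := by
  induction m generalizing x j with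
  | zero => exact hwc x hx j
  | succ m ih =>
    have hm : ∀ z l, Measurable fun t => neumannTerm (E z) (fun j l => R j l z) (w₀ z) m t l :=
      fun z l => measurable_neumannTerm (hE z) (fun j l => (R j l z).measurable) (hw z) m l
    have hb : ∀ z ∈ Λ, ∀ l t, ‖E z j x t * neumannTerm (E z) (fun j l => R j l z) (w₀ z) m t l‖ ≤
        B * (D * (1 / 2) ^ m) := fun z hz l t =>
      norm_kernel_mul_le (hEB z hz) (hES z) (hD z hz m) hx j l t
    have key : DifferentiableOn ℂ (fun z => ∑ l, ∫ t in Ici 0,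
        (E z j x t * neumannTerm (E z) (fun j l => R j l z) (w₀ z) m t l) * R j l z t) Λ := by
      refine DifferentiableOn.fun_sum fun l _ => ?_
      refine differentiableOn_integral_mul hΛ (fun z hz t => hb z hz l t)
        (fun z => (hE z j).of_uncurry_left.mul (hm z l)) (fun t => ?_) (hRc j l)
      by_cases ht : t ∈ S
      · exact (hEc x hx j t).mul (ih ht l)
      · simp only [hES _ x hx j t ht, zero_mul]; exact differentiableOn_const _
    refine key.congr fun z hz => ?_
    exact kernelOp_eq_sum (R := fun j l => R j l z) (hE z) (hm z) (hb z hz)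

theorem continuousOn_neumannSum
    (hD : ∀ z ∈ Λ, ∀ m, ∀ x ∈ S, ∀ j,
      ‖neumannTerm (E z) (fun j l => R j l z) (w₀ z) m x j‖ ≤ D * (1 / 2) ^ m)
    {x : ℝ} (hx : x ∈ S) (j : Fin n)
    (h : ∀ m, ContinuousOn (fun z => neumannTerm (E z) (fun j l => R j l z) (w₀ z) m x j) Λ) :
    ContinuousOn (fun z => neumannSum (E z) (fun j l => R j l z) (w₀ z) x j) Λ :=
  continuousOn_tsum h (summable_geometric_two.mul_left D) fun m z hz => hD z hz m x hx j

theorem differentiableOn_neumannSum (hΛ : IsOpen Λ)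
    (hD : ∀ z ∈ Λ, ∀ m, ∀ x ∈ S, ∀ j,
      ‖neumannTerm (E z) (fun j l => R j l z) (w₀ z) m x j‖ ≤ D * (1 / 2) ^ m)
    {x : ℝ} (hx : x ∈ S) (j : Fin n)
    (h : ∀ m, DifferentiableOn ℂ
      (fun z => neumannTerm (E z) (fun j l => R j l z) (w₀ z) m x j) Λ) :
    DifferentiableOn ℂ (fun z => neumannSum (E z) (fun j l => R j l z) (w₀ z) x j) Λ :=
  Complex.differentiableOn_tsum_of_summable_norm (summable_geometric_two.mul_left D) h hΛ
    fun m z hz => hD z hz m x hx j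

end Parameter

end Neumann

/-! ### Volterra operators in an exponentially weighted norm. -/

section Volterra

theorem uIoc_subset_Ici_zero {α x : ℝ} (hα : 0 ≤ α) (hx : 0 ≤ x) : uIoc α x ⊆ Ici 0 :=
  fun _ ht => (le_min hα hx).trans ht.1.le

theorem uIcc_subset_Ici_zero {α x : ℝ} (hα : 0 ≤ α) (hx : 0 ≤ x) : uIcc α x ⊆ Ici 0 :=
  fun _ ht => (le_min hα hx).trans ht.1

/-- The weight `exp (2 B |∫_α^x γ|)` absorbs integration against `γ`. -/
theorem integral_mul_exp_weight_le {γ : ℝ → ℝ} (hγ : IntegrableOn γ (Ici 0)) (hγ0 : ∀ t, 0 ≤ γ t)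
    {B α x : ℝ} (hB : 0 < B) (hα : 0 ≤ α) (hx : 0 ≤ x) :
    IntegrableOn (fun t => γ t * Real.exp (2 * B * |∫ s in α..t, γ s|)) (uIoc α x) ∧
    ∫ t in uIoc α x, γ t * Real.exp (2 * B * |∫ s in α..t, γ s|) ≤
      Real.exp (2 * B * |∫ s in α..x, γ s|) / (2 * B) := by
  have hi : IntervalIntegrable γ volume α x :=
    intervalIntegrable_iff.2 (hγ.mono_set (uIoc_subset_Ici_zero hα hx))
  have hc : ContinuousOn (fun t => ∫ s in α..t, γ s) (uIcc α x) :=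
    intervalIntegral.continuousOn_primitive_interval' hi left_mem_uIcc
  have hint : IntervalIntegrable (fun t => γ t * Real.exp (2 * B * |∫ s in α..t, γ s|)) volume α x :=
    hi.mul_continuousOn (Real.continuous_exp.comp_continuousOn (continuousOn_const.mul hc.abs))
  refine ⟨intervalIntegrable_iff.1 hint, ?_⟩
  -- The integrand is the exact derivative of exp(2Bσ∫γ). The sign σ is 1 to the right of α and -1
  -- to its left, and removes the absolute value in the weight.
  have key : ∀ σ : ℝ, ∫ t in α..x, Real.exp (2 * B * σ * ∫ s in α..t, γ s) * (2 * B * σ * γ t) =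
      Real.exp (2 * B * σ * ∫ s in α..x, γ s) - 1 := by
    intro σ
    have hiC : IntervalIntegrable (fun t => (γ t : ℂ)) volume α x := by
      rw [intervalIntegrable_iff] at *; exact hi.ofReal
    have h := (((HasACDeriv.integral hiC left_mem_uIcc).const_mul
      ((2 * B * σ : ℝ) : ℂ)).cexp).integral_eq_sub
    simp only [intervalIntegral.integral_same, mul_zero, Complex.exp_zero,
      intervalIntegral.integral_ofReal, ← Complex.ofReal_mul, ← Complex.ofReal_exp] at h
    exact_mod_cast h
  rw [le_div_iff₀ (by positivity), mul_comm, ← integral_const_mul]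
  rcases le_total α x with h | h
  · have hk := key 1
    rw [intervalIntegral.integral_of_le h] at hk
    rw [uIoc_of_le h, abs_of_nonneg (intervalIntegral.integral_nonneg h fun _ _ => hγ0 _)]
    have : ∫ t in Ioc α x, 2 * B * (γ t * Real.exp (2 * B * |∫ s in α..t, γ s|)) =
        ∫ t in Ioc α x, Real.exp (2 * B * 1 * ∫ s in α..t, γ s) * (2 * B * 1 * γ t) := by
      refine setIntegral_congr_fun measurableSet_Ioc fun t ht => ?_
      simp only [abs_of_nonneg (intervalIntegral.integral_nonneg ht.1.le fun s _ => hγ0 s)]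
      ring_nf
    rw [this, hk, mul_one]; linarith
  · have hneg : ∀ t, t ≤ α → ∫ s in α..t, γ s ≤ 0 := fun t ht => by
      rw [intervalIntegral.integral_symm]
      exact neg_nonpos.2 (intervalIntegral.integral_nonneg ht fun _ _ => hγ0 _)
    have hk := key (-1)
    rw [intervalIntegral.integral_of_ge h] at hk
    rw [uIoc_of_ge h, abs_of_nonpos (hneg x h)]
    have : ∫ t in Ioc x α, 2 * B * (γ t * Real.exp (2 * B * |∫ s in α..t, γ s|)) =
        -∫ t in Ioc x α, Real.exp (2 * B * -1 * ∫ s in α..t, γ s) * (2 * B * -1 * γ t) := by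
      rw [← integral_neg]
      refine setIntegral_congr_fun measurableSet_Ioc fun t ht => ?_
      simp only [abs_of_nonpos (hneg t ht.2)]
      ring_nf
    rw [this, hk]
    have e : 2 * B * -1 * ∫ s in α..x, γ s = 2 * B * -∫ s in α..x, γ s := by ring
    rw [e]; linarith

variable {n : ℕ} {E : Fin n → ℝ → ℝ → ℂ} {R : Fin n → Fin n → ℝ → ℂ} {w₀ : ℝ → Fin n → ℂ}
  {S : Set ℝ} {B W α : ℝ}

/-- In the sup norm weighted by exp(2B|∫_α^x γ|), with γ the entry sum of R, the operator has norm
at most 1/2, whatever the size of the coefficient. The weight is bounded because γ is integrable on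
the half-line, which turns the weighted bound into a uniform one. -/
theorem norm_neumannTerm_le_of_volterra (hRi : ∀ j l, IntegrableOn (R j l) (Ici 0))
    (hα : 0 ≤ α) (hS : ∀ x ∈ S, 0 ≤ x) (hSα : ∀ x ∈ S, uIoc α x ⊆ S) (hB : 0 < B)
    (hEB : ∀ x ∈ S, ∀ j t, ‖E j x t‖ ≤ B) (hE0 : ∀ x ∈ S, ∀ j, ∀ t ∉ uIoc α x, E j x t = 0)
    (hw : ∀ x ∈ S, ∀ j, ‖w₀ x j‖ ≤ W) (m : ℕ) {x : ℝ} (hx : x ∈ S) (j : Fin n) :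
    ‖neumannTerm E R w₀ m x j‖ ≤
      W * Real.exp (2 * B * ∫ t in Ici 0, entrySum R t) * (1 / 2) ^ m := by
  have hγ := integrableOn_entrySum hRi
  have hγ0 := entrySum_nonneg R
  have hW0 : 0 ≤ W := (norm_nonneg _).trans (hw x hx j)
  have main : ∀ x ∈ S, ∀ j, ‖neumannTerm E R w₀ m x j‖ ≤
      W * (1 / 2) ^ m * Real.exp (2 * B * |∫ s in α..x, entrySum R s|) := by
    induction m with
    | zero =>
      intro x hx j
      refine (hw x hx j).trans ?_
      rw [pow_zero, mul_one]
      exact le_mul_of_one_le_right hW0 (Real.one_le_exp (by positivity))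
    | succ m ih =>
      intro x hx j
      obtain ⟨h1, h2⟩ := integral_mul_exp_weight_le hγ hγ0 hB hα (hS x hx)
      set φ : ℝ → ℝ := fun t => entrySum R t * Real.exp (2 * B * |∫ s in α..t, entrySum R s|)
        with hφ
      have hbd : ∀ t, ‖E j x t * ∑ l, R j l t * neumannTerm E R w₀ m t l‖ ≤
          (uIoc α x).indicator (fun t => B * (W * (1 / 2) ^ m) * φ t) t := by
        intro t
        by_cases ht : t ∈ uIoc α x
        · rw [indicator_of_mem ht, norm_mul]
          calc _ ≤ B * (entrySum R t * (W * (1 / 2) ^ m *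
                Real.exp (2 * B * |∫ s in α..t, entrySum R s|))) :=
                mul_le_mul (hEB x hx j t) (norm_sum_mul_le (ih t (hSα x hx ht)) j) (norm_nonneg _)
                  hB.le
            _ = _ := by simp only [hφ]; ring
        · rw [indicator_of_notMem ht, hE0 x hx j t ht, zero_mul, norm_zero]
      have hind : IntegrableOn ((uIoc α x).indicator fun t => B * (W * (1 / 2) ^ m) * φ t)
          (Ici 0) := by
        refine IntegrableOn.integrable_indicator ?_ measurableSet_uIoc |>.integrableOn
        exact h1.const_mul _
      calc ‖kernelOp E R (neumannTerm E R w₀ m) x j‖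
          ≤ ∫ t in Ici 0, (uIoc α x).indicator (fun t => B * (W * (1 / 2) ^ m) * φ t) t :=
            norm_integral_le_of_norm_le hind (Eventually.of_forall hbd)
        _ = B * (W * (1 / 2) ^ m) * ∫ t in uIoc α x, φ t := by
            rw [setIntegral_indicator measurableSet_uIoc,
              inter_eq_self_of_subset_right (uIoc_subset_Ici_zero hα (hS x hx)),
              integral_const_mul]
        _ ≤ B * (W * (1 / 2) ^ m) * (Real.exp (2 * B * |∫ s in α..x, entrySum R s|) / (2 * B)) :=
            mul_le_mul_of_nonneg_left h2 (by positivity)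
        _ = _ := by rw [pow_succ]; field_simp
  refine (main x hx j).trans ?_
  rw [mul_right_comm]
  refine mul_le_mul_of_nonneg_right (mul_le_mul_of_nonneg_left ?_ hW0) (by positivity)
  refine Real.exp_le_exp.2 (mul_le_mul_of_nonneg_left ?_ (by positivity))
  rw [intervalIntegral.abs_integral_eq_abs_integral_uIoc,
    abs_of_nonneg (integral_nonneg fun _ => hγ0 _)]
  exact setIntegral_mono_set hγ (Eventually.of_forall hγ0)
    (LE.le.eventuallyLE (uIoc_subset_Ici_zero hα (hS x hx)))

end Volterra

/-! ### Linear systems with summable coefficients: fundamental matrix, duality, uniqueness. -/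

section LinearSystems

variable {n : ℕ}

/-- The kernel of `φ ↦ ∫_α^x φ`. -/
noncomputable def signedKernel (α x t : ℝ) : ℂ :=
  (Ioc α x).indicator 1 t - (Ioc x α).indicator 1 t

theorem measurable_signedKernel (α : ℝ) : Measurable (Function.uncurry (signedKernel α)) := by
  have h1 : MeasurableSet {p : ℝ × ℝ | p.2 ∈ Ioc α p.1} :=
    (measurableSet_lt measurable_const measurable_snd).inter
      (measurableSet_le measurable_snd measurable_fst)
  have h2 : MeasurableSet {p : ℝ × ℝ | p.2 ∈ Ioc p.1 α} :=
    (measurableSet_lt measurable_fst measurable_snd).inter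
      (measurableSet_le measurable_snd measurable_const)
  exact ((measurable_const (a := (1 : ℂ))).indicator h1).sub
    ((measurable_const (a := (1 : ℂ))).indicator h2)

theorem signedKernel_of_le {α x : ℝ} (h : α ≤ x) (t : ℝ) :
    signedKernel α x t = (Ioc α x).indicator 1 t := by
  simp [signedKernel, Ioc_eq_empty_of_le h]

theorem signedKernel_of_ge {α x : ℝ} (h : x ≤ α) (t : ℝ) :
    signedKernel α x t = -(Ioc x α).indicator 1 t := by
  simp [signedKernel, Ioc_eq_empty_of_le h]

theorem norm_signedKernel_le (α x t : ℝ) : ‖signedKernel α x t‖ ≤ 1 := by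
  rcases le_total α x with h | h
  · rw [signedKernel_of_le h]; simp only [indicator]; split_ifs <;> simp
  · rw [signedKernel_of_ge h]; simp only [indicator]; split_ifs <;> simp

theorem signedKernel_eq_zero {α x t : ℝ} (ht : t ∉ uIoc α x) : signedKernel α x t = 0 := by
  rcases le_total α x with h | h
  · rw [uIoc_of_le h] at ht; rw [signedKernel_of_le h, indicator_of_notMem ht]
  · rw [uIoc_of_ge h] at ht; rw [signedKernel_of_ge h, indicator_of_notMem ht, neg_zero]

theorem integral_signedKernel_mul {α x : ℝ} (hα : 0 ≤ α) (hx : 0 ≤ x) (φ : ℝ → ℂ) :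
    ∫ t in Ici 0, signedKernel α x t * φ t = ∫ t in α..x, φ t := by
  rcases le_total α x with h | h
  · rw [intervalIntegral.integral_of_le h]
    have : ∀ t, signedKernel α x t * φ t = (Ioc α x).indicator φ t := fun t => by
      rw [signedKernel_of_le h]; by_cases ht : t ∈ Ioc α x <;> simp [ht]
    simp_rw [this]
    rw [setIntegral_indicator measurableSet_Ioc, inter_eq_self_of_subset_right]
    exact fun t ht => hα.trans ht.1.le
  · rw [intervalIntegral.integral_of_ge h, ← integral_neg]
    have : ∀ t, signedKernel α x t * φ t = (Ioc x α).indicator (fun t => -φ t) t := fun t => by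
      rw [signedKernel_of_ge h]; by_cases ht : t ∈ Ioc x α <;> simp [ht]
    simp_rw [this]
    rw [setIntegral_indicator measurableSet_Ioc, inter_eq_self_of_subset_right]
    exact fun t ht => hx.trans ht.1.le

/-- The columns are Volterra series for y = e_k + ∫_α^x Gy. Since G is summable on the entire
half-line, the bound is uniform in x and does not depend on α. -/
theorem exists_fundamentalMatrix {G : Fin n → Fin n → ℝ → ℂ}
    (hG : ∀ j l, IntegrableOn (G j l) (Ici 0)) {α : ℝ} (hα : 0 ≤ α) :
    ∃ M : ℝ → Matrix (Fin n) (Fin n) ℂ, M α = 1 ∧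
      (∀ x, 0 ≤ x → ∀ j k, ‖M x j k‖ ≤ 2 * Real.exp (2 * ∫ t in Ici 0, entrySum G t)) ∧
      ∀ T, 0 ≤ T → ∀ j k,
        HasACDeriv (fun x => M x j k) (fun x => ∑ l, G j l x * M x l k) 0 T := by
  -- The kernel lemmas need Borel measurable coefficients, so `G` is replaced by a measurable
  -- representative; the equation is insensitive to null sets.
  set G' : Fin n → Fin n → ℝ → ℂ := fun j l => (hG j l).1.mk with hG'
  have hmeas : ∀ j l, Measurable (G' j l) := fun j l => (hG j l).1.stronglyMeasurable_mk.measurable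
  have hae : ∀ᵐ t ∂(volume.restrict (Ici (0 : ℝ))), ∀ j l, G j l t = G' j l t := by
    rw [ae_all_iff]; intro j; rw [ae_all_iff]; intro l
    exact (hG j l).1.ae_eq_mk
  have hG'i : ∀ j l, IntegrableOn (G' j l) (Ici 0) := fun j l => (hG j l).congr (by
    filter_upwards [hae] with t ht using ht j l)
  have hsum : ∫ t in Ici 0, entrySum G t = ∫ t in Ici 0, entrySum G' t := by
    refine integral_congr_ae ?_
    filter_upwards [hae] with t ht
    simp only [entrySum, ht]
  set E : Fin n → ℝ → ℝ → ℂ := fun _ x t => signedKernel α x t with hE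
  set w₀ : Fin n → ℝ → Fin n → ℂ := fun k _ j => (1 : Matrix (Fin n) (Fin n) ℂ) j k with hw₀
  have hEm : ∀ j, Measurable (Function.uncurry (E j)) := fun _ => measurable_signedKernel α
  have hw₀m : ∀ k l, Measurable fun t => w₀ k t l := fun k l => measurable_const
  have hD : ∀ k m, ∀ x ∈ Ici (0 : ℝ), ∀ j, ‖neumannTerm E G' (w₀ k) m x j‖ ≤
      1 * Real.exp (2 * 1 * ∫ t in Ici 0, entrySum G' t) * (1 / 2) ^ m := by
    intro k m x hx j
    refine norm_neumannTerm_le_of_volterra (S := Ici 0) hG'i hα (fun x hx => hx)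
      (fun x hx => uIoc_subset_Ici_zero hα hx) one_pos (fun x _ j t => norm_signedKernel_le _ _ _)
      (fun x _ j t ht => signedKernel_eq_zero ht) (fun x _ j => ?_) m hx j
    simp only [hw₀, Matrix.one_apply]
    split_ifs <;> simp
  have heq : ∀ k, ∀ x, 0 ≤ x → ∀ j, neumannSum E G' (w₀ k) x j = (1 : Matrix _ _ ℂ) j k +
      ∫ t in α..x, ∑ l, G' j l t * neumannSum E G' (w₀ k) t l := by
    intro k x hx j
    rw [neumannSum_eq (S := Ici 0) hEm hmeas hG'i (hw₀m k)
      (fun x _ j t => norm_signedKernel_le _ _ _)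
      (fun x hx j t ht => signedKernel_eq_zero fun h => ht (uIoc_subset_Ici_zero hα hx h))
      (hD k) hx j]
    rw [kernelOp, integral_signedKernel_mul hα hx]
  have hbd : ∀ k, ∀ x, 0 ≤ x → ∀ j,
      ‖neumannSum E G' (w₀ k) x j‖ ≤ 2 * Real.exp (2 * ∫ t in Ici 0, entrySum G t) := by
    intro k x hx j
    have := norm_neumannSum_le (S := Ici 0) (hD k) hx j
    rwa [one_mul, mul_one, ← hsum] at this
  refine ⟨fun x => Matrix.of fun j k => neumannSum E G' (w₀ k) x j, ?_, fun x hx j k => hbd k x hx j,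
    fun T hT j k => ?_⟩
  · ext j k
    simp [heq k α hα j]
  · have hint : IntegrableOn (fun t => ∑ l, G' j l t * neumannSum E G' (w₀ k) t l) (Ici 0) := by
      refine integrable_finsetSum _ fun l _ => ?_
      have hm := measurable_indicator_neumannSum (S := Ici 0) measurableSet_Ici hEm hmeas (hw₀m k)
        (hD k) l
      refine Integrable.congr (f := fun t => (Ici 0).indicator
        (fun x => neumannSum E G' (w₀ k) x l) t * G' j l t) ?_ ?_
      · refine integrable_bounded_mul hm (B := 2 * Real.exp (2 * ∫ t in Ici 0, entrySum G t))
          (fun t => ?_) (hG'i j l)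
        by_cases ht : t ∈ Ici (0 : ℝ)
        · rw [indicator_of_mem ht]; exact hbd k t ht l
        · rw [indicator_of_notMem ht, norm_zero]; positivity
      · filter_upwards [ae_restrict_mem measurableSet_Ici] with t ht
        rw [indicator_of_mem ht, mul_comm]
    have hii : IntervalIntegrable (fun t => ∑ l, G' j l t * neumannSum E G' (w₀ k) t l)
        volume α (max α T) := by
      rw [intervalIntegrable_iff]
      exact hint.mono_set (uIoc_subset_Ici_zero hα (hα.trans (le_max_left _ _)))
    have hii' : IntervalIntegrable (fun t => ∑ l, G' j l t * neumannSum E G' (w₀ k) t l)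
        volume 0 (max α T) := by
      rw [intervalIntegrable_iff]
      exact hint.mono_set (uIoc_subset_Ici_zero le_rfl (hα.trans (le_max_left _ _)))
    have hmem : α ∈ uIcc 0 (max α T) := by
      rw [uIcc_of_le (hα.trans (le_max_left _ _))]; exact ⟨hα, le_max_left _ _⟩
    -- The base point α may exceed T, so the primitive is handled on [0, max α T] and then
    -- restricted.
    have h := ((HasACDeriv.const ((1 : Matrix (Fin n) (Fin n) ℂ) j k) 0 (max α T)).add
      (HasACDeriv.integral hii' hmem)).mono (c := 0) (d := T) (by
        rw [uIcc_of_le hT, uIcc_of_le (hα.trans (le_max_left _ _))]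
        exact Icc_subset_Icc le_rfl (le_max_right _ _))
    refine (h.congr fun x hx => ?_).congr_deriv ?_
    · exact (heq k x (uIcc_subset_Ici_zero le_rfl hT hx) j).symm
    · rw [ae_restrict_iff' measurableSet_Ici] at hae
      filter_upwards [hae] with t ht htT
      have := ht (uIcc_subset_Ici_zero le_rfl hT htT)
      simp [this]

variable {G : Fin n → Fin n → ℝ → ℂ} {a c : ℝ}

/-- Solutions of `y' = G y` and of the adjoint system `v' = -Gᵀ v` have constant pairing. -/
theorem pairing_eq_of_adjoint {y v : ℝ → Fin n → ℂ}
    (hy : ∀ j, HasACDeriv (fun x => y x j) (fun x => ∑ l, G j l x * y x l) a c)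
    (hv : ∀ j, HasACDeriv (fun x => v x j) (fun x => ∑ l, -G l j x * v x l) a c) :
    ∑ j, v c j * y c j = ∑ j, v a j * y a j := by
  have h := (HasACDeriv.sum Finset.univ fun j _ => (hv j).mul (hy j)).congr_deriv (g' := fun _ => 0)
    (Eventually.of_forall fun x _ => by
      simp only [Finset.sum_add_distrib, Finset.sum_mul, Finset.mul_sum]
      rw [Finset.sum_comm, ← Finset.sum_add_distrib]
      refine Finset.sum_eq_zero fun j _ => ?_
      rw [← Finset.sum_add_distrib]
      exact Finset.sum_eq_zero fun l _ => by ring)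
  exact h.eq_of_deriv_zero

/-- Uniqueness by duality: let P solve the adjoint system with value I at the target point x. The
pairing of y with the k-th column of P is constant, is 0 at α, and equals y_k(x) at x. -/
theorem eq_zero_of_linear_system (hG : ∀ j l, IntegrableOn (G j l) (Ici 0)) {y : ℝ → Fin n → ℂ}
    (hy : ∀ T, 0 ≤ T → ∀ j, HasACDeriv (fun x => y x j) (fun x => ∑ l, G j l x * y x l) 0 T)
    {α : ℝ} (hα : 0 ≤ α) (h0 : y α = 0) {x : ℝ} (hx : 0 ≤ x) : y x = 0 := by
  obtain ⟨P, hP1, -, hP⟩ := exists_fundamentalMatrix (G := fun j l t => -G l j t)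
    (fun j l => (hG l j).neg) hx
  have hsub : uIcc α x ⊆ uIcc 0 (max α x) := by
    rw [uIcc_of_le (hα.trans (le_max_left _ _))]
    exact Icc_subset_Icc (le_min hα hx) le_rfl
  have hT : 0 ≤ max α x := hα.trans (le_max_left _ _)
  funext k
  have := pairing_eq_of_adjoint (y := y) (v := fun x j => P x j k) (G := G)
    (fun j => (hy _ hT j).mono hsub) (fun j => (hP _ hT j k).mono hsub)
  simpa [h0, hP1, Matrix.one_apply] using this

end LinearSystems

/-! ### The block gauge transformation and conjugation of L¹ matrix functions. -/

section Gauge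

variable {n : ℕ}

theorem isSolution_of_hasACDeriv {G : ℝ → Matrix (Fin n) (Fin n) ℂ} {y g : ℝ → Fin n → ℂ}
    (h : ∀ T, 0 ≤ T → ∀ j, HasACDeriv (fun x => y x j) (fun x => g x j) 0 T)
    (hg : ∀ᵐ x ∂(volume.restrict (Ici (0 : ℝ))), ∀ j, g x j = ∑ l, G x j l * y x l) :
    IsSolution G y := by
  refine ⟨fun T hT j => (h T hT.le j).ac, ?_⟩
  -- The exceptional set may depend on T; integer values of T leave a countable union of null sets.
  have h1 : ∀ᵐ x : ℝ, ∀ (m : ℕ) (j : Fin n), x ∈ uIcc (0 : ℝ) m →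
      HasDerivAt (fun x => y x j) (g x j) x := by
    rw [ae_all_iff]; intro m; rw [ae_all_iff]; intro j
    exact (h m (Nat.cast_nonneg m) j).hasDerivAt
  rw [ae_restrict_iff' measurableSet_Ici] at hg ⊢
  filter_upwards [h1, hg] with x hx hgx hx0 j
  obtain ⟨m, hm⟩ := exists_nat_ge x
  have := hx m j (by rw [uIcc_of_le (Nat.cast_nonneg m)]; exact ⟨hx0, hm⟩)
  rwa [hgx hx0 j] at this

theorem hasACDeriv_of_isSolution {G : ℝ → Matrix (Fin n) (Fin n) ℂ} {y : ℝ → Fin n → ℂ}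
    (hG : ∀ j l, IntegrableOn (fun x => G x j l) (Ici 0)) (h : IsSolution G y) (T : ℝ)
    (hT : 0 ≤ T) (j : Fin n) :
    HasACDeriv (fun x => y x j) (fun x => ∑ l, G x j l * y x l) 0 T := by
  suffices H : HasACDeriv (fun x => y x j) (fun x => ∑ l, G x j l * y x l) 0 (T + 1) from
    H.mono (by rw [uIcc_of_le hT, uIcc_of_le (by linarith)]; exact Icc_subset_Icc le_rfl (by linarith))
  refine ⟨h.1 (T + 1) (by linarith) j, ?_, ?_⟩
  · rw [intervalIntegrable_iff]
    refine integrable_finsetSum _ fun l _ => intervalIntegrable_iff.1 ?_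
    refine IntervalIntegrable.mul_continuousOn ?_ (h.1 (T + 1) (by linarith) l).continuousOn
    rw [intervalIntegrable_iff]
    exact (hG j l).mono_set (uIoc_subset_Ici_zero le_rfl (by linarith))
  · have := h.2
    rw [ae_restrict_iff' measurableSet_Ici] at this
    filter_upwards [this] with x hx hxT
    exact hx (uIcc_subset_Ici_zero le_rfl (by linarith) hxT) j

/-- The matrix diag(b_j) - b_k commutes with a block coefficient, so applying it to the k-th column
of M gives another solution. It vanishes at α, hence identically, and the factor b_j - b_k can be
divided out. -/
theorem entry_eq_zero_of_block {b : Fin n → ℂ} {G : Fin n → Fin n → ℝ → ℂ}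
    (hG : ∀ j l, IntegrableOn (G j l) (Ici 0)) (hb : ∀ j l x, b j ≠ b l → G j l x = 0)
    {α : ℝ} (hα : 0 ≤ α) {M : ℝ → Matrix (Fin n) (Fin n) ℂ} (hM1 : M α = 1)
    (hM : ∀ T, 0 ≤ T → ∀ j k,
        HasACDeriv (fun x => M x j k) (fun x => ∑ l, G j l x * M x l k) 0 T)
    {x : ℝ} (hx : 0 ≤ x) {j k : Fin n} (hjk : b j ≠ b k) : M x j k = 0 := by
  have h := eq_zero_of_linear_system hG (y := fun x j => (b j - b k) * M x j k) (fun T hT j => by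
    refine ((hM T hT j k).const_mul (b j - b k)).congr_deriv (Eventually.of_forall fun t _ => ?_)
    rw [Finset.mul_sum]
    refine Finset.sum_congr rfl fun l _ => ?_
    by_cases hjl : b j = b l
    · rw [hjl]; ring
    · rw [hb j l t hjl]; ring) hα (by
    funext j
    by_cases hjk : j = k
    · simp [hjk]
    · simp [hM1, Matrix.one_apply_ne hjk]) hx
  have := congrFun h j
  simpa [sub_ne_zero.2 hjk] using this

/-- N is the transpose of the fundamental matrix of the adjoint system. This produces the inverse of
M with the same a priori bound and the same block structure. -/
theorem exists_gauge {b : Fin n → ℂ} {G : Fin n → Fin n → ℝ → ℂ}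
    (hG : ∀ j l, IntegrableOn (G j l) (Ici 0)) (hb : ∀ j l x, b j ≠ b l → G j l x = 0)
    {α : ℝ} (hα : 0 ≤ α) :
    ∃ M N : ℝ → Matrix (Fin n) (Fin n) ℂ, M α = 1 ∧ (∀ x, 0 ≤ x → M x * N x = 1) ∧
      (∀ x, 0 ≤ x → ∀ j k, b j ≠ b k → M x j k = 0 ∧ N x j k = 0) ∧
      (∀ x, 0 ≤ x → ∀ j k, ‖M x j k‖ ≤ 2 * Real.exp (2 * ∫ t in Ici 0, entrySum G t) ∧
        ‖N x j k‖ ≤ 2 * Real.exp (2 * ∫ t in Ici 0, entrySum G t)) ∧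
      (∀ T, 0 ≤ T → ∀ j k,
        HasACDeriv (fun x => M x j k) (fun x => ∑ l, G j l x * M x l k) 0 T) ∧
      ∀ T, 0 ≤ T → ∀ j k, ContinuousOn (fun x => N x j k) (uIcc 0 T) := by
  obtain ⟨M, hM1, hMb, hM⟩ := exists_fundamentalMatrix hG hα
  have hG' : ∀ j l, IntegrableOn (fun t => -G l j t) (Ici 0) := fun j l => (hG l j).neg
  obtain ⟨P, hP1, hPb, hP⟩ := exists_fundamentalMatrix hG' hα
  have hsum : entrySum (fun j l t => -G l j t) = entrySum G := by
    funext t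
    simp only [entrySum, norm_neg]
    exact Finset.sum_comm
  rw [hsum] at hPb
  refine ⟨M, fun x => (P x).transpose, hM1, fun x hx => ?_, fun x hx j k hjk => ⟨?_, ?_⟩,
    fun x hx j k => ⟨hMb x hx j k, hPb x hx k j⟩, hM, fun T hT j k => (hP T hT k j).continuousOn⟩
  -- Constancy of the pairing gives NM = I directly; for square matrices this is equivalent to MN =
  -- I.
  · rw [mul_eq_one_comm]
    ext i k
    have hsub : uIcc α x ⊆ uIcc 0 (max α x) := by
      rw [uIcc_of_le (hα.trans (le_max_left _ _))]
      exact Icc_subset_Icc (le_min hα hx) le_rfl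
    have hT : 0 ≤ max α x := hα.trans (le_max_left _ _)
    have := pairing_eq_of_adjoint (y := fun x j => M x j k) (v := fun x j => P x j i) (G := G)
      (fun j => (hM _ hT j k).mono hsub) (fun j => (hP _ hT j i).mono hsub)
    rw [Matrix.mul_apply]
    simp only [Matrix.transpose_apply]
    rw [this, hM1, hP1]
    simp [Matrix.one_apply, eq_comm]
  · exact entry_eq_zero_of_block hG hb hα hM1 hM hx hjk
  · exact entry_eq_zero_of_block hG' (fun j l t h => by simp [hb l j t (Ne.symm h)]) hα hP1 hP hx
      (Ne.symm hjk)

theorem integrable_mul_coeFn {B : ℝ} {φ : ℝ → ℂ} (hm : Measurable φ) (hB : ∀ t, ‖φ t‖ ≤ B)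
    (g : HalfLineL1) : Integrable (fun t => φ t * g t) (volume.restrict (Ici 0)) :=
  integrable_bounded_mul hm hB g.integrableOn

theorem coeFn_sum_halfLineL1 {ι : Type*} [Fintype ι] (f : ι → HalfLineL1) :
    ∀ᵐ t ∂(volume.restrict (Ici (0 : ℝ))), (∑ i, f i : HalfLineL1) t = ∑ i, f i t := by
  classical
  suffices H : ∀ s : Finset ι, ∀ᵐ t ∂(volume.restrict (Ici (0 : ℝ))),
      (∑ i ∈ s, f i : HalfLineL1) t = ∑ i ∈ s, f i t from H _
  intro s
  induction s using Finset.induction_on with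
  | empty =>
    filter_upwards [Lp.coeFn_zero ℂ 1 (volume.restrict (Ici (0 : ℝ)))] with t ht
    simpa using ht
  | insert i s hi ih =>
    rw [Finset.sum_insert hi]
    filter_upwards [Lp.coeFn_add (f i) (∑ i ∈ s, f i), ih] with t h1 h2
    rw [h1, Pi.add_apply, h2, Finset.sum_insert hi]

/-- Multiplication by a bounded function, as an operator on `L[0, ∞)`. -/
noncomputable def boundedMul {B : ℝ} (φ : ℝ → ℂ) (hm : Measurable φ) (hB : ∀ t, ‖φ t‖ ≤ B) :
    HalfLineL1 →L[ℂ] HalfLineL1 :=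
  LinearMap.mkContinuous
    { toFun := fun g => Integrable.toL1 _ (integrable_mul_coeFn hm hB g)
      map_add' := fun g h => by
        rw [← Integrable.toL1_add]
        refine (Integrable.toL1_eq_toL1_iff _ _ _ _).2 ?_
        filter_upwards [Lp.coeFn_add g h] with t ht
        rw [ht, Pi.add_apply, Pi.add_apply, mul_add]
      map_smul' := fun c g => by
        rw [RingHom.id_apply, ← Integrable.toL1_smul]
        refine (Integrable.toL1_eq_toL1_iff _ _ _ _).2 ?_
        filter_upwards [Lp.coeFn_smul c g] with t ht
        rw [ht, Pi.smul_apply, smul_eq_mul, smul_eq_mul]; ring } B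
    fun g => by
      rw [L1.norm_eq_integral_norm, L1.norm_eq_integral_norm, ← integral_const_mul]
      refine integral_mono_ae (L1.integrable_coeFn _).norm (g.integrableOn.norm.const_mul B) ?_
      filter_upwards [Integrable.coeFn_toL1 (integrable_mul_coeFn hm hB g)]
        with t ht
      refine (congrArg norm ht).le.trans ?_
      rw [norm_mul]
      exact mul_le_mul_of_nonneg_right (hB t) (norm_nonneg _)

theorem coeFn_boundedMul {B : ℝ} (φ : ℝ → ℂ) (hm : Measurable φ) (hB : ∀ t, ‖φ t‖ ≤ B)
    (g : HalfLineL1) :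
    (boundedMul φ hm hB g : ℝ → ℂ) =ᵐ[volume.restrict (Ici 0)] fun t => φ t * g t :=
  Integrable.coeFn_toL1 (integrable_mul_coeFn hm hB g)

/-- Conjugation of an `L[0, ∞)` matrix function by bounded matrix functions. -/
theorem exists_conjugation {M N : ℝ → Matrix (Fin n) (Fin n) ℂ} {L : ℝ}
    (hMc : ∀ j k, Measurable fun x => M x j k) (hNc : ∀ j k, Measurable fun x => N x j k)
    (hM : ∀ x j k, ‖M x j k‖ ≤ L) (hN : ∀ x j k, ‖N x j k‖ ≤ L) :
    ∃ T : Fin n → Fin n → (Fin n → Fin n → HalfLineL1) →L[ℂ] HalfLineL1,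
      ∀ H : Fin n → Fin n → HalfLineL1, ∀ᵐ t ∂(volume.restrict (Ici (0 : ℝ))), ∀ j l,
        (T j l H : ℝ → ℂ) t = (N t * (Matrix.of fun a c => H a c t) * M t) j l := by
  have hb : ∀ j a c l t, ‖N t j a * M t c l‖ ≤ L * L := fun j a c l t => by
    rw [norm_mul]
    exact mul_le_mul (hN _ _ _) (hM _ _ _) (norm_nonneg _) ((norm_nonneg _).trans (hN t j a))
  -- Conjugation is packaged as a continuous linear operator on L¹ matrices so that holomorphy in λ
  -- is inherited by the conjugated coefficient.
  set T : Fin n → Fin n → (Fin n → Fin n → HalfLineL1) →L[ℂ] HalfLineL1 := fun j l =>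
    ∑ a, ∑ c, (boundedMul (fun t => N t j a * M t c l) ((hNc j a).mul (hMc c l)) (hb j a c l)).comp
      ((ContinuousLinearMap.proj c).comp (ContinuousLinearMap.proj (R := ℂ)
        (φ := fun _ : Fin n => Fin n → HalfLineL1) a)) with hT
  refine ⟨T, fun H => ?_⟩
  rw [ae_all_iff]; intro j; rw [ae_all_iff]; intro l
  have e : T j l H = ∑ a, ∑ c,
      boundedMul (fun t => N t j a * M t c l) ((hNc j a).mul (hMc c l)) (hb j a c l) (H a c) := by
    simp [hT]
  have h1 : ∀ᵐ t ∂(volume.restrict (Ici (0 : ℝ))), ∀ a c,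
      (boundedMul (fun t => N t j a * M t c l) ((hNc j a).mul (hMc c l)) (hb j a c l) (H a c) :
        ℝ → ℂ) t = N t j a * M t c l * H a c t := by
    rw [ae_all_iff]; intro a; rw [ae_all_iff]; intro c
    exact coeFn_boundedMul _ _ _ _
  have h2 : ∀ᵐ t ∂(volume.restrict (Ici (0 : ℝ))), ∀ a,
      (∑ c, boundedMul (fun t => N t j a * M t c l) ((hNc j a).mul (hMc c l)) (hb j a c l) (H a c) :
        HalfLineL1) t = ∑ c, (boundedMul (fun t => N t j a * M t c l) ((hNc j a).mul (hMc c l))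
          (hb j a c l) (H a c) : ℝ → ℂ) t := by
    rw [ae_all_iff]; intro a
    exact coeFn_sum_halfLineL1 _
  have h3 : ∀ᵐ t ∂(volume.restrict (Ici (0 : ℝ))),
      (∑ a, ∑ c, boundedMul (fun t => N t j a * M t c l) ((hNc j a).mul (hMc c l)) (hb j a c l)
        (H a c) : HalfLineL1) t = ∑ a, (∑ c, boundedMul (fun t => N t j a * M t c l)
          ((hNc j a).mul (hMc c l)) (hb j a c l) (H a c) : HalfLineL1) t := coeFn_sum_halfLineL1 _
  rw [e]
  filter_upwards [h1, h2, h3] with t ht1 ht2 ht3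
  rw [ht3]
  simp only [ht2, ht1, Matrix.mul_apply, Matrix.of_apply, Finset.sum_mul]
  rw [Finset.sum_comm]
  refine Finset.sum_congr rfl fun c _ => Finset.sum_congr rfl fun a _ => by ring

theorem entrySum_conj_le {M N H : Matrix (Fin n) (Fin n) ℂ} {L : ℝ}
    (hM : ∀ j k, ‖M j k‖ ≤ L) (hN : ∀ j k, ‖N j k‖ ≤ L) :
    ∑ j, ∑ l, ‖(N * H * M) j l‖ ≤ (n : ℝ) ^ 2 * L ^ 2 * ∑ a, ∑ c, ‖H a c‖ := by
  rcases Nat.eq_zero_or_pos n with rfl | hn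
  · simp
  have hL : 0 ≤ L := (norm_nonneg _).trans (hM ⟨0, hn⟩ ⟨0, hn⟩)
  have h : ∀ j l, ‖(N * H * M) j l‖ ≤ L ^ 2 * ∑ a, ∑ c, ‖H a c‖ := by
    intro j l
    simp only [Matrix.mul_apply, Finset.sum_mul]
    rw [Finset.sum_comm, Finset.mul_sum]
    refine norm_sum_le_of_le _ fun a _ => ?_
    rw [Finset.mul_sum]
    refine norm_sum_le_of_le _ fun c _ => ?_
    rw [norm_mul, norm_mul, sq]
    calc _ ≤ L * ‖H a c‖ * L := mul_le_mul (mul_le_mul_of_nonneg_right (hN _ _) (norm_nonneg _))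
          (hM _ _) (norm_nonneg _) (by positivity)
      _ = _ := by ring
  calc _ ≤ ∑ _j : Fin n, ∑ _l : Fin n, L ^ 2 * ∑ a, ∑ c, ‖H a c‖ :=
        Finset.sum_le_sum fun j _ => Finset.sum_le_sum fun l _ => h j l
    _ = _ := by simp; ring

end Gauge

/-! ### The phase p and its exponentials. -/

section Phase

/-- `p` is a continuous monotone function which is a primitive of `ρ` on the half-line. -/
structure IsPhase (ρ p : ℝ → ℝ) : Prop where
  continuous : Continuous p
  monotone : Monotone p
  hasACDeriv : ∀ a c, 0 ≤ a → 0 ≤ c →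
    HasACDeriv (fun x => (p x : ℂ)) (fun x => (ρ x : ℂ)) a c

/-- The primitive is continued by a constant to the negative axis: the kernels are functions on the
whole plane, and global continuity and monotonicity of p give their measurability and bounds. -/
theorem isPhase_primitiveFun {ρ : ℝ → ℝ} (hρ_int : ∀ T > 0, IntegrableOn ρ (Ico 0 T))
    (hρ_pos : ∀ᵐ x ∂(volume.restrict (Ici (0 : ℝ))), 0 < ρ x) :
    IsPhase ρ fun x => primitiveFun ρ (max x 0) := by
  have hii : ∀ a c, 0 ≤ a → 0 ≤ c → IntervalIntegrable ρ volume a c := fun a c ha hc =>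
    intervalIntegrable_of_integrableOn_Ico hρ_int ha hc
  have hd : ∀ T, 0 ≤ T →
      HasACDeriv (fun x => (primitiveFun ρ x : ℂ)) (fun x => (ρ x : ℂ)) 0 T := by
    intro T hT
    have : IntervalIntegrable (fun t => (ρ t : ℂ)) volume 0 T := by
      have := hii 0 T le_rfl hT
      rw [intervalIntegrable_iff] at *
      exact this.ofReal
    exact (HasACDeriv.integral this left_mem_uIcc).congr fun x _ => by
      simp [primitiveFun, intervalIntegral.integral_ofReal]
  refine ⟨?_, ?_, ?_⟩
  · have hc : ContinuousOn (primitiveFun ρ) (Ici 0) := by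
      intro x hx
      have hx0 : (0 : ℝ) ≤ x := hx
      have h1 := (hd (x + 1) (by linarith)).continuousOn
      have h2 : ContinuousOn (primitiveFun ρ) (uIcc 0 (x + 1)) := by
        have := Complex.continuous_re.comp_continuousOn h1
        simpa [Function.comp_def] using this
      refine (h2 x (by rw [uIcc_of_le (by linarith)]; exact ⟨hx0, by linarith⟩)).mono_of_mem_nhdsWithin ?_
      rw [uIcc_of_le (by linarith)]
      exact mem_nhdsWithin.2 ⟨Iio (x + 1), isOpen_Iio, by simp, fun y hy => ⟨hy.2, hy.1.le⟩⟩
    exact hc.comp_continuous (by fun_prop) fun x => mem_Ici.2 (le_max_right _ _)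
  · intro x y hxy
    have h := intervalIntegral.integral_interval_sub_left (hii 0 (max y 0) le_rfl (le_max_right _ _))
      (hii 0 (max x 0) le_rfl (le_max_right _ _))
    have h0 : 0 ≤ ∫ t in (max x 0)..(max y 0), ρ t := by
      refine intervalIntegral.integral_nonneg_of_ae_restrict (max_le_max_right 0 hxy) ?_
      refine (ae_restrict_of_ae_restrict_of_subset (t := Ici 0) ?_ hρ_pos).mono fun t ht => ht.le
      exact fun t ht => (le_max_right x 0).trans ht.1
    simp only [primitiveFun]
    linarith
  · intro a c ha hc
    have hT : 0 ≤ max a c := ha.trans (le_max_left _ _)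
    refine ((hd _ hT).mono ?_).congr fun x hx => ?_
    · rw [uIcc_of_le hT]; exact Icc_subset_Icc (le_min ha hc) le_rfl
    · rw [max_eq_left (uIcc_subset_Ici_zero ha hc hx)]

variable {ρ p : ℝ → ℝ} {a c α : ℝ}

theorem IsPhase.hasACDeriv_exp (hp : IsPhase ρ p) (ha : 0 ≤ a) (hc : 0 ≤ c) (η : ℂ) (s : ℝ) :
    HasACDeriv (fun x => Complex.exp (η * ((p x - p s : ℝ) : ℂ)))
      (fun x => Complex.exp (η * ((p x - p s : ℝ) : ℂ)) * (η * ρ x)) a c := by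
  have := (((hp.hasACDeriv a c ha hc).sub (HasACDeriv.const (p s : ℂ) a c)).const_mul η).cexp
  simpa using this

/-- Variation of constants for w' = ηρw + h. Differentiating the integral leaves h times two
exponentials at the same point, which cancel. -/
theorem IsPhase.hasACDeriv_duhamel (hp : IsPhase ρ p) (ha : 0 ≤ a) (hc : 0 ≤ c) (η : ℂ) {h : ℝ → ℂ}
    (hh : IntervalIntegrable h volume a c) {s : ℝ} (hs : s ∈ uIcc a c) (C : ℂ) :
    HasACDeriv
      (fun x => Complex.exp (η * ((p x - p s : ℝ) : ℂ)) *
        (C + ∫ t in s..x, Complex.exp (-η * ((p t - p s : ℝ) : ℂ)) * h t))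
      (fun x => η * ρ x * (Complex.exp (η * ((p x - p s : ℝ) : ℂ)) *
        (C + ∫ t in s..x, Complex.exp (-η * ((p t - p s : ℝ) : ℂ)) * h t)) + h x) a c := by
  have hint : IntervalIntegrable (fun t => Complex.exp (-η * ((p t - p s : ℝ) : ℂ)) * h t)
      volume a c := hh.continuousOn_mul (hp.hasACDeriv_exp ha hc (-η) s).continuousOn
  refine ((hp.hasACDeriv_exp ha hc η s).mul
    ((HasACDeriv.const C a c).add (HasACDeriv.integral hint hs))).congr_deriv
    (Eventually.of_forall fun x _ => ?_)
  have : Complex.exp (η * ((p x - p s : ℝ) : ℂ)) * Complex.exp (-η * ((p x - p s : ℝ) : ℂ)) = 1 := by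
    rw [← Complex.exp_add]; simp
  linear_combination h x * this

theorem norm_exp_mul_ofReal_le {η : ℂ} {r : ℝ} (h : η.re * r ≤ 0) :
    ‖Complex.exp (η * (r : ℂ))‖ ≤ 1 := by
  rw [Complex.norm_exp]
  simpa using h

end Phase

/-! ### The integral operator on [α, ∞). -/

section HalfLineKernel

variable {n : ℕ} {ρ p : ℝ → ℝ} {α : ℝ} {b : Fin n → ℂ} {z : ℂ} {k : Fin n}

/-- The kernel of the integral equation for the `k`-th column on `[α, ∞)`. -/
noncomputable def halfKernel (b : Fin n → ℂ) (p : ℝ → ℝ) (α : ℝ) (k : Fin n) (z : ℂ) (j : Fin n)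
    (x t : ℝ) : ℂ :=
  (if k ≤ j then (Ioc α x).indicator 1 t else -(Ioi x).indicator 1 t) *
    Complex.exp (z * (b j - b k) * ((p x - p t : ℝ) : ℂ))

theorem measurable_halfKernel (hp : Continuous p) (j : Fin n) :
    Measurable (Function.uncurry (halfKernel b p α k z j)) := by
  have h1 : MeasurableSet {q : ℝ × ℝ | q.2 ∈ Ioc α q.1} :=
    (measurableSet_lt measurable_const measurable_snd).inter
      (measurableSet_le measurable_snd measurable_fst)
  have h2 : MeasurableSet {q : ℝ × ℝ | q.2 ∈ Ioi q.1} :=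
    measurableSet_lt measurable_fst measurable_snd
  have h3 : Measurable fun q : ℝ × ℝ =>
      Complex.exp (z * (b j - b k) * ((p q.1 - p q.2 : ℝ) : ℂ)) := by
    refine Continuous.measurable ?_
    fun_prop
  by_cases hjk : k ≤ j
  · have := ((measurable_const (a := (1 : ℂ))).indicator h1).mul h3
    unfold halfKernel
    simp only [hjk, if_true]
    exact this
  · have := ((measurable_const (a := (1 : ℂ))).indicator h2).neg.mul h3
    unfold halfKernel
    simp only [hjk, if_false]
    exact this

theorem re_mul_sub_nonpos (hz : ∀ j k : Fin n, j ≤ k → (z * b k).re ≤ (z * b j).re) {j k : Fin n}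
    (h : k ≤ j) : (z * (b j - b k)).re ≤ 0 := by
  have := hz k j h
  rw [mul_sub, Complex.sub_re]; linarith

/-- The ordering of the real parts dictates the direction of integration. For k ≤ j the exponent has
Re z(b_j - b_k) ≤ 0 and p(x) ≥ p(t); for j < k both signs are reversed. Only weak inequalities are
used, so boundary rays of the sector are included. -/
theorem norm_halfKernel_le (hp : Monotone p)
    (hz : ∀ j k : Fin n, j ≤ k → (z * b k).re ≤ (z * b j).re) (j : Fin n) (x t : ℝ) :
    ‖halfKernel b p α k z j x t‖ ≤ 1 := by
  unfold halfKernel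
  rw [norm_mul]
  by_cases hjk : k ≤ j
  · rw [if_pos hjk]
    by_cases ht : t ∈ Ioc α x
    · rw [indicator_of_mem ht]
      have h2 := re_mul_sub_nonpos hz hjk
      simpa using norm_exp_mul_ofReal_le (r := p x - p t)
        (mul_nonpos_of_nonpos_of_nonneg h2 (sub_nonneg.2 (hp ht.2)))
    · simp [indicator_of_notMem ht]
  · rw [if_neg hjk]
    by_cases ht : t ∈ Ioi x
    · rw [indicator_of_mem ht]
      have h2 := re_mul_sub_nonpos hz (not_le.1 hjk).le
      have h3 : 0 ≤ (z * (b j - b k)).re := by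
        have : z * (b j - b k) = -(z * (b k - b j)) := by ring
        rw [this, Complex.neg_re]; linarith
      simpa using norm_exp_mul_ofReal_le (r := p x - p t)
        (mul_nonpos_of_nonneg_of_nonpos h3 (sub_nonpos.2 (hp (le_of_lt ht))))
    · simp [indicator_of_notMem ht]

theorem halfKernel_eq_zero {x : ℝ} (hx : α ≤ x) {t : ℝ} (ht : t ∉ Ici α) (j : Fin n) :
    halfKernel b p α k z j x t = 0 := by
  have ht' : t < α := not_le.1 ht
  unfold halfKernel
  rw [indicator_of_notMem (fun h => (h.1.trans ht').false),
    indicator_of_notMem (s := Ioi x) (fun h => ((lt_of_le_of_lt hx h).trans ht').false)]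
  simp

theorem integral_halfKernel_of_le (hα : 0 ≤ α) {j : Fin n} (hjk : k ≤ j) {x : ℝ} (hx : α ≤ x)
    (h : ℝ → ℂ) : ∫ t in Ici 0, halfKernel b p α k z j x t * h t =
      ∫ t in α..x, Complex.exp (z * (b j - b k) * ((p x - p t : ℝ) : ℂ)) * h t := by
  rw [intervalIntegral.integral_of_le hx]
  have : ∀ t, halfKernel b p α k z j x t * h t = (Ioc α x).indicator
      (fun t => Complex.exp (z * (b j - b k) * ((p x - p t : ℝ) : ℂ)) * h t) t := fun t => by
    by_cases ht : t ∈ Ioc α x <;> simp [halfKernel, hjk, ht]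
  simp_rw [this]
  rw [setIntegral_indicator measurableSet_Ioc, inter_eq_self_of_subset_right]
  exact fun t ht => hα.trans ht.1.le

theorem integral_halfKernel_of_gt {j : Fin n} (hjk : ¬k ≤ j) {x : ℝ} (hx : 0 ≤ x)
    (h : ℝ → ℂ) : ∫ t in Ici 0, halfKernel b p α k z j x t * h t =
      -∫ t in Ioi x, Complex.exp (z * (b j - b k) * ((p x - p t : ℝ) : ℂ)) * h t := by
  rw [← integral_neg]
  have : ∀ t, halfKernel b p α k z j x t * h t = (Ioi x).indicator
      (fun t => -(Complex.exp (z * (b j - b k) * ((p x - p t : ℝ) : ℂ)) * h t)) t := fun t => by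
    by_cases ht : t ∈ Ioi x
    · simp [halfKernel, hjk, indicator_of_mem ht]
    · simp [halfKernel, hjk, indicator_of_notMem ht]
  simp_rw [this]
  rw [setIntegral_indicator measurableSet_Ioi, inter_eq_self_of_subset_right]
  exact fun t ht => hx.trans (le_of_lt ht)

/-- Duhamel's form of the half-line integral operator. -/
theorem exists_integral_halfKernel_eq (hp : IsPhase ρ p) (hα : 0 ≤ α)
    (hz : ∀ j k : Fin n, j ≤ k → (z * b k).re ≤ (z * b j).re) (j : Fin n) {h : ℝ → ℂ}
    (hh : IntegrableOn h (Ici α)) :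
    ∃ C : ℂ, ∀ x, α ≤ x → ∫ t in Ici 0, halfKernel b p α k z j x t * h t =
      Complex.exp (z * (b j - b k) * ((p x - p α : ℝ) : ℂ)) *
        (C + ∫ t in α..x, Complex.exp (-(z * (b j - b k)) * ((p t - p α : ℝ) : ℂ)) * h t) := by
  have split : ∀ x t, Complex.exp (z * (b j - b k) * ((p x - p t : ℝ) : ℂ)) * h t =
      Complex.exp (z * (b j - b k) * ((p x - p α : ℝ) : ℂ)) *
        (Complex.exp (-(z * (b j - b k)) * ((p t - p α : ℝ) : ℂ)) * h t) := by
    intro x t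
    rw [← mul_assoc, ← Complex.exp_add]
    congr 2
    push_cast; ring
  by_cases hjk : k ≤ j
  · refine ⟨0, fun x hx => ?_⟩
    rw [integral_halfKernel_of_le hα hjk hx]
    simp_rw [split x]
    rw [intervalIntegral.integral_const_mul, zero_add]
  · have hint : IntegrableOn
        (fun t => Complex.exp (-(z * (b j - b k)) * ((p t - p α : ℝ) : ℂ)) * h t) (Ioi α) := by
      refine Integrable.bdd_mul (c := 1) (hh.mono_set Ioi_subset_Ici_self) ?_ ?_
      · have := hp.continuous
        exact Continuous.aestronglyMeasurable (by fun_prop)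
      · filter_upwards [ae_restrict_mem measurableSet_Ioi] with t ht
        refine norm_exp_mul_ofReal_le ?_
        have h2 := re_mul_sub_nonpos hz (not_le.1 hjk).le
        have : -(z * (b j - b k)) = z * (b k - b j) := by ring
        rw [this]
        exact mul_nonpos_of_nonpos_of_nonneg h2 (sub_nonneg.2 (hp.monotone (le_of_lt ht)))
    -- Minus the integral over (x, ∞) is minus the integral over (α, ∞) plus that over (α, x); the
    -- first is the constant.
    refine ⟨-∫ t in Ioi α, Complex.exp (-(z * (b j - b k)) * ((p t - p α : ℝ) : ℂ)) * h t,
      fun x hx => ?_⟩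
    rw [integral_halfKernel_of_gt hjk (hα.trans hx)]
    simp_rw [split x]
    rw [integral_const_mul, ← mul_neg]
    congr 1
    have := intervalIntegral.integral_interval_add_Ioi' (a := α) (b := x)
      (f := fun t => Complex.exp (-(z * (b j - b k)) * ((p t - p α : ℝ) : ℂ)) * h t)
      (by rw [intervalIntegrable_iff_integrableOn_Ioc_of_le hx]
          exact hint.mono_set fun t ht => ht.1) (hint.mono_set (Ioi_subset_Ioi hx))
    rw [← this]; ring

theorem norm_kernelOp_halfKernel_le (hα : 0 ≤ α) (hp : Monotone p)
    (hz : ∀ j k : Fin n, j ≤ k → (z * b k).re ≤ (z * b j).re) {R : Fin n → Fin n → ℝ → ℂ}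
    (hR : ∀ j l, IntegrableOn (R j l) (Ici 0)) {w : ℝ → Fin n → ℂ} {W : ℝ}
    (hw : ∀ x, α ≤ x → ∀ l, ‖w x l‖ ≤ W) {x : ℝ} (hx : α ≤ x) (j : Fin n) :
    ‖kernelOp (halfKernel b p α k z) R w x j‖ ≤ (∫ t in Ici α, entrySum R t) * W := by
  have hγ := integrableOn_entrySum hR
  have hsub : Ici α ⊆ Ici 0 := Ici_subset_Ici.2 hα
  calc _ ≤ ∫ t in Ici 0, (Ici α).indicator (fun t => entrySum R t * W) t := by
        refine norm_integral_le_of_norm_le ?_ (Eventually.of_forall fun t => ?_)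
        · have : IntegrableOn (fun t => entrySum R t * W) (Ici α) := (hγ.mono_set hsub).mul_const W
          exact (this.integrable_indicator measurableSet_Ici).integrableOn
        · by_cases ht : t ∈ Ici α
          · rw [indicator_of_mem ht, norm_mul, ← one_mul (entrySum R t * W)]
            exact mul_le_mul (norm_halfKernel_le hp hz j x t) (norm_sum_mul_le (hw t ht) j)
              (norm_nonneg _) zero_le_one
          · rw [indicator_of_notMem ht, halfKernel_eq_zero hx ht, zero_mul, norm_zero]
    _ = _ := by
        rw [setIntegral_indicator measurableSet_Ici, inter_eq_self_of_subset_right hsub,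
          integral_mul_const]

end HalfLineKernel

/-! ### Oscillation estimates for the half-line operator. -/

section HalfLineEstimates

variable {n : ℕ} {ρ p : ℝ → ℝ} {α : ℝ} {b : Fin n → ℂ}

/-- Multiplying v by the kernel's exponential cancels b_k: the product φ satisfies φ' = z(b_l -
b_j)ρφ + g̃ with |g̃| ≤ |g|. Since b_j ≠ b_l, the oscillation bound applies with μ = z(b_l - b_j),
uniformly in k, x and the interval. For j < k it is applied on [x, c] and c is sent to infinity. -/
theorem exists_norm_integral_halfKernel_le (hρ_int : ∀ T > 0, IntegrableOn ρ (Ico 0 T))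
    (hρ_pos : ∀ᵐ x ∂(volume.restrict (Ici (0 : ℝ))), 0 < ρ x) (hp : IsPhase ρ p) (hα : 0 ≤ α)
    (q : HalfLineL1) {ε : ℝ} (hε : 0 < ε) {j l : Fin n} (hjl : b j ≠ b l) :
    ∃ K : ℝ, 0 ≤ K ∧ ∀ (z : ℂ) (k : Fin n) (v g : ℝ → ℂ) (W G : ℝ), z ≠ 0 →
      (∀ j k : Fin n, j ≤ k → (z * b k).re ≤ (z * b j).re) →
      (∀ a c, α ≤ a → a ≤ c → HasACDeriv v (fun t => z * (b l - b k) * ρ t * v t + g t) a c) →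
      (∀ t, α ≤ t → ‖v t‖ ≤ W) → IntegrableOn g (Ici α) → ∫ t in Ici α, ‖g t‖ ≤ G →
      ∀ x, α ≤ x → ‖∫ t in Ici 0, halfKernel b p α k z j x t * v t * q t‖ ≤
        ε * W + K * (W + G) / ‖z‖ := by
  obtain ⟨K, hK, H⟩ := exists_oscillation_bound hρ_int hρ_pos q.integrableOn hε
  have hβ : 0 < ‖b l - b j‖ := norm_pos_iff.2 (sub_ne_zero.2 (Ne.symm hjl))
  refine ⟨K / ‖b l - b j‖, by positivity, fun z k v g W G hz0 hz hv hW hg hG x hx => ?_⟩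
  set e : ℝ → ℂ := fun t => Complex.exp (z * (b j - b k) * ((p x - p t : ℝ) : ℂ))
    with he
  have hee : ∀ t, Complex.exp (-(z * (b j - b k)) * ((p t - p x : ℝ) : ℂ)) = e t := fun t => by
    simp only [he]; congr 1; push_cast; ring
  have hsub : ∀ {a c}, α ≤ a → a ≤ c → Ioc a c ⊆ Ici α := fun h _ t ht => h.trans ht.1.le
  have finite : ∀ a c, α ≤ a → a ≤ c → (∀ t ∈ Icc a c, ‖e t‖ ≤ 1) →
      ‖∫ t in a..c, e t * v t * q t‖ ≤ ε * W + K / ‖b l - b j‖ * (W + G) / ‖z‖ := by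
    intro a c ha hac hbd
    have ha0 : 0 ≤ a := hα.trans ha
    have hE := hp.hasACDeriv_exp ha0 (ha0.trans hac) (-(z * (b j - b k))) x
    simp only [hee] at hE
    have hgi : IntervalIntegrable g volume a c := by
      rw [intervalIntegrable_iff_integrableOn_Ioc_of_le hac]
      exact hg.mono_set (hsub ha hac)
    have hegi : IntervalIntegrable (fun t => e t * g t) volume a c :=
      hgi.continuousOn_mul hE.continuousOn
    have hφ : HasACDeriv (fun t => e t * v t)
        (fun t => z * (b l - b j) * ρ t * (e t * v t) + e t * g t) a c :=
      (hE.mul (hv a c ha hac)).congr_deriv (Eventually.of_forall fun t _ => by ring)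
    have := H (z * (b l - b j)) (fun t => e t * v t) (fun t => e t * g t) a c W G
      (mul_ne_zero hz0 (sub_ne_zero.2 (Ne.symm hjl))) ha0 hac hφ (fun t ht => ?_) hegi ?_
    · rw [norm_mul] at this
      refine this.trans (le_of_eq ?_)
      have : ‖z‖ ≠ 0 := norm_ne_zero_iff.2 hz0
      field_simp
    · rw [norm_mul]
      exact (mul_le_of_le_one_left (norm_nonneg _) (hbd t ht)).trans (hW t (ha.trans ht.1))
    · refine le_trans ?_ hG
      calc ∫ t in a..c, ‖e t * g t‖ ≤ ∫ t in a..c, ‖g t‖ := by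
            refine intervalIntegral.integral_mono_on hac hegi.norm hgi.norm fun t ht => ?_
            rw [norm_mul]
            exact mul_le_of_le_one_left (norm_nonneg _) (hbd t ht)
        _ ≤ _ := by
            rw [intervalIntegral.integral_of_le hac]
            exact setIntegral_mono_set hg.norm (Eventually.of_forall fun _ => norm_nonneg _)
              (LE.le.eventuallyLE (hsub ha hac))
  simp only [mul_assoc (halfKernel b p α k z j x _)]
  by_cases hjk : k ≤ j
  · rw [integral_halfKernel_of_le hα hjk hx]
    simp only [← mul_assoc (Complex.exp _)]
    refine finite α x le_rfl hx fun t ht => ?_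
    exact norm_exp_mul_ofReal_le (mul_nonpos_of_nonpos_of_nonneg (re_mul_sub_nonpos hz hjk)
      (sub_nonneg.2 (hp.monotone ht.2)))
  · rw [integral_halfKernel_of_gt hjk (hα.trans hx), norm_neg]
    simp only [← mul_assoc (Complex.exp _)]
    have hle : ∀ t, x ≤ t → ‖e t‖ ≤ 1 := fun t ht => by
      have h2 := re_mul_sub_nonpos hz (not_le.1 hjk).le
      rw [← hee]
      refine norm_exp_mul_ofReal_le ?_
      have : -(z * (b j - b k)) = z * (b k - b j) := by ring
      rw [this]
      exact mul_nonpos_of_nonpos_of_nonneg h2 (sub_nonneg.2 (hp.monotone ht))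
    have hvc : ContinuousOn v (Ici x) := by
      intro y hy
      have hy' : x ≤ y := hy
      have := (hv x (y + 1) hx (by linarith)).continuousOn
      refine (this y (by rw [uIcc_of_le (by linarith)]; exact ⟨hy', by linarith⟩)).mono_of_mem_nhdsWithin ?_
      rw [uIcc_of_le (by linarith)]
      exact mem_nhdsWithin.2 ⟨Iio (y + 1), isOpen_Iio, by simp, fun s hs => ⟨hs.2, hs.1.le⟩⟩
    have hint : IntegrableOn (fun t => e t * v t * q t) (Ioi x) := by
      refine Integrable.bdd_mul (c := 1 * W)
        (q.integrableOn.mono_set fun t ht => (hα.trans hx).trans (le_of_lt ht)) ?_ ?_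
      · have h1 : Continuous e := by
          have := hp.continuous
          simp only [he]; fun_prop
        exact (h1.continuousOn.mul (hvc.mono Ioi_subset_Ici_self)).aestronglyMeasurable
          measurableSet_Ioi
      · filter_upwards [ae_restrict_mem measurableSet_Ioi] with t ht
        rw [norm_mul]
        exact mul_le_mul (hle t (le_of_lt ht)) (hW t (hx.trans (le_of_lt ht))) (norm_nonneg _)
          zero_le_one
    refine le_of_tendsto (intervalIntegral_tendsto_integral_Ioi x hint tendsto_id).norm ?_
    filter_upwards [eventually_ge_atTop x] with c hc
    exact finite x c hx hc fun t ht => hle t ht.1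

/-- The half-line operator with an off-block-diagonal coefficient is small for large `z` on
functions which solve an inhomogeneous equation of the same type. -/
theorem exists_norm_kernelOp_halfKernel_le (hρ_int : ∀ T > 0, IntegrableOn ρ (Ico 0 T))
    (hρ_pos : ∀ᵐ x ∂(volume.restrict (Ici (0 : ℝ))), 0 < ρ x) (hp : IsPhase ρ p) (hα : 0 ≤ α)
    {Q : Fin n → Fin n → HalfLineL1} (hQ : ∀ j l, b j = b l → Q j l = 0) {ε : ℝ} (hε : 0 < ε) :
    ∃ K : ℝ, 0 ≤ K ∧ ∀ (z : ℂ) (k : Fin n) (v g : ℝ → Fin n → ℂ) (W G : ℝ), z ≠ 0 →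
      (∀ j k : Fin n, j ≤ k → (z * b k).re ≤ (z * b j).re) →
      (∀ l, Measurable fun t => v t l) →
      (∀ l a c, α ≤ a → a ≤ c →
        HasACDeriv (fun t => v t l) (fun t => z * (b l - b k) * ρ t * v t l + g t l) a c) →
      (∀ t, α ≤ t → ∀ l, ‖v t l‖ ≤ W) → (∀ l, IntegrableOn (fun t => g t l) (Ici α)) →
      (∀ l, ∫ t in Ici α, ‖g t l‖ ≤ G) →
      ∀ x, α ≤ x → ∀ j, ‖kernelOp (halfKernel b p α k z) (fun j l => Q j l) v x j‖ ≤
        ε * W + K * (W + G) / ‖z‖ := by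
  -- Dividing by n + 1 instead of n keeps the denominator nonzero for n = 0; summing n terms still
  -- gives at most ε.
  have hε' : 0 < ε / (n + 1) := by positivity
  have h : ∀ j l : Fin n, ∃ K : ℝ, 0 ≤ K ∧ ∀ (z : ℂ) (k : Fin n) (v g : ℝ → ℂ) (W G : ℝ), z ≠ 0 →
      (∀ j k : Fin n, j ≤ k → (z * b k).re ≤ (z * b j).re) →
      (∀ a c, α ≤ a → a ≤ c → HasACDeriv v (fun t => z * (b l - b k) * ρ t * v t + g t) a c) →
      (∀ t, α ≤ t → ‖v t‖ ≤ W) → IntegrableOn g (Ici α) → ∫ t in Ici α, ‖g t‖ ≤ G →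
      ∀ x, α ≤ x → ‖∫ t in Ici 0, halfKernel b p α k z j x t * v t * Q j l t‖ ≤
        ε / (n + 1) * W + K * (W + G) / ‖z‖ := by
    intro j l
    by_cases hjl : b j = b l
    · refine ⟨0, le_rfl, fun z k v g W G _ _ _ hW _ _ x hx => ?_⟩
      have hW0 : 0 ≤ W := (norm_nonneg _).trans (hW x hx)
      have : ∫ t in Ici 0, halfKernel b p α k z j x t * v t * Q j l t = 0 := by
        rw [hQ j l hjl]
        refine integral_eq_zero_of_ae ?_
        filter_upwards [Lp.coeFn_zero ℂ 1 (volume.restrict (Ici (0 : ℝ)))] with t ht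
        rw [ht]; simp
      rw [this, norm_zero, zero_mul, zero_div, add_zero]
      positivity
    · exact exists_norm_integral_halfKernel_le hρ_int hρ_pos hp hα (Q j l) hε' hjl
  choose K hK0 hK using h
  refine ⟨∑ j, ∑ l, K j l, Finset.sum_nonneg fun j _ => Finset.sum_nonneg fun l _ => hK0 j l,
    fun z k v g W G hz0 hz hvm hv hW hg hG x hx j => ?_⟩
  have hW0 : 0 ≤ W := (norm_nonneg _).trans (hW x hx j)
  have hG0 : 0 ≤ G := (integral_nonneg fun _ => norm_nonneg _).trans (hG j)
  rw [kernelOp_eq_sum (B := 1 * W) (measurable_halfKernel hp.continuous) hvm (fun l t =>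
    norm_kernel_mul_le (S := Ici α) (fun x _ j t => norm_halfKernel_le hp.monotone hz j x t)
      (fun x hx j t ht => halfKernel_eq_zero hx ht j) (fun x hx l => hW x hx l) hx j l t)]
  calc _ ≤ ∑ l, (ε / (n + 1) * W + K j l * (W + G) / ‖z‖) :=
        norm_sum_le_of_le _ fun l _ =>
          hK j l z k (fun t => v t l) (fun t => g t l) W G hz0 hz (hv l) (fun t ht => hW t ht l)
            (hg l) (hG l) x hx
    _ = n * (ε / (n + 1)) * W + (∑ l, K j l) * (W + G) / ‖z‖ := by
        rw [Finset.sum_add_distrib, Finset.sum_const, Finset.card_univ, Fintype.card_fin,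
          nsmul_eq_mul, Finset.sum_mul, Finset.sum_div, mul_assoc]
    _ ≤ _ := by
        refine add_le_add (mul_le_mul_of_nonneg_right ?_ hW0) ?_
        · rw [mul_div_assoc', div_le_iff₀ (by positivity)]
          nlinarith
        · refine div_le_div_of_nonneg_right (mul_le_mul_of_nonneg_right ?_ (by positivity))
            (norm_nonneg _)
          exact Finset.single_le_sum (f := fun j => ∑ l, K j l)
            (fun i _ => Finset.sum_nonneg fun l _ => hK0 i l) (Finset.mem_univ j)

theorem integrableOn_sum_mul {R : Fin n → Fin n → HalfLineL1} {w : ℝ → Fin n → ℂ} {W : ℝ}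
    (hα : 0 ≤ α) (hw : ∀ l, AEStronglyMeasurable (fun t => w t l) (volume.restrict (Ici α)))
    (hW : ∀ t, α ≤ t → ∀ l, ‖w t l‖ ≤ W)
    (j : Fin n) : IntegrableOn (fun t => ∑ l, R j l t * w t l) (Ici α) := by
  refine integrable_finsetSum _ fun l _ => ?_
  refine Integrable.mul_bdd (c := W) ((R j l).integrableOn.mono_set (Ici_subset_Ici.2 hα)) (hw l) ?_
  filter_upwards [ae_restrict_mem measurableSet_Ici] with t ht using hW t ht l

theorem integral_norm_sum_mul_le {R : Fin n → Fin n → HalfLineL1} {w : ℝ → Fin n → ℂ} {W : ℝ}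
    (hα : 0 ≤ α) (hw : ∀ l, AEStronglyMeasurable (fun t => w t l) (volume.restrict (Ici α)))
    (hW : ∀ t, α ≤ t → ∀ l, ‖w t l‖ ≤ W)
    (j : Fin n) : ∫ t in Ici α, ‖∑ l, R j l t * w t l‖ ≤
      (∫ t in Ici α, entrySum (fun j l => R j l) t) * W := by
  rw [← integral_mul_const]
  refine setIntegral_mono_on (integrableOn_sum_mul hα hw hW j).norm ?_ measurableSet_Ici
    fun t ht => norm_sum_mul_le (R := fun j l => R j l) (hW t ht) j
  exact (integrableOn_entrySum fun j l => (R j l).integrableOn.mono_set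
    (Ici_subset_Ici.2 hα)).mul_const W

/-- This is what makes the square of the operator better than the operator: an image Kw solves the
differential equation with source Rw, so a second application can be integrated by parts although w
itself has no regularity. -/
theorem hasACDeriv_kernelOp_halfKernel (hp : IsPhase ρ p) (hα : 0 ≤ α) {z : ℂ} {k : Fin n}
    (hz : ∀ j k : Fin n, j ≤ k → (z * b k).re ≤ (z * b j).re) {R : Fin n → Fin n → ℝ → ℂ}
    {w : ℝ → Fin n → ℂ} (j : Fin n)
    (hh : IntegrableOn (fun t => ∑ l, R j l t * w t l) (Ici α)) {a c : ℝ}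
    (ha : α ≤ a) (hac : a ≤ c) :
    HasACDeriv (fun x => kernelOp (halfKernel b p α k z) R w x j)
      (fun x => z * (b j - b k) * ρ x * kernelOp (halfKernel b p α k z) R w x j +
        ∑ l, R j l x * w x l) a c := by
  obtain ⟨C, hC⟩ := exists_integral_halfKernel_eq (k := k) hp hα hz j hh
  have hαc := ha.trans hac
  have hsub : uIcc a c ⊆ uIcc α c := by
    rw [uIcc_of_le hac, uIcc_of_le hαc]; exact Icc_subset_Icc ha le_rfl
  have hi : IntervalIntegrable (fun t => ∑ l, R j l t * w t l) volume α c := by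
    rw [intervalIntegrable_iff_integrableOn_Ioc_of_le hαc]
    exact hh.mono_set fun t ht => ht.1.le
  have h := ((hp.hasACDeriv_duhamel hα (hα.trans hαc) (z * (b j - b k)) hi left_mem_uIcc
    C).congr (g := fun x => kernelOp (halfKernel b p α k z) R w x j) fun x hx => by
      rw [uIcc_of_le hαc] at hx
      exact (hC x hx.1).symm).congr_deriv
    (g' := fun x => z * (b j - b k) * ρ x * kernelOp (halfKernel b p α k z) R w x j +
        ∑ l, R j l x * w x l) (Eventually.of_forall fun x hx => by
      rw [uIcc_of_le hαc] at hx
      rw [← hC x hx.1]; rfl)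
  exact h.mono hsub

theorem entrySum_add_le {P Q : Fin n → Fin n → ℝ → ℂ} (t : ℝ) :
    entrySum (fun j l t => P j l t + Q j l t) t ≤ entrySum P t + entrySum Q t := by
  simp only [entrySum, ← Finset.sum_add_distrib]
  exact Finset.sum_le_sum fun j _ => Finset.sum_le_sum fun l _ => norm_add_le _ _

end HalfLineEstimates

/-! ### Smallness of the square of the half-line operator. -/

section Contraction

variable {n : ℕ}

theorem neumannTerm_succ' (E : Fin n → ℝ → ℝ → ℂ) (R : Fin n → Fin n → ℝ → ℂ)
    (w₀ : ℝ → Fin n → ℂ) (m : ℕ) :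
    neumannTerm E R w₀ (m + 1) = neumannTerm E R (kernelOp E R w₀) m := by
  induction m with
  | zero => rfl
  | succ m ih => rw [neumannTerm, ih, neumannTerm]

/-- If `K²` is a `1/4`-contraction, the Neumann series is dominated by a geometric series. -/
theorem norm_neumannTerm_le_of_sq {E : Fin n → ℝ → ℝ → ℂ} {R : Fin n → Fin n → ℝ → ℂ}
    {w₀ : ℝ → Fin n → ℂ} {S : Set ℝ} {D : ℝ} (hE : ∀ j, Measurable (Function.uncurry (E j)))
    (hR : ∀ j l, Measurable (R j l)) (hw : ∀ l, Measurable fun t => w₀ t l)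
    (h0 : ∀ x ∈ S, ∀ j, ‖w₀ x j‖ ≤ D) (h1 : ∀ x ∈ S, ∀ j, ‖kernelOp E R w₀ x j‖ ≤ D * (1 / 2))
    (hsq : ∀ (w : ℝ → Fin n → ℂ) (W : ℝ), (∀ l, Measurable fun t => w t l) →
      (∀ x ∈ S, ∀ j, ‖w x j‖ ≤ W) →
      ∀ x ∈ S, ∀ j, ‖kernelOp E R (kernelOp E R w) x j‖ ≤ W / 4) (m : ℕ) :
    ∀ x ∈ S, ∀ j, ‖neumannTerm E R w₀ m x j‖ ≤ D * (1 / 2) ^ m := by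
  -- The hypothesis gains 1/4 every two steps, so the induction carries two consecutive terms.
  suffices H : (∀ x ∈ S, ∀ j, ‖neumannTerm E R w₀ m x j‖ ≤ D * (1 / 2) ^ m) ∧
      ∀ x ∈ S, ∀ j, ‖neumannTerm E R w₀ (m + 1) x j‖ ≤ D * (1 / 2) ^ (m + 1) from H.1
  induction m with
  | zero =>
    refine ⟨fun x hx j => ?_, fun x hx j => ?_⟩
    · rw [pow_zero, mul_one]; exact h0 x hx j
    · rw [zero_add, pow_one]; exact h1 x hx j
  | succ m ih =>
    refine ⟨ih.2, fun x hx j => ?_⟩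
    refine (hsq (neumannTerm E R w₀ m) _ (measurable_neumannTerm hE hR hw m) ih.1 x hx j).trans
      (le_of_eq ?_)
    rw [pow_succ, pow_succ]; ring

theorem kernelOp_add {E : Fin n → ℝ → ℝ → ℂ} {P Q : Fin n → Fin n → HalfLineL1} {B : ℝ}
    {w : ℝ → Fin n → ℂ} (hE : ∀ j, Measurable (Function.uncurry (E j)))
    (hw : ∀ l, Measurable fun t => w t l) {x : ℝ} {j : Fin n}
    (hB : ∀ l t, ‖E j x t * w t l‖ ≤ B) :
    kernelOp E (fun j l => (P j l + Q j l : HalfLineL1)) w x j =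
      kernelOp E (fun j l => P j l) w x j + kernelOp E (fun j l => Q j l) w x j := by
  rw [kernelOp_eq_sum (R := fun j l => P j l + Q j l) hE hw hB,
    kernelOp_eq_sum (R := P) hE hw hB, kernelOp_eq_sum (R := Q) hE hw hB,
    ← Finset.sum_add_distrib]
  refine Finset.sum_congr rfl fun l _ => ?_
  have hm : Measurable fun t => E j x t * w t l := (hE j).of_uncurry_left.mul (hw l)
  exact (boundedPairing _ hm (hB l)).map_add (P j l) (Q j l)

/-- The columns of the identity matrix, as constant vector functions. -/
def unitColumn (k : Fin n) (_ : ℝ) (j : Fin n) : ℂ := if j = k then 1 else 0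

theorem norm_unitColumn_le (k : Fin n) (x : ℝ) (j : Fin n) : ‖unitColumn k x j‖ ≤ 1 := by
  unfold unitColumn; split_ifs <;> simp

theorem measurable_unitColumn (k l : Fin n) : Measurable fun t => unitColumn k t l :=
  measurable_const

variable {ρ p : ℝ → ℝ} {α : ℝ} {b : Fin n → ℂ}

/-- The off-block part Q is treated by oscillation and P by its L¹ norm. The unit column solves the
homogeneous equation, because its only nonzero entry has factor b_k - b_k = 0, so its source is 0.
For the square, the inner image and its source are both bounded by (∫γ)W, γ being the entry sum of Q
+ P; this is where 2K comes from. -/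
theorem exists_halfKernel_contraction (hρ_int : ∀ T > 0, IntegrableOn ρ (Ico 0 T))
    (hρ_pos : ∀ᵐ x ∂(volume.restrict (Ici (0 : ℝ))), 0 < ρ x) (hp : IsPhase ρ p) (hα : 0 ≤ α)
    {Q : Fin n → Fin n → HalfLineL1} (hQ : ∀ j l, b j = b l → Q j l = 0) {ε : ℝ} (hε : 0 < ε) :
    ∃ K : ℝ, 0 ≤ K ∧ ∀ (P : Fin n → Fin n → HalfLineL1) (z : ℂ) (k : Fin n), z ≠ 0 →
      (∀ j k : Fin n, j ≤ k → (z * b k).re ≤ (z * b j).re) →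
      (∀ x, α ≤ x → ∀ j,
        ‖kernelOp (halfKernel b p α k z) (fun j l => (Q j l + P j l : HalfLineL1))
          (unitColumn k) x j‖ ≤
          ε + K / ‖z‖ + ∫ t in Ici α, entrySum (fun j l => P j l) t) ∧
      ∀ (w : ℝ → Fin n → ℂ) (W : ℝ), (∀ l, Measurable fun t => w t l) →
        (∀ x, α ≤ x → ∀ j, ‖w x j‖ ≤ W) → ∀ x, α ≤ x → ∀ j,
        ‖kernelOp (halfKernel b p α k z) (fun j l => (Q j l + P j l : HalfLineL1))
          (kernelOp (halfKernel b p α k z) (fun j l => (Q j l + P j l : HalfLineL1)) w) x j‖ ≤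
          (ε + 2 * K / ‖z‖ + ∫ t in Ici α, entrySum (fun j l => P j l) t) *
            ((∫ t in Ici α, entrySum (fun j l => (Q j l + P j l : HalfLineL1)) t) * W) := by
  obtain ⟨K, hK, H⟩ := exists_norm_kernelOp_halfKernel_le hρ_int hρ_pos hp hα hQ hε
  refine ⟨K, hK, fun P z k hz0 hz => ?_⟩
  have hEm : ∀ j, Measurable (Function.uncurry (halfKernel b p α k z j)) :=
    measurable_halfKernel hp.continuous
  have hbd : ∀ {v : ℝ → Fin n → ℂ} {W : ℝ}, (∀ x, α ≤ x → ∀ j, ‖v x j‖ ≤ W) → ∀ x, α ≤ x →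
      ∀ j l t, ‖halfKernel b p α k z j x t * v t l‖ ≤ 1 * W := fun hv x hx j l t =>
    norm_kernel_mul_le (S := Ici α) (fun x _ j t => norm_halfKernel_le hp.monotone hz j x t)
      (fun x hx j t ht => halfKernel_eq_zero hx ht j) (fun x hx l => hv x hx l) hx j l t
  have hPi : ∀ j l, IntegrableOn (fun t => P j l t) (Ici 0) := fun j l => (P j l).integrableOn
  have step : ∀ (v g : ℝ → Fin n → ℂ) (W G : ℝ), (∀ l, Measurable fun t => v t l) →
      (∀ l a c, α ≤ a → a ≤ c →
        HasACDeriv (fun t => v t l) (fun t => z * (b l - b k) * ρ t * v t l + g t l) a c) →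
      (∀ t, α ≤ t → ∀ l, ‖v t l‖ ≤ W) → (∀ l, IntegrableOn (fun t => g t l) (Ici α)) →
      (∀ l, ∫ t in Ici α, ‖g t l‖ ≤ G) →
      ∀ x, α ≤ x → ∀ j, ‖kernelOp (halfKernel b p α k z)
        (fun j l => (Q j l + P j l : HalfLineL1)) v x j‖ ≤
        ε * W + K * (W + G) / ‖z‖ + (∫ t in Ici α, entrySum (fun j l => P j l) t) * W := by
    intro v g W G hvm hv hW hg hG x hx j
    rw [kernelOp_add hEm hvm (hbd hW x hx j)]
    exact (norm_add_le _ _).trans (add_le_add (H z k v g W G hz0 hz hvm hv hW hg hG x hx j)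
      (norm_kernelOp_halfKernel_le hα hp.monotone hz hPi hW hx j))
  refine ⟨fun x hx j => ?_, fun w W hwm hW x hx j => ?_⟩
  · have := step (unitColumn k) (fun _ _ => 0) 1 0 (measurable_unitColumn k) (fun l a c _ _ => ?_)
      (fun t _ l => norm_unitColumn_le k t l) (fun l => integrableOn_zero) (fun l => by simp) x hx j
    · simpa using this
    · refine (HasACDeriv.const (unitColumn k 0 l) a c).congr_deriv (Eventually.of_forall
        fun t _ => ?_)
      unfold unitColumn
      split_ifs with h
      · simp [h]
      · simp
  · obtain ⟨R, hR⟩ : ∃ R : Fin n → Fin n → HalfLineL1, ∀ j l, Q j l + P j l = R j l := ⟨_, fun _ _ => rfl⟩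
    simp only [hR] at step ⊢
    obtain ⟨r, hr⟩ : ∃ r, r = ∫ t in Ici α, entrySum (fun j l => R j l) t := ⟨_, rfl⟩
    rw [← hr]
    have hRi : ∀ j l, IntegrableOn (fun t => R j l t) (Ici 0) := fun j l => (R j l).integrableOn
    have hwa : ∀ l, AEStronglyMeasurable (fun t => w t l) (volume.restrict (Ici α)) :=
      fun l => (hwm l).aestronglyMeasurable
    have hint := integrableOn_sum_mul (R := R) hα hwa hW
    have := step (kernelOp (halfKernel b p α k z) (fun j l => R j l) w)
      (fun t j => ∑ l, R j l t * w t l) (r * W) (r * W)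
      (measurable_kernelOp hEm (fun j l => (R j l).measurable) hwm)
      (fun l a c ha hac => hasACDeriv_kernelOp_halfKernel (R := fun j l => (R j l : ℝ → ℂ)) (w := w) hp hα hz l
        (hint l) ha hac)
      (fun t ht l => hr ▸ norm_kernelOp_halfKernel_le (R := fun j l => (R j l : ℝ → ℂ)) hα hp.monotone hz hRi hW ht l) hint
      (fun l => hr ▸ integral_norm_sum_mul_le (R := R) hα hwa hW l) x hx j
    refine this.trans (le_of_eq ?_)
    ring

end Contraction

/-! ### The kernel that continues solutions to [0, α]. -/

section BackwardKernel

variable {n : ℕ} {ρ p : ℝ → ℝ} {α : ℝ} {b : Fin n → ℂ} {z : ℂ} {k : Fin n}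

/-- The kernel of the integral equation which continues the `k`-th column to `[0, α]`. -/
noncomputable def backKernel (b : Fin n → ℂ) (p : ℝ → ℝ) (α : ℝ) (k : Fin n) (z : ℂ) (j : Fin n)
    (x t : ℝ) : ℂ :=
  signedKernel α x t * Complex.exp (z * (b j - b k) * ((p x - p t : ℝ) : ℂ))

theorem measurable_backKernel (hp : Continuous p) (j : Fin n) :
    Measurable (Function.uncurry (backKernel b p α k z j)) := by
  have h3 : Measurable fun q : ℝ × ℝ =>
      Complex.exp (z * (b j - b k) * ((p q.1 - p q.2 : ℝ) : ℂ)) := by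
    refine Continuous.measurable ?_
    fun_prop
  exact (measurable_signedKernel α).mul h3

theorem backKernel_eq_zero {x t : ℝ} (ht : t ∉ uIoc α x) (j : Fin n) :
    backKernel b p α k z j x t = 0 := by
  rw [backKernel, signedKernel_eq_zero ht, zero_mul]

/-- On [0, α] the exponent has no favourable sign. A bound growing with |z| is enough, since only
local uniformity in z is needed there. -/
theorem norm_exp_phase_le (hp : Monotone p) {L x t : ℝ} (hL : ‖z‖ ≤ L) (hx : x ∈ Icc 0 α)
    (ht : t ∈ Icc 0 α) (j : Fin n) :
    ‖Complex.exp (z * (b j - b k) * ((p x - p t : ℝ) : ℂ))‖ ≤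
      Real.exp (L * (∑ i, ‖b i - b k‖) * (p α - p 0)) := by
  refine (Complex.norm_exp_le_exp_norm _).trans (Real.exp_le_exp.2 ?_)
  rw [norm_mul, norm_mul, Complex.norm_real, Real.norm_eq_abs]
  have hL0 : 0 ≤ L := (norm_nonneg _).trans hL
  have h1 : ‖b j - b k‖ ≤ ∑ i, ‖b i - b k‖ :=
    Finset.single_le_sum (f := fun i => ‖b i - b k‖) (fun _ _ => norm_nonneg _) (Finset.mem_univ j)
  have h2 : |p x - p t| ≤ p α - p 0 := by
    have a1 := hp hx.1
    have a2 := hp hx.2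
    have a3 := hp ht.1
    have a4 := hp ht.2
    rw [abs_le]; constructor <;> linarith
  exact mul_le_mul (mul_le_mul hL h1 (norm_nonneg _) hL0) h2 (abs_nonneg _)
    (mul_nonneg hL0 (Finset.sum_nonneg fun _ _ => norm_nonneg _))

theorem norm_backKernel_le (hp : Monotone p) {L x : ℝ} (hL : ‖z‖ ≤ L) (hx : x ∈ Icc 0 α)
    (j : Fin n) (t : ℝ) :
    ‖backKernel b p α k z j x t‖ ≤ Real.exp (L * (∑ i, ‖b i - b k‖) * (p α - p 0)) := by
  by_cases ht : t ∈ uIoc α x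
  · rw [backKernel, norm_mul]
    rw [uIoc_of_ge hx.2] at ht
    exact (mul_le_of_le_one_left (norm_nonneg _) (norm_signedKernel_le _ _ _)).trans
      (norm_exp_phase_le hp hL hx ⟨hx.1.trans ht.1.le, ht.2⟩ j)
  · rw [backKernel_eq_zero ht, norm_zero]; positivity

theorem integral_backKernel (hα : 0 ≤ α) {x : ℝ} (hx : 0 ≤ x) (j : Fin n) (h : ℝ → ℂ) :
    ∫ t in Ici 0, backKernel b p α k z j x t * h t =
      Complex.exp (z * (b j - b k) * ((p x - p α : ℝ) : ℂ)) *
        ∫ t in α..x, Complex.exp (-(z * (b j - b k)) * ((p t - p α : ℝ) : ℂ)) * h t := by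
  simp only [backKernel, mul_assoc (signedKernel _ _ _)]
  rw [integral_signedKernel_mul hα hx, ← intervalIntegral.integral_const_mul]
  refine intervalIntegral.integral_congr fun t _ => ?_
  rw [← mul_assoc (Complex.exp (z * (b j - b k) * ((p x - p α : ℝ) : ℂ))), ← Complex.exp_add]
  congr 2
  push_cast; ring

end BackwardKernel

/-! ### Construction of a column on the whole half-line. -/

section Column

variable {n : ℕ} {ρ p : ℝ → ℝ} {α : ℝ} {b : Fin n → ℂ}

theorem integral_entrySum_eq (R : Fin n → Fin n → HalfLineL1) :
    ∫ t in Ici 0, entrySum (fun j l => R j l) t = ∑ j, ∑ l, ‖R j l‖ := by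
  unfold entrySum
  rw [integral_finsetSum _ fun j _ => integrable_finsetSum _ fun l _ => (R j l).integrableOn.norm]
  refine Finset.sum_congr rfl fun j _ => ?_
  rw [integral_finsetSum _ fun l _ => (R j l).integrableOn.norm]
  exact Finset.sum_congr rfl fun l _ => (L1.norm_eq_integral_norm _).symm

theorem aestronglyMeasurable_of_indicator {S : Set ℝ} (hS : MeasurableSet S) {f : ℝ → ℂ}
    (h : Measurable (S.indicator f)) : AEStronglyMeasurable f (volume.restrict S) :=
  h.aestronglyMeasurable.congr (indicator_ae_eq_restrict hS)

/-- The `k`-th column on `[α, ∞)`, with the exponential factor removed. -/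
noncomputable def forwardColumn (b : Fin n → ℂ) (p : ℝ → ℝ) (α : ℝ)
    (R : Fin n → Fin n → ℂ → HalfLineL1) (k : Fin n) (z : ℂ) :
    ℝ → Fin n → ℂ :=
  neumannSum (halfKernel b p α k z) (fun j l => R j l z) (unitColumn k)

/-- The initial term of the continuation of the `k`-th column to `[0, α]`. -/
noncomputable def backwardStart (b : Fin n → ℂ) (p : ℝ → ℝ) (α : ℝ)
    (R : Fin n → Fin n → ℂ → HalfLineL1) (k : Fin n) (z : ℂ)
    (x : ℝ) (j : Fin n) : ℂ :=
  forwardColumn b p α R k z α j * Complex.exp (z * (b j - b k) * ((p x - p α : ℝ) : ℂ))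

/-- The `k`-th column on `[0, α]`, with the exponential factor removed. -/
noncomputable def backwardColumn (b : Fin n → ℂ) (p : ℝ → ℝ) (α : ℝ)
    (R : Fin n → Fin n → ℂ → HalfLineL1) (k : Fin n) (z : ℂ) :
    ℝ → Fin n → ℂ :=
  neumannSum (backKernel b p α k z) (fun j l => R j l z) (backwardStart b p α R k z)

open Classical in
/-- The `k`-th column on `[0, ∞)`, with the exponential factor removed. -/
noncomputable def column (b : Fin n → ℂ) (p : ℝ → ℝ) (α : ℝ)
    (R : Fin n → Fin n → ℂ → HalfLineL1) (k : Fin n) (z : ℂ)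
    (x : ℝ) (j : Fin n) : ℂ :=
  if α ≤ x then forwardColumn b p α R k z x j else backwardColumn b p α R k z x j

/-- The conditions on the coefficient `R` under which the columns are constructed for `z ∈ Λ`. -/
structure ContractionData (b : Fin n → ℂ) (p : ℝ → ℝ) (α : ℝ)
    (R : Fin n → Fin n → ℂ → HalfLineL1) (Λ : Set ℂ) (N₀ : ℝ) : Prop where
  order : ∀ z ∈ Λ, ∀ j k : Fin n, j ≤ k → (z * b k).re ≤ (z * b j).re
  bound : ∀ z ∈ Λ, ∫ t in Ici α, entrySum (fun j l => R j l z) t ≤ N₀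
  sq : ∀ z ∈ Λ, ∀ (k : Fin n) (w : ℝ → Fin n → ℂ) (W : ℝ), (∀ l, Measurable fun t => w t l) →
    (∀ x, α ≤ x → ∀ j, ‖w x j‖ ≤ W) → ∀ x, α ≤ x → ∀ j,
    ‖kernelOp (halfKernel b p α k z) (fun j l => R j l z)
      (kernelOp (halfKernel b p α k z) (fun j l => R j l z) w) x j‖ ≤ W / 4

variable {R : Fin n → Fin n → ℂ → HalfLineL1} {Λ : Set ℂ} {N₀ : ℝ} {k : Fin n} {z : ℂ}

namespace ContractionData

theorem nonneg (h : ContractionData b p α R Λ N₀) (hz : z ∈ Λ) : 0 ≤ N₀ :=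
  (integral_nonneg fun _ => entrySum_nonneg _ _).trans (h.bound z hz)

theorem norm_neumannTerm_forward_le (h : ContractionData b p α R Λ N₀) (hp : IsPhase ρ p)
    (hα : 0 ≤ α) (hz : z ∈ Λ) (m : ℕ) :
    ∀ x ∈ Ici α, ∀ j, ‖neumannTerm (halfKernel b p α k z) (fun j l => R j l z) (unitColumn k)
      m x j‖ ≤ (1 + 2 * N₀) * (1 / 2) ^ m := by
  have hN := h.nonneg hz
  -- The constant 1 + 2N₀ dominates e_k, bounded by 1, and its half dominates the image Ke_k,
  -- bounded by N₀.
  refine norm_neumannTerm_le_of_sq (measurable_halfKernel hp.continuous)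
    (fun j l => (R j l z).measurable) (measurable_unitColumn k)
    (fun x _ j => (norm_unitColumn_le k x j).trans (by linarith)) (fun x hx j => ?_)
    (h.sq z hz k) m
  have := norm_kernelOp_halfKernel_le (R := fun j l => (R j l z : ℝ → ℂ)) (k := k) hα hp.monotone
    (h.order z hz) (fun j l => (R j l z).integrableOn) (fun x _ l => norm_unitColumn_le k x l) hx j
  have h2 := h.bound z hz
  linarith

theorem norm_forwardColumn_le (h : ContractionData b p α R Λ N₀) (hp : IsPhase ρ p)
    (hα : 0 ≤ α) (hz : z ∈ Λ) {x : ℝ} (hx : α ≤ x) (j : Fin n) :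
    ‖forwardColumn b p α R k z x j‖ ≤ 2 * (1 + 2 * N₀) :=
  norm_neumannSum_le (S := Ici α) (h.norm_neumannTerm_forward_le hp hα hz) hx j

/-- The deviation from e_k is the Neumann series started from Ke_k, so it is of the order of Ke_k.
This estimate yields the decay of the remainder s_{jk}. -/
theorem norm_forwardColumn_sub_le (h : ContractionData b p α R Λ N₀) (hp : IsPhase ρ p)
    (hα : 0 ≤ α) (hz : z ∈ Λ) {s : ℝ}
    (hs : ∀ x, α ≤ x → ∀ j, ‖kernelOp (halfKernel b p α k z) (fun j l => R j l z)
      (unitColumn k) x j‖ ≤ s) {x : ℝ} (hx : α ≤ x) (j : Fin n) :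
    ‖forwardColumn b p α R k z x j - unitColumn k x j‖ ≤ 2 * ((1 + 2 * N₀) * s) := by
  have hN := h.nonneg hz
  have hs0 : 0 ≤ s := (norm_nonneg _).trans (hs x hx j)
  refine norm_neumannSum_sub_le (S := Ici α) (h.norm_neumannTerm_forward_le hp hα hz) hx j
    fun m => ?_
  rw [neumannTerm_succ']
  refine norm_neumannTerm_le_of_sq (S := Ici α) (measurable_halfKernel hp.continuous)
    (fun j l => (R j l z).measurable) (measurable_kernelOp (measurable_halfKernel hp.continuous)
      (fun j l => (R j l z).measurable) (measurable_unitColumn k))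
    (fun x hx j => (hs x hx j).trans ?_) (fun x hx j => ?_) (h.sq z hz k) m x hx j
  · nlinarith
  · have := norm_kernelOp_halfKernel_le (R := fun j l => (R j l z : ℝ → ℂ)) (k := k) hα hp.monotone
      (h.order z hz) (fun j l => (R j l z).integrableOn) hs hx j
    have h2 := mul_le_mul_of_nonneg_right (h.bound z hz) hs0
    linarith

theorem forwardColumn_eq (h : ContractionData b p α R Λ N₀) (hp : IsPhase ρ p)
    (hα : 0 ≤ α) (hz : z ∈ Λ) {x : ℝ} (hx : α ≤ x) (j : Fin n) :
    forwardColumn b p α R k z x j = unitColumn k x j +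
      kernelOp (halfKernel b p α k z) (fun j l => R j l z) (forwardColumn b p α R k z) x j :=
  neumannSum_eq (S := Ici α) (measurable_halfKernel hp.continuous)
    (fun j l => (R j l z).measurable) (fun j l => (R j l z).integrableOn) (measurable_unitColumn k)
    (fun _ _ j t => norm_halfKernel_le hp.monotone (h.order z hz) j _ t)
    (fun x hx j t ht => halfKernel_eq_zero hx ht j) (h.norm_neumannTerm_forward_le hp hα hz) hx j

theorem aestronglyMeasurable_forwardColumn (h : ContractionData b p α R Λ N₀) (hp : IsPhase ρ p)
    (hα : 0 ≤ α) (hz : z ∈ Λ) (l : Fin n) :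
    AEStronglyMeasurable (fun t => forwardColumn b p α R k z t l) (volume.restrict (Ici α)) :=
  aestronglyMeasurable_of_indicator measurableSet_Ici
    (measurable_indicator_neumannSum measurableSet_Ici (measurable_halfKernel hp.continuous)
      (fun j l => (R j l z).measurable) (measurable_unitColumn k)
      (h.norm_neumannTerm_forward_le hp hα hz) l)

/-- For k ≤ j the integral runs over the empty interval from α to α. Entries with j < k involve
integrals over (α, ∞) and are not normalized. -/
theorem forwardColumn_self (h : ContractionData b p α R Λ N₀) (hp : IsPhase ρ p)
    (hα : 0 ≤ α) (hz : z ∈ Λ) {j : Fin n} (hkj : k ≤ j) :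
    forwardColumn b p α R k z α j = if j = k then 1 else 0 := by
  rw [h.forwardColumn_eq hp hα hz le_rfl, kernelOp, integral_halfKernel_of_le hα hkj le_rfl]
  simp [unitColumn]

theorem measurable_backwardStart (hp : Continuous p) (l : Fin n) :
    Measurable fun t => backwardStart b p α R k z t l := by
  refine Continuous.measurable ?_
  unfold backwardStart
  fun_prop

/-- The order of quantifiers matters: D is chosen before z and depends on it only through the bounds
L and N₁, which makes the domination locally uniform in z. -/
theorem exists_norm_neumannTerm_backward_le (h : ContractionData b p α R Λ N₀) (hp : IsPhase ρ p)
    (hα : 0 ≤ α) {L N₁ : ℝ} : ∃ D, ∀ z ∈ Λ, ‖z‖ ≤ L →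
    ∫ t in Ici 0, entrySum (fun j l => R j l z) t ≤ N₁ → ∀ m, ∀ x ∈ Icc 0 α, ∀ j,
    ‖neumannTerm (backKernel b p α k z) (fun j l => R j l z) (backwardStart b p α R k z)
      m x j‖ ≤ D * (1 / 2) ^ m := by
  set B := Real.exp (L * (∑ i, ‖b i - b k‖) * (p α - p 0)) with hB
  have hB0 : 0 < B := Real.exp_pos _
  refine ⟨2 * (1 + 2 * N₀) * B * Real.exp (2 * B * N₁), fun z hz hL hN m x hx j => ?_⟩
  have hN0 := h.nonneg hz
  refine (norm_neumannTerm_le_of_volterra (S := Icc 0 α) (α := α) (B := B)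
    (W := 2 * (1 + 2 * N₀) * B) (fun j l => (R j l z).integrableOn) hα (fun x hx => hx.1)
    (fun x hx => ?_) hB0 (fun x hx j t => norm_backKernel_le hp.monotone hL hx j t)
    (fun x _ j t ht => backKernel_eq_zero ht j) (fun x hx j => ?_) m hx j).trans ?_
  · rw [uIoc_of_ge hx.2]
    exact fun t ht => ⟨hx.1.trans ht.1.le, ht.2⟩
  · rw [backwardStart, norm_mul]
    exact mul_le_mul (h.norm_forwardColumn_le hp hα hz le_rfl j)
      (norm_exp_phase_le hp.monotone hL hx ⟨hα, le_rfl⟩ j) (norm_nonneg _) (by positivity)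
  · refine mul_le_mul_of_nonneg_right (mul_le_mul_of_nonneg_left ?_ (by positivity)) (by positivity)
    exact Real.exp_le_exp.2 (mul_le_mul_of_nonneg_left hN (by positivity))

theorem backKernel_eq_zero_of_notMem {x : ℝ} (hx : x ∈ Icc 0 α) (j : Fin n) {t : ℝ}
    (ht : t ∉ Icc 0 α) : backKernel b p α k z j x t = 0 := by
  refine backKernel_eq_zero (fun h => ht ?_) j
  rw [uIoc_of_ge hx.2] at h
  exact ⟨hx.1.trans h.1.le, h.2⟩

theorem backwardColumn_eq (h : ContractionData b p α R Λ N₀) (hp : IsPhase ρ p)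
    (hα : 0 ≤ α) (hz : z ∈ Λ) {x : ℝ} (hx : x ∈ Icc 0 α) (j : Fin n) :
    backwardColumn b p α R k z x j = backwardStart b p α R k z x j +
      kernelOp (backKernel b p α k z) (fun j l => R j l z) (backwardColumn b p α R k z) x j := by
  obtain ⟨D, hD⟩ := h.exists_norm_neumannTerm_backward_le (k := k) hp hα (L := ‖z‖)
    (N₁ := ∫ t in Ici 0, entrySum (fun j l => R j l z) t)
  exact neumannSum_eq (S := Icc 0 α) (measurable_backKernel hp.continuous)
    (fun j l => (R j l z).measurable) (fun j l => (R j l z).integrableOn)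
    (measurable_backwardStart hp.continuous)
    (fun x hx j t => norm_backKernel_le hp.monotone le_rfl hx j t)
    (fun x hx j t ht => backKernel_eq_zero_of_notMem hx j ht) (hD z hz le_rfl le_rfl) hx j

/-- At the junction α the integral term of the backward equation vanishes and its initial term is
the forward value, so the two definitions agree there. -/
theorem column_of_mem_Icc (h : ContractionData b p α R Λ N₀) (hp : IsPhase ρ p)
    (hα : 0 ≤ α) (hz : z ∈ Λ) {x : ℝ} (hx : x ∈ Icc 0 α) (j : Fin n) :
    column b p α R k z x j = backwardColumn b p α R k z x j := by
  unfold column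
  split_ifs with hαx
  · obtain rfl : x = α := le_antisymm hx.2 hαx
    rw [h.backwardColumn_eq hp hα hz hx, kernelOp, integral_backKernel hα hα]
    simp [backwardStart]
  · rfl

theorem column_of_le {x : ℝ} (hx : α ≤ x) (j : Fin n) :
    column b p α R k z x j = forwardColumn b p α R k z x j := if_pos hx

theorem integrableOn_column (h : ContractionData b p α R Λ N₀) (hp : IsPhase ρ p)
    (hα : 0 ≤ α) (hz : z ∈ Λ) (j : Fin n) :
    IntegrableOn (fun t => ∑ l, R j l z t * column b p α R k z t l) (Ici 0) := by
  have hU : Icc 0 α ∪ Ici α = Ici (0 : ℝ) := Icc_union_Ici_eq_Ici hα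
  refine (IntegrableOn.union ?_ ?_).mono_set hU.ge
  · obtain ⟨D, hD⟩ := h.exists_norm_neumannTerm_backward_le (k := k) hp hα (L := ‖z‖)
      (N₁ := ∫ t in Ici 0, entrySum (fun j l => R j l z) t)
    have hD' := hD z hz le_rfl le_rfl
    have hb : IntegrableOn (fun t => ∑ l, R j l z t * backwardColumn b p α R k z t l)
        (Icc 0 α) := by
      refine integrable_finsetSum _ fun l _ => ?_
      refine Integrable.mul_bdd (c := 2 * D)
        ((R j l z).integrableOn.mono_set Icc_subset_Ici_self) ?_ ?_
      · exact aestronglyMeasurable_of_indicator measurableSet_Icc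
          (measurable_indicator_neumannSum measurableSet_Icc (measurable_backKernel hp.continuous)
            (fun j l => (R j l z).measurable) (measurable_backwardStart hp.continuous) hD' l)
      · filter_upwards [ae_restrict_mem measurableSet_Icc] with t ht
        exact norm_neumannSum_le (S := Icc 0 α) hD' ht l
    refine hb.congr_fun (fun t ht => ?_) measurableSet_Icc
    simp only [h.column_of_mem_Icc hp hα hz ht]
  · refine (integrableOn_sum_mul (R := fun j l => R j l z) hα
      (h.aestronglyMeasurable_forwardColumn hp hα hz (k := k))
      (fun t ht l => h.norm_forwardColumn_le hp hα hz ht l) j).congr_fun (fun t ht => ?_)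
      measurableSet_Ici
    simp only [column_of_le ht]

/-- Duhamel's form of the column on the whole half-line. -/
theorem exists_column_eq (h : ContractionData b p α R Λ N₀) (hp : IsPhase ρ p)
    (hα : 0 ≤ α) (hz : z ∈ Λ) (j : Fin n) :
    ∃ C : ℂ, ∀ x, 0 ≤ x → column b p α R k z x j =
      Complex.exp (z * (b j - b k) * ((p x - p α : ℝ) : ℂ)) *
        (C + ∫ t in α..x, Complex.exp (-(z * (b j - b k)) * ((p t - p α : ℝ) : ℂ)) *
          ∑ l, R j l z t * column b p α R k z t l) := by
  obtain ⟨C, hC⟩ := exists_integral_halfKernel_eq (k := k) hp hα (h.order z hz) j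
    (integrableOn_sum_mul (R := fun j l => R j l z) hα
      (h.aestronglyMeasurable_forwardColumn hp hα hz (k := k))
      (fun t ht l => h.norm_forwardColumn_le hp hα hz ht l) j)
  have hfwd : ∀ x, α ≤ x → column b p α R k z x j =
      Complex.exp (z * (b j - b k) * ((p x - p α : ℝ) : ℂ)) *
        ((unitColumn k 0 j + C) + ∫ t in α..x,
          Complex.exp (-(z * (b j - b k)) * ((p t - p α : ℝ) : ℂ)) *
          ∑ l, R j l z t * column b p α R k z t l) := by
    intro x hx
    rw [column_of_le hx, h.forwardColumn_eq hp hα hz hx, kernelOp, hC x hx]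
    have e1 : unitColumn k x j = Complex.exp (z * (b j - b k) * ((p x - p α : ℝ) : ℂ)) *
        unitColumn k 0 j := by
      unfold unitColumn
      split_ifs with hjk
      · simp [hjk]
      · simp
    have e2 : ∫ t in α..x, Complex.exp (-(z * (b j - b k)) * ((p t - p α : ℝ) : ℂ)) *
        ∑ l, R j l z t * column b p α R k z t l =
        ∫ t in α..x, Complex.exp (-(z * (b j - b k)) * ((p t - p α : ℝ) : ℂ)) *
        ∑ l, R j l z t * forwardColumn b p α R k z t l := by
      refine intervalIntegral.integral_congr fun t ht => ?_
      rw [uIcc_of_le hx] at ht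
      simp only [column_of_le ht.1]
    rw [e1, e2]; ring
  refine ⟨unitColumn k 0 j + C, fun x hx => ?_⟩
  rcases le_total α x with hαx | hxα
  · exact hfwd x hαx
  -- Evaluating the forward formula at α identifies its constant with the initial value of the
  -- backward equation. A single Duhamel formula thus holds on both sides of α, and no gluing of
  -- derivatives is required.
  · have h0 : forwardColumn b p α R k z α j = unitColumn k 0 j + C := by
      have := hfwd α le_rfl
      rw [column_of_le le_rfl] at this
      simpa using this
    rw [h.column_of_mem_Icc hp hα hz ⟨hx, hxα⟩, h.backwardColumn_eq hp hα hz ⟨hx, hxα⟩, kernelOp,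
      integral_backKernel hα hx, backwardStart, h0]
    have e2 : ∫ t in α..x, Complex.exp (-(z * (b j - b k)) * ((p t - p α : ℝ) : ℂ)) *
        ∑ l, R j l z t * column b p α R k z t l =
        ∫ t in α..x, Complex.exp (-(z * (b j - b k)) * ((p t - p α : ℝ) : ℂ)) *
        ∑ l, R j l z t * backwardColumn b p α R k z t l := by
      refine intervalIntegral.integral_congr fun t ht => ?_
      rw [uIcc_of_ge hxα] at ht
      simp only [h.column_of_mem_Icc hp hα hz ⟨hx.trans ht.1, ht.2⟩]
    rw [e2]; ring

theorem hasACDeriv_column (h : ContractionData b p α R Λ N₀) (hp : IsPhase ρ p)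
    (hα : 0 ≤ α) (hz : z ∈ Λ) {T : ℝ} (hT : 0 ≤ T) (j : Fin n) :
    HasACDeriv (fun x => column b p α R k z x j)
      (fun x => z * (b j - b k) * ρ x * column b p α R k z x j +
        ∑ l, R j l z x * column b p α R k z x l) 0 T := by
  obtain ⟨C, hC⟩ := h.exists_column_eq (k := k) hp hα hz j
  have hT' : 0 ≤ max α T := hα.trans (le_max_left _ _)
  have hi : IntervalIntegrable (fun t => ∑ l, R j l z t * column b p α R k z t l) volume 0
      (max α T) := by
    rw [intervalIntegrable_iff]
    exact (h.integrableOn_column hp hα hz j).mono_set (uIoc_subset_Ici_zero le_rfl hT')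
  have hd := hp.hasACDeriv_duhamel le_rfl hT' (z * (b j - b k)) hi
    (s := α) (by rw [uIcc_of_le hT']; exact ⟨hα, le_max_left _ _⟩) C
  have hd' := (hd.congr (g := fun x => column b p α R k z x j) fun x hx =>
    (hC x (uIcc_subset_Ici_zero le_rfl hT' hx)).symm).congr_deriv
    (g' := fun x => z * (b j - b k) * ρ x * column b p α R k z x j +
        ∑ l, R j l z x * column b p α R k z x l) (Eventually.of_forall fun x hx => by
      rw [← hC x (uIcc_subset_Ici_zero le_rfl hT' hx)])
  refine hd'.mono ?_
  rw [uIcc_of_le hT, uIcc_of_le hT']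
  exact Icc_subset_Icc le_rfl (le_max_right _ _)

end ContractionData

end Column

/-! ### Continuity and holomorphy of the columns in λ. -/

namespace ContractionData

variable {n : ℕ} {ρ p : ℝ → ℝ} {α : ℝ} {b : Fin n → ℂ}
  {R : Fin n → Fin n → ℂ → HalfLineL1} {Λ U : Set ℂ} {N₀ : ℝ} {k : Fin n}

theorem mono (h : ContractionData b p α R Λ N₀) (hU : U ⊆ Λ) : ContractionData b p α R U N₀ :=
  ⟨fun z hz => h.order z (hU hz), fun z hz => h.bound z (hU hz), fun z hz => h.sq z (hU hz)⟩

theorem continuousOn_forwardColumn (h : ContractionData b p α R Λ N₀) (hp : IsPhase ρ p)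
    (hα : 0 ≤ α) (hR : ∀ j l, ContinuousOn (R j l) Λ) {x : ℝ} (hx : α ≤ x) (j : Fin n) :
    ContinuousOn (fun z => forwardColumn b p α R k z x j) Λ := by
  refine continuousOn_neumannSum (S := Ici α)
    (fun z hz => h.norm_neumannTerm_forward_le hp hα hz) hx j fun m => ?_
  refine continuousOn_neumannTerm (S := Ici α) (fun z => measurable_halfKernel hp.continuous)
    (fun z => measurable_unitColumn k)
    (fun z hz x _ j t => norm_halfKernel_le hp.monotone (h.order z hz) j x t)
    (fun z x hx j t ht => halfKernel_eq_zero hx ht j)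
    (fun z hz => h.norm_neumannTerm_forward_le hp hα hz) (fun x _ j t => ?_)
    (fun x _ j => continuousOn_const) hR m hx j
  unfold halfKernel
  fun_prop

theorem differentiableOn_forwardColumn (h : ContractionData b p α R U N₀) (hp : IsPhase ρ p)
    (hα : 0 ≤ α) (hU : IsOpen U) (hR : ∀ j l, DifferentiableOn ℂ (R j l) U) {x : ℝ} (hx : α ≤ x)
    (j : Fin n) : DifferentiableOn ℂ (fun z => forwardColumn b p α R k z x j) U := by
  refine differentiableOn_neumannSum (S := Ici α) hU
    (fun z hz => h.norm_neumannTerm_forward_le hp hα hz) hx j fun m => ?_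
  refine differentiableOn_neumannTerm (S := Ici α) hU
    (fun z => measurable_halfKernel hp.continuous) (fun z => measurable_unitColumn k)
    (fun z hz x _ j t => norm_halfKernel_le hp.monotone (h.order z hz) j x t)
    (fun z x hx j t ht => halfKernel_eq_zero hx ht j)
    (fun z hz => h.norm_neumannTerm_forward_le hp hα hz) (fun x _ j t => ?_)
    (fun x _ j => differentiableOn_const _) hR m hx j
  unfold halfKernel
  fun_prop

/-- The terms of the continuation to `[0, α]` are locally uniformly dominated in `z`. -/
theorem exists_isOpen_backward (h : ContractionData b p α R Λ N₀) (hp : IsPhase ρ p)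
    (hα : 0 ≤ α) (hR : ∀ j l, ContinuousOn (R j l) Λ) {z₀ : ℂ} (hz₀ : z₀ ∈ Λ) :
    ∃ V : Set ℂ, IsOpen V ∧ z₀ ∈ V ∧ ∃ L D : ℝ, ∀ z ∈ Λ ∩ V, ‖z‖ ≤ L ∧
      ∀ m, ∀ x ∈ Icc 0 α, ∀ j, ‖neumannTerm (backKernel b p α k z) (fun j l => R j l z)
        (backwardStart b p α R k z) m x j‖ ≤ D * (1 / 2) ^ m := by
  have hc : ContinuousOn (fun z => ∑ j, ∑ l, ‖R j l z‖) Λ :=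
    continuousOn_finsetSum _ fun j _ => continuousOn_finsetSum _ fun l _ => (hR j l).norm
  have h1 : ∀ᶠ z in 𝓝[Λ] z₀, ∑ j, ∑ l, ‖R j l z‖ < (∑ j, ∑ l, ‖R j l z₀‖) + 1 :=
    (hc z₀ hz₀).eventually_lt_const (by linarith)
  obtain ⟨V, hVo, hzV, hV⟩ := mem_nhdsWithin.1 h1
  obtain ⟨D, hD⟩ := h.exists_norm_neumannTerm_backward_le (k := k) hp hα (L := ‖z₀‖ + 1)
    (N₁ := (∑ j, ∑ l, ‖R j l z₀‖) + 1)
  refine ⟨V ∩ Metric.ball z₀ 1, hVo.inter Metric.isOpen_ball, ⟨hzV, Metric.mem_ball_self one_pos⟩,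
    ‖z₀‖ + 1, D, fun z hz => ?_⟩
  have hL : ‖z‖ ≤ ‖z₀‖ + 1 := by
    have h2 : ‖z - z₀‖ < 1 := mem_ball_iff_norm.1 hz.2.2
    have := norm_add_le z₀ (z - z₀)
    rw [add_sub_cancel] at this
    linarith
  refine ⟨hL, hD z hz.1 hL ?_⟩
  rw [integral_entrySum_eq]
  exact (hV ⟨hz.2.1, hz.1⟩).le

theorem continuousOn_backwardColumn (h : ContractionData b p α R Λ N₀) (hp : IsPhase ρ p)
    (hα : 0 ≤ α) (hR : ∀ j l, ContinuousOn (R j l) Λ) {x : ℝ} (hx : x ∈ Icc 0 α) (j : Fin n) :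
    ContinuousOn (fun z => backwardColumn b p α R k z x j) Λ := by
  intro z₀ hz₀
  obtain ⟨V, hVo, hzV, L, D, hV⟩ := h.exists_isOpen_backward (k := k) hp hα hR hz₀
  have key : ContinuousOn (fun z => backwardColumn b p α R k z x j) (Λ ∩ V) := by
    refine continuousOn_neumannSum (S := Icc 0 α) (fun z hz => (hV z hz).2) hx j fun m => ?_
    refine continuousOn_neumannTerm (S := Icc 0 α) (fun z => measurable_backKernel hp.continuous)
      (fun z => measurable_backwardStart hp.continuous)
      (fun z hz x hx j t => norm_backKernel_le hp.monotone (hV z hz).1 hx j t)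
      (fun z x hx j t ht => backKernel_eq_zero_of_notMem hx j ht) (fun z hz => (hV z hz).2)
      (fun x _ j t => ?_) (fun x _ j => ?_) (fun j l => (hR j l).mono inter_subset_left) m hx j
    · unfold backKernel; fun_prop
    · exact ((h.continuousOn_forwardColumn hp hα hR le_rfl j).mono inter_subset_left).mul
        (by fun_prop)
  exact (key z₀ ⟨hz₀, hzV⟩).mono_of_mem_nhdsWithin
    (inter_mem self_mem_nhdsWithin (mem_nhdsWithin_of_mem_nhds (hVo.mem_nhds hzV)))

theorem differentiableOn_backwardColumn (h : ContractionData b p α R U N₀) (hp : IsPhase ρ p)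
    (hα : 0 ≤ α) (hU : IsOpen U) (hR : ∀ j l, DifferentiableOn ℂ (R j l) U) {x : ℝ}
    (hx : x ∈ Icc 0 α) (j : Fin n) :
    DifferentiableOn ℂ (fun z => backwardColumn b p α R k z x j) U := by
  intro z₀ hz₀
  obtain ⟨V, hVo, hzV, L, D, hV⟩ := h.exists_isOpen_backward (k := k) hp hα
    (fun j l => (hR j l).continuousOn) hz₀
  have key : DifferentiableOn ℂ (fun z => backwardColumn b p α R k z x j) (U ∩ V) := by
    refine differentiableOn_neumannSum (S := Icc 0 α) (hU.inter hVo) (fun z hz => (hV z hz).2) hx j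
      fun m => ?_
    refine differentiableOn_neumannTerm (S := Icc 0 α) (hU.inter hVo)
      (fun z => measurable_backKernel hp.continuous)
      (fun z => measurable_backwardStart hp.continuous)
      (fun z hz x hx j t => norm_backKernel_le hp.monotone (hV z hz).1 hx j t)
      (fun z x hx j t ht => backKernel_eq_zero_of_notMem hx j ht) (fun z hz => (hV z hz).2)
      (fun x _ j t => ?_) (fun x _ j => ?_) (fun j l => (hR j l).mono inter_subset_left) m hx j
    · unfold backKernel; fun_prop
    · exact ((h.differentiableOn_forwardColumn hp hα hU hR le_rfl j).mono inter_subset_left).mul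
        (by fun_prop)
  exact ((key z₀ ⟨hz₀, hzV⟩).differentiableAt ((hU.inter hVo).mem_nhds
    ⟨hz₀, hzV⟩)).differentiableWithinAt

theorem continuousOn_column (h : ContractionData b p α R Λ N₀) (hp : IsPhase ρ p)
    (hα : 0 ≤ α) (hR : ∀ j l, ContinuousOn (R j l) Λ) {x : ℝ} (hx : 0 ≤ x) (j : Fin n) :
    ContinuousOn (fun z => column b p α R k z x j) Λ := by
  unfold column
  split_ifs with hαx
  · exact h.continuousOn_forwardColumn hp hα hR hαx j
  · exact h.continuousOn_backwardColumn hp hα hR ⟨hx, (not_le.1 hαx).le⟩ j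

theorem differentiableOn_column (h : ContractionData b p α R U N₀) (hp : IsPhase ρ p)
    (hα : 0 ≤ α) (hU : IsOpen U) (hR : ∀ j l, DifferentiableOn ℂ (R j l) U) {x : ℝ} (hx : 0 ≤ x)
    (j : Fin n) : DifferentiableOn ℂ (fun z => column b p α R k z x j) U := by
  unfold column
  split_ifs with hαx
  · exact h.differentiableOn_forwardColumn hp hα hU hR hαx j
  · exact h.differentiableOn_backwardColumn hp hα hU hR ⟨hx, (not_le.1 hαx).le⟩ j

end ContractionData

/-! ### The system after removal of its block part. -/

section GaugedSystem

variable {n : ℕ}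

/-- The sum of the entries of the block part is dominated by that of the whole matrix. -/
theorem entrySum_blockPart_le (b : Fin n → ℂ) (A : ℝ → Matrix (Fin n) (Fin n) ℂ) (t : ℝ) :
    entrySum (fun j l t => blockPart b A t j l) t ≤ entrySum (fun j l t => A t j l) t := by
  refine Finset.sum_le_sum fun j _ => Finset.sum_le_sum fun l _ => ?_
  simp only [blockPart, Matrix.of_apply]
  split_ifs <;> simp

theorem integrableOn_blockPart {b : Fin n → ℂ} {A : ℝ → Matrix (Fin n) (Fin n) ℂ}
    (hA : ∀ j k, IntegrableOn (fun x => A x j k) (Ici 0)) (j l : Fin n) :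
    IntegrableOn (fun t => blockPart b A t j l) (Ici 0) := by
  simp only [blockPart, Matrix.of_apply]
  split_ifs
  · exact hA j l
  · exact integrableOn_zero

theorem blockPart_eq_zero {b : Fin n → ℂ} {A : ℝ → Matrix (Fin n) (Fin n) ℂ} (j l : Fin n) (t : ℝ)
    (h : b j ≠ b l) : blockPart b A t j l = 0 := by
  simp [blockPart, h]

/-- The constant which controls the conjugation by the solution of the block system. -/
noncomputable def gaugeConstant (A : ℝ → Matrix (Fin n) (Fin n) ℂ) : ℝ :=
  2 * Real.exp (2 * ∫ t in Ici 0, entrySum (fun j l t => A t j l) t)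

/-- The coefficient left by the gauge is N(A - D + C)M. Its fixed part Q stays off-block because M
and N are block diagonal, and its variable part P is holomorphic in λ, being a bounded linear image
of C. -/
theorem exists_gauged_system {b : Fin n → ℂ} {A : ℝ → Matrix (Fin n) (Fin n) ℂ}
    {C : Fin n → Fin n → ℂ → HalfLineL1}
    (hA : ∀ j k, IntegrableOn (fun x => A x j k) (Ici 0))
    (hC : ∀ j k, DifferentiableOn ℂ (C j k) {0}ᶜ) {α : ℝ} (hα : 0 ≤ α) :
    ∃ (M N : ℝ → Matrix (Fin n) (Fin n) ℂ) (Q : Fin n → Fin n → HalfLineL1)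
      (P : Fin n → Fin n → ℂ → HalfLineL1), M α = 1 ∧ (∀ x, 0 ≤ x → M x * N x = 1) ∧
      (∀ x, 0 ≤ x → ∀ j k, b j ≠ b k → M x j k = 0) ∧
      (∀ x, 0 ≤ x → ∀ j k, ‖M x j k‖ ≤ gaugeConstant A) ∧
      (∀ T, 0 ≤ T → ∀ j k,
        HasACDeriv (fun x => M x j k) (fun x => ∑ l, blockPart b A x j l * M x l k) 0 T) ∧
      (∀ j l, b j = b l → Q j l = 0) ∧ (∀ j k, DifferentiableOn ℂ (P j k) {0}ᶜ) ∧
      (∀ z, ∀ᵐ t ∂(volume.restrict (Ici (0 : ℝ))), ∀ j l,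
        Q j l t + P j l z t =
          (N t * (A t - blockPart b A t + Matrix.of fun j k => C j k z t) * M t) j l) ∧
      (∫ t in Ici α, entrySum (fun j l => Q j l) t ≤
        (n : ℝ) ^ 2 * gaugeConstant A ^ 2 * ∫ t in Ici α, entrySum (fun j l t => A t j l) t) ∧
      ∀ z, ∫ t in Ici α, entrySum (fun j l => P j l z) t ≤
        (n : ℝ) ^ 2 * gaugeConstant A ^ 2 * ∫ t in Ici α, entrySum (fun j l => C j l z) t := by
  set G : Fin n → Fin n → ℝ → ℂ := fun j l t => blockPart b A t j l with hGdef
  have hG : ∀ j l, IntegrableOn (G j l) (Ici 0) := integrableOn_blockPart hA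
  obtain ⟨M, N, hM1, hMN, hMNb, hMNbd, hM, hN⟩ := exists_gauge hG
    (fun j l x h => blockPart_eq_zero j l x h) hα
  have hAi := integrableOn_entrySum hA
  have hLle : 2 * Real.exp (2 * ∫ t in Ici 0, entrySum G t) ≤ gaugeConstant A := by
    unfold gaugeConstant
    refine mul_le_mul_of_nonneg_left (Real.exp_le_exp.2 (mul_le_mul_of_nonneg_left ?_ zero_le_two))
      zero_le_two
    exact setIntegral_mono_on (integrableOn_entrySum hG) hAi measurableSet_Ici
      fun t _ => entrySum_blockPart_le b A t
  have hcont : ∀ {f : ℝ → ℂ}, (∀ T, 0 ≤ T → ContinuousOn f (uIcc 0 T)) →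
      Measurable fun x => f (max x 0) := by
    intro f hf
    have hfc : ContinuousOn f (Ici 0) := by
      intro x hx
      have hx0 : (0 : ℝ) ≤ x := hx
      refine (hf (x + 1) (by linarith) x
        (by rw [uIcc_of_le (by linarith)]; exact ⟨hx0, by linarith⟩)).mono_of_mem_nhdsWithin ?_
      rw [uIcc_of_le (by linarith)]
      exact mem_nhdsWithin.2 ⟨Iio (x + 1), isOpen_Iio, by simp, fun y hy => ⟨hy.2, hy.1.le⟩⟩
    exact (hfc.comp_continuous (by fun_prop) fun x => mem_Ici.2 (le_max_right x 0)).measurable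
  have hMb : ∀ x j k, ‖M (max x 0) j k‖ ≤ gaugeConstant A := fun x j k =>
    (hMNbd _ (le_max_right _ _) j k).1.trans hLle
  have hNb : ∀ x j k, ‖N (max x 0) j k‖ ≤ gaugeConstant A := fun x j k =>
    (hMNbd _ (le_max_right _ _) j k).2.trans hLle
  -- M and N are controlled only on the half-line; freezing the argument at max x 0 gives functions
  -- measurable and bounded on the whole line.
  obtain ⟨T, hT⟩ := exists_conjugation (M := fun x => M (max x 0)) (N := fun x => N (max x 0))
    (fun j k => hcont fun T hT => (hM T hT j k).continuousOn)
    (fun j k => hcont fun T hT => hN T hT j k) hMb hNb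
  have hT' : ∀ H : Fin n → Fin n → HalfLineL1, ∀ᵐ t ∂(volume.restrict (Ici (0 : ℝ))), ∀ j l,
      (T j l H : ℝ → ℂ) t = (N t * (Matrix.of fun a c => H a c t) * M t) j l := fun H => by
    filter_upwards [hT H, ae_restrict_mem measurableSet_Ici] with t ht ht0 j l
    have : max t 0 = t := max_eq_left ht0
    rw [ht j l, this]
  have hTle : ∀ H : Fin n → Fin n → HalfLineL1, ∀ f : ℝ → ℝ, IntegrableOn f (Ici 0) →
      (∀ᵐ t ∂(volume.restrict (Ici (0 : ℝ))), entrySum (fun j l => H j l) t ≤ f t) →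
      ∫ t in Ici α, entrySum (fun j l => (T j l H : ℝ → ℂ)) t ≤
        (n : ℝ) ^ 2 * gaugeConstant A ^ 2 * ∫ t in Ici α, f t := by
    intro H f hf hfH
    have hsub : Ici α ⊆ Ici 0 := Ici_subset_Ici.2 hα
    rw [← integral_const_mul]
    refine integral_mono_ae (integrableOn_entrySum fun j l => (T j l H).integrableOn.mono_set hsub)
      ((hf.mono_set hsub).const_mul _) ?_
    filter_upwards [ae_restrict_of_ae_restrict_of_subset hsub (hT' H),
      ae_restrict_of_ae_restrict_of_subset hsub hfH, ae_restrict_mem measurableSet_Ici]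
      with t ht htf htα
    have ht0 : 0 ≤ t := hα.trans htα
    simp only [entrySum, ht] at htf ⊢
    exact (entrySum_conj_le (fun j k => (hMNbd t ht0 j k).1.trans hLle)
      (fun j k => (hMNbd t ht0 j k).2.trans hLle)).trans
      (mul_le_mul_of_nonneg_left htf (by positivity))
  have hAD : ∀ j l, Integrable (fun t => (A t - blockPart b A t) j l) (volume.restrict (Ici 0)) :=
    fun j l => (hA j l).sub (hG j l)
  set H₀ : Fin n → Fin n → HalfLineL1 := fun j l => (hAD j l).toL1 with hH₀
  have hH₀e : ∀ᵐ t ∂(volume.restrict (Ici (0 : ℝ))), ∀ j l,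
      H₀ j l t = (A t - blockPart b A t) j l := by
    rw [ae_all_iff]; intro j; rw [ae_all_iff]; intro l
    exact (hAD j l).coeFn_toL1
  refine ⟨M, N, fun j l => T j l H₀, fun j l z => T j l fun a c => C a c z, hM1, hMN,
    fun x hx j k h => (hMNb x hx j k h).1, fun x hx j k => (hMNbd x hx j k).1.trans hLle, hM, ?_,
    ?_, ?_, ?_, ?_⟩
  · intro j l hjl
    refine Lp.ext ?_
    filter_upwards [hT' H₀, hH₀e, Lp.coeFn_zero ℂ 1 (volume.restrict (Ici (0 : ℝ))),
      ae_restrict_mem measurableSet_Ici] with t h1 h2 h3 ht0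
    rw [h1, h3, Pi.zero_apply]
    simp only [Matrix.mul_apply, h2, Matrix.of_apply, Finset.sum_mul]
    -- A nonzero product N_{ja}(A - D)_{ac}M_{cl} would need b_j = b_a, b_c = b_l and b_a ≠ b_c,
    -- which contradicts b_j = b_l.
    refine Finset.sum_eq_zero fun c _ => Finset.sum_eq_zero fun a _ => ?_
    by_cases hja : b j = b a
    · by_cases hcl : b c = b l
      · have : b a = b c := by rw [← hja, hcl, hjl]
        simp [blockPart, this]
      · rw [(hMNb t ht0 c l hcl).1, mul_zero]
    · rw [(hMNb t ht0 j a hja).2]; simp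
  · intro j l
    refine (T j l).differentiable.comp_differentiableOn ?_
    exact differentiableOn_pi.2 fun a => differentiableOn_pi.2 fun c => hC a c
  · intro z
    filter_upwards [hT' H₀, hH₀e, hT' fun a c => C a c z] with t h1 h2 h3 j l
    have e : (Matrix.of fun a c => (H₀ a c : ℝ → ℂ) t) = A t - blockPart b A t := by
      ext a c; exact h2 a c
    rw [h1, h3, e, Matrix.mul_add, Matrix.add_mul, Matrix.add_apply]
  · refine hTle H₀ _ hAi ?_
    filter_upwards [hH₀e] with t ht
    refine Finset.sum_le_sum fun j _ => Finset.sum_le_sum fun l _ => ?_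
    refine (congrArg norm (ht j l)).le.trans ?_
    simp only [blockPart, Matrix.sub_apply, Matrix.of_apply]
    split_ifs <;> simp
  · intro z
    exact hTle _ _ (integrableOn_entrySum fun j l => (C j l z).integrableOn)
      (Eventually.of_forall fun t => le_rfl)

end GaugedSystem

/-! ### From gauged columns to the fundamental system. -/

section Family

variable {n : ℕ} {ρ p : ℝ → ℝ} {α : ℝ} {b : Fin n → ℂ}

/-- M commutes with diag(b) by its block structure, and MN = I reduces M(NHM) to HM. Hence Mv
satisfies the original equation when M' = DM and v solves the gauged one. -/
theorem gauge_identity {M N H D : Matrix (Fin n) (Fin n) ℂ} (v : Fin n → ℂ) (c : ℂ)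
    (hMN : M * N = 1) (hM : ∀ j k, b j ≠ b k → M j k = 0) (j : Fin n) :
    ∑ l, ((∑ i, D j i * M i l) * v l + M j l * (c * b l * v l + ∑ i, (N * H * M) l i * v i)) =
      ∑ i, (c • Matrix.diagonal b + D + H) j i * ∑ l, M i l * v l := by
  have hcomm : M * (c • Matrix.diagonal b) = (c • Matrix.diagonal b) * M := by
    ext i k
    rw [Matrix.mul_smul, Matrix.smul_mul, Matrix.smul_apply, Matrix.smul_apply,
      Matrix.mul_diagonal, Matrix.diagonal_mul]
    by_cases h : b i = b k
    · rw [h, mul_comm]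
    · rw [hM i k h]; simp
  have hN : M * (N * H * M) = H * M := by
    rw [← mul_assoc, ← mul_assoc, hMN, one_mul]
  have key : (D * M).mulVec v + M.mulVec ((c • Matrix.diagonal b).mulVec v + (N * H * M).mulVec v) =
      (c • Matrix.diagonal b + D + H).mulVec (M.mulVec v) := by
    rw [Matrix.mulVec_add, Matrix.mulVec_mulVec, Matrix.mulVec_mulVec, Matrix.mulVec_mulVec, hcomm,
      hN, Matrix.add_mul, Matrix.add_mul, Matrix.add_mulVec, Matrix.add_mulVec]
    abel
  have h := congrFun key j
  have e : (c • Matrix.diagonal b).mulVec v = fun l => c * b l * v l := by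
    funext l
    rw [Matrix.smul_mulVec, Pi.smul_apply, Matrix.mulVec_diagonal, smul_eq_mul, mul_assoc]
  rw [e] at h
  rw [Finset.sum_add_distrib]
  exact h

/-- Y(α) is upper triangular with unit diagonal, so its determinant is 1; independence of the values
at one point suffices. -/
theorem linearIndependent_of_unitriangular {Y : ℝ → Matrix (Fin n) (Fin n) ℂ} (hα : 0 ≤ α)
    (hY : ∀ j k : Fin n, k ≤ j → Y α j k = if j = k then 1 else 0) :
    LinearIndependent ℂ (fun (k : Fin n) (x : Ici (0 : ℝ)) (j : Fin n) => Y (x : ℝ) j k) := by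
  have hdet : (Y α).det = 1 := by
    have ht : (Y α).BlockTriangular id := fun j k hkj => by
      rw [hY j k (le_of_lt hkj), if_neg (show j ≠ k from ne_of_gt hkj)]
    rw [Matrix.det_of_isUpperTriangular ht]
    exact Finset.prod_eq_one fun j _ => by rw [hY j j le_rfl, if_pos rfl]
  have hu : IsUnit (Y α) := by
    rw [Matrix.isUnit_iff_isUnit_det, hdet]; exact isUnit_one
  have hli := Matrix.linearIndependent_cols_iff_isUnit.2 hu
  refine LinearIndependent.of_comp
    (LinearMap.proj (R := ℂ) (φ := fun _ : Ici (0 : ℝ) => Fin n → ℂ) ⟨α, hα⟩) ?_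
  exact hli

theorem closure_truncatedSector_subset (Γ : Set ℂ) (r : ℝ) :
    closure (truncatedSector Γ r) ⊆ {z | z ∈ closure Γ ∧ r ≤ ‖z‖} := by
  intro z hz
  refine ⟨closure_mono (fun w hw => hw.1) hz, ?_⟩
  have hc : IsClosed {w : ℂ | r ≤ ‖w‖} := isClosed_le continuous_const continuous_norm
  exact closure_minimal (fun w (hw : w ∈ truncatedSector Γ r) => hw.2.le) hc hz

theorem IsSector.isOpen {Γ : Set ℂ} (h : IsSector b Γ) : IsOpen Γ := by
  obtain ⟨z, -, rfl⟩ := h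
  refine IsOpen.connectedComponentIn ?_
  have : sectorRegion b = {z | z ≠ 0} ∩ ⋂ j, ⋂ l, {z | b j ≠ b l → (z * b j).re ≠ (z * b l).re} := by
    ext z; simp [sectorRegion]
  rw [this]
  refine isOpen_ne.inter (isOpen_iInter_of_finite fun j => isOpen_iInter_of_finite fun l => ?_)
  by_cases hjl : b j = b l
  · simp [hjl]
  · simp only [ne_eq, hjl, not_false_eq_true, forall_const]
    exact isOpen_ne_fun (by fun_prop) (by fun_prop)

theorem isOpen_truncatedSector {Γ : Set ℂ} (h : IsOpen Γ) (r : ℝ) :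
    IsOpen (truncatedSector Γ r) :=
  h.inter (isOpen_lt continuous_const continuous_norm)

/-- Restoring the factor e^{z b_k(p(x) - p(α))} adds z b_k ρ to the coefficient, so z(b_j - b_k)ρ
becomes z b_j ρ; the gauge identity then gives back the original system. -/
theorem isSolution_gauged {A : ℝ → Matrix (Fin n) (Fin n) ℂ} {C : Fin n → Fin n → ℂ → HalfLineL1}
    {M N : ℝ → Matrix (Fin n) (Fin n) ℂ} {R : Fin n → Fin n → ℂ → HalfLineL1} (hp : IsPhase ρ p)
    (hMN : ∀ x, 0 ≤ x → M x * N x = 1) (hM0 : ∀ x, 0 ≤ x → ∀ j k, b j ≠ b k → M x j k = 0)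
    (hM : ∀ T, 0 ≤ T → ∀ j k,
      HasACDeriv (fun x => M x j k) (fun x => ∑ l, blockPart b A x j l * M x l k) 0 T) {z : ℂ}
    (hR : ∀ᵐ t ∂(volume.restrict (Ici (0 : ℝ))), ∀ j l, R j l z t =
      (N t * (A t - blockPart b A t + Matrix.of fun j k => C j k z t) * M t) j l)
    {k : Fin n} {u : ℝ → Fin n → ℂ}
    (hu : ∀ T, 0 ≤ T → ∀ j, HasACDeriv (fun x => u x j)
      (fun x => z * (b j - b k) * ρ x * u x j + ∑ l, R j l z x * u x l) 0 T) :
    IsSolution (systemMatrix ρ b A C z) fun x j =>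
      ∑ l, M x j l * (Complex.exp (z * b k * ((p x - p α : ℝ) : ℂ)) * u x l) := by
  have hv : ∀ T, 0 ≤ T → ∀ l, HasACDeriv
      (fun x => Complex.exp (z * b k * ((p x - p α : ℝ) : ℂ)) * u x l)
      (fun x => z * ρ x * b l * (Complex.exp (z * b k * ((p x - p α : ℝ) : ℂ)) * u x l) +
        ∑ i, R l i z x * (Complex.exp (z * b k * ((p x - p α : ℝ) : ℂ)) * u x i)) 0 T := by
    intro T hT l
    refine ((hp.hasACDeriv_exp le_rfl hT (z * b k) α).mul (hu T hT l)).congr_deriv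
      (Eventually.of_forall fun x _ => ?_)
    have : ∑ i, R l i z x * (Complex.exp (z * b k * ((p x - p α : ℝ) : ℂ)) * u x i) =
        Complex.exp (z * b k * ((p x - p α : ℝ) : ℂ)) * ∑ i, R l i z x * u x i := by
      rw [Finset.mul_sum]
      exact Finset.sum_congr rfl fun i _ => by ring
    rw [this]; ring
  refine isSolution_of_hasACDeriv (fun T hT j =>
    HasACDeriv.sum Finset.univ fun l _ => (hM T hT j l).mul (hv T hT l)) ?_
  filter_upwards [hR, ae_restrict_mem measurableSet_Ici] with x hx hx0 j
  simp only [hx]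
  rw [gauge_identity (b := b) _ _ (hMN x hx0) (hM0 x hx0) j]
  have e : (z * (ρ x : ℂ)) • Matrix.diagonal b + blockPart b A x +
      (A x - blockPart b A x + Matrix.of fun j k => C j k z x) = systemMatrix ρ b A C z x := by
    rw [systemMatrix]; abel
  rw [e]

/-- The matrix whose columns are the gauged columns with their exponential factors restored. -/
noncomputable def solutionMatrix (b : Fin n → ℂ) (p : ℝ → ℝ) (α : ℝ)
    (R : Fin n → Fin n → ℂ → HalfLineL1) (M : ℝ → Matrix (Fin n) (Fin n) ℂ) (x : ℝ) (z : ℂ) :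
    Matrix (Fin n) (Fin n) ℂ :=
  Matrix.of fun j k =>
    ∑ l, M x j l * (Complex.exp (z * b k * ((p x - p α : ℝ) : ℂ)) * column b p α R k z x l)

theorem exists_family_of_contraction {A : ℝ → Matrix (Fin n) (Fin n) ℂ}
    {C : Fin n → Fin n → ℂ → HalfLineL1} {M N : ℝ → Matrix (Fin n) (Fin n) ℂ}
    {R : Fin n → Fin n → ℂ → HalfLineL1} {L N₀ : ℝ}
    (hp : IsPhase ρ p) (hpx : ∀ x, 0 ≤ x → p x = primitiveFun ρ x) (hα : 0 ≤ α) (hM1 : M α = 1)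
    (hMN : ∀ x, 0 ≤ x → M x * N x = 1) (hM0 : ∀ x, 0 ≤ x → ∀ j k, b j ≠ b k → M x j k = 0)
    (hML : ∀ x, 0 ≤ x → ∀ j k, ‖M x j k‖ ≤ L)
    (hM : ∀ T, 0 ≤ T → ∀ j k,
      HasACDeriv (fun x => M x j k) (fun x => ∑ l, blockPart b A x j l * M x l k) 0 T)
    (hRd : ∀ j k, DifferentiableOn ℂ (R j k) {0}ᶜ)
    (hR : ∀ z, ∀ᵐ t ∂(volume.restrict (Ici (0 : ℝ))), ∀ j l, R j l z t =
      (N t * (A t - blockPart b A t + Matrix.of fun j k => C j k z t) * M t) j l)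
    {Γ : Set ℂ} (hΓ : IsOpen Γ) {r : ℝ} (hr : 0 < r)
    (hcd : ContractionData b p α R {z | z ∈ closure Γ ∧ r ≤ ‖z‖} N₀)
    (hsmall : ∀ ε > 0, ∃ r₀ : ℝ, ∀ z, z ∈ closure Γ → r₀ ≤ ‖z‖ → ∀ (k : Fin n) (x : ℝ), α ≤ x →
      ∀ j, ‖kernelOp (halfKernel b p α k z)
        (fun j l => R j l z) (unitColumn k) x j‖ ≤ ε) :
    ∃ Y S : ℝ → ℂ → Matrix (Fin n) (Fin n) ℂ,
      (∀ z ∈ closure (truncatedSector Γ r),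
        IsFundamentalSystem (systemMatrix ρ b A C z) (fun x => Y x z)) ∧
      (∀ j k, ∀ z ∈ closure (truncatedSector Γ r), ∀ x, α ≤ x →
        Y x z j k =
          Complex.exp (z * b k * ((primitiveFun ρ x - primitiveFun ρ α : ℝ) : ℂ)) *
            (M x j k + S x z j k)) ∧
      (∀ j k, TendstoUniformlyOn (fun (z : ℂ) (x : ℝ) => S x z j k) (fun _ => 0)
        (Bornology.cobounded ℂ ⊓ 𝓟 (closure (truncatedSector Γ r))) (Ici α)) ∧
      (∀ x, 0 ≤ x → ∀ j k,
        ContinuousOn (fun z => Y x z j k) (closure (truncatedSector Γ r)) ∧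
        AnalyticOnNhd ℂ (fun z => Y x z j k) (truncatedSector Γ r)) ∧
      (∀ z ∈ closure (truncatedSector Γ r), ∀ j k : Fin n, k ≤ j →
        Y α z j k = if j = k then 1 else 0) := by
  have hsub := closure_truncatedSector_subset Γ r
  have hne : {z | z ∈ closure Γ ∧ r ≤ ‖z‖} ⊆ ({0}ᶜ : Set ℂ) := fun z hz h0 => by
    have h1 : z = 0 := h0
    have := hz.2
    rw [h1, norm_zero] at this
    linarith
  have hΛ := hcd.mono hsub
  have hU := hcd.mono (subset_closure.trans hsub)
  have hUo := isOpen_truncatedSector hΓ r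
  have hYα : ∀ z ∈ closure (truncatedSector Γ r), ∀ j k : Fin n, k ≤ j →
      solutionMatrix b p α R M α z j k = if j = k then 1 else 0 := by
    intro z hz j k hkj
    simp only [solutionMatrix, Matrix.of_apply, hM1, sub_self, Complex.ofReal_zero, mul_zero, Complex.exp_zero,
      one_mul, Matrix.one_apply, ite_mul, zero_mul, Finset.sum_ite_eq, Finset.mem_univ, if_true]
    rw [ContractionData.column_of_le le_rfl, hΛ.forwardColumn_self hp hα hz hkj]
  have hsol : ∀ z ∈ closure (truncatedSector Γ r), ∀ k, IsSolution (systemMatrix ρ b A C z)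
      fun x j => ∑ l, M x j l *
        (Complex.exp (z * b k * ((p x - p α : ℝ) : ℂ)) * column b p α R k z x l) := by
    intro z hz k
    exact isSolution_gauged (R := R) (u := column b p α R k z) (α := α) hp hMN hM0 hM (hR z)
      fun T hT j => hΛ.hasACDeriv_column hp hα hz hT j
  -- The remainder is M applied to the deviation of the gauged column from e_k, since M e_k is the
  -- k-th column of M.
  refine ⟨solutionMatrix b p α R M, fun x z => Matrix.of fun j k =>
    ∑ l, M x j l * (column b p α R k z x l - unitColumn k x l), ?_, ?_, ?_, ?_, hYα⟩
  · intro z hz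
    exact ⟨hsol z hz, linearIndependent_of_unitriangular
      (Y := fun x => solutionMatrix b p α R M x z) hα (hYα z hz)⟩
  · intro j k z _ x hx
    simp only [solutionMatrix, Matrix.of_apply, hpx x (hα.trans hx), hpx α hα, unitColumn, mul_sub,
      Finset.sum_sub_distrib, mul_ite, mul_one, mul_zero, Finset.sum_ite_eq', Finset.mem_univ,
      if_true, add_sub_cancel, Finset.mul_sum]
    exact Finset.sum_congr rfl fun l _ => by ring
  · intro j k
    rw [Metric.tendstoUniformlyOn_iff]
    intro ε hε
    have hL0 : 0 ≤ L := (norm_nonneg _).trans (hML α hα j k)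
    -- The absolute value is taken because N₀ ≥ 0 follows from the contraction data only once a
    -- point of the region is given.
    have hlim : ∃ δ > 0, n * (L * (2 * ((1 + 2 * |N₀|) * δ))) < ε := by
      obtain ⟨δ, hδ, hδε⟩ := exists_pos_mul_lt hε (n * (L * (2 * (1 + 2 * |N₀|))))
      exact ⟨δ, hδ, lt_of_eq_of_lt (by ring) hδε⟩
    obtain ⟨δ, hδ, hδε⟩ := hlim
    obtain ⟨r₀, hr₀⟩ := hsmall δ hδ
    rw [eventually_inf_principal]
    filter_upwards [tendsto_norm_cobounded_atTop.eventually_ge_atTop r₀] with z hz hzΛ x hx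
    have hx' : α ≤ x := hx
    rw [dist_zero_left, Matrix.of_apply]
    refine lt_of_le_of_lt ?_ hδε
    have hb : ∀ l, ‖M x j l * (column b p α R k z x l - unitColumn k x l)‖ ≤
        L * (2 * ((1 + 2 * |N₀|) * δ)) := by
      intro l
      rw [norm_mul]
      refine mul_le_mul (hML x (hα.trans hx') j l) ?_ (norm_nonneg _) hL0
      rw [ContractionData.column_of_le hx']
      refine (hΛ.norm_forwardColumn_sub_le hp hα hzΛ (hr₀ z (hsub hzΛ).1 hz k) hx' l).trans ?_
      have := le_abs_self N₀
      gcongr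
    calc _ ≤ ∑ _l : Fin n, L * (2 * ((1 + 2 * |N₀|) * δ)) := norm_sum_le_of_le _ fun l _ => hb l
      _ = _ := by simp
  · intro x hx j k
    have hRc : ∀ j l, ContinuousOn (R j l) (closure (truncatedSector Γ r)) := fun j l =>
      (hRd j l).continuousOn.mono (hsub.trans hne)
    have hRd' : ∀ j l, DifferentiableOn ℂ (R j l) (truncatedSector Γ r) := fun j l =>
      (hRd j l).mono ((subset_closure.trans hsub).trans hne)
    simp only [solutionMatrix, Matrix.of_apply]
    refine ⟨?_, DifferentiableOn.analyticOnNhd ?_ hUo⟩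
    · refine continuousOn_finsetSum _ fun l _ => continuousOn_const.mul (ContinuousOn.mul ?_
        (hΛ.continuousOn_column hp hα hRc hx l))
      fun_prop
    · refine DifferentiableOn.fun_sum fun l _ => (differentiableOn_const _).mul
        (DifferentiableOn.mul ?_ (hU.differentiableOn_column hp hα hUo hRd' hx l))
      fun_prop

end Family

/-! ### L¹ tails of the coefficients. -/

section Tails

variable {n : ℕ}

theorem integral_entrySum_add_le (P Q : Fin n → Fin n → HalfLineL1) {α : ℝ} (hα : 0 ≤ α) :
    ∫ t in Ici α, entrySum (fun j l => (P j l + Q j l : HalfLineL1)) t ≤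
      (∫ t in Ici α, entrySum (fun j l => P j l) t) +
        ∫ t in Ici α, entrySum (fun j l => Q j l) t := by
  have hsub : Ici α ⊆ Ici 0 := Ici_subset_Ici.2 hα
  have hi : ∀ S : Fin n → Fin n → HalfLineL1,
      IntegrableOn (entrySum fun j l => (S j l : ℝ → ℂ)) (Ici α) := fun S =>
    integrableOn_entrySum fun j l => (S j l).integrableOn.mono_set hsub
  rw [← integral_add (hi P) (hi Q)]
  refine integral_mono_ae (hi fun j l => P j l + Q j l) ((hi P).add (hi Q)) ?_
  have h : ∀ᵐ t ∂(volume.restrict (Ici (0 : ℝ))), ∀ j l,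
      (P j l + Q j l : HalfLineL1) t = P j l t + Q j l t := by
    rw [ae_all_iff]; intro j; rw [ae_all_iff]; intro l
    exact Lp.coeFn_add (P j l) (Q j l)
  filter_upwards [ae_restrict_of_ae_restrict_of_subset hsub h] with t ht
  refine le_trans (le_of_eq ?_) (entrySum_add_le (P := fun j l => P j l) (Q := fun j l => Q j l) t)
  simp only [entrySum, ht]

theorem integral_entrySum_le_of_tailNorm_le {C : Fin n → Fin n → ℂ → HalfLineL1} {α : ℝ}
    (hα : 0 ≤ α) {z : ℂ} {ε : ℝ} (hε : 0 ≤ ε) (h : tailNorm C α z ≤ ENNReal.ofReal ε) :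
    ∫ t in Ici α, entrySum (fun j l => C j l z) t ≤ (n : ℝ) ^ 2 * ε := by
  have hi : ∀ j l, Integrable (fun t => ‖C j l z t‖) (volume.restrict (Ici α)) := fun j l =>
    ((C j l z).integrableOn.mono_set (Ici_subset_Ici.2 hα)).norm
  have hb : ∀ j l, ∫ t in Ici α, ‖C j l z t‖ ≤ ε := by
    intro j l
    have h1 : eLpNorm (C j l z : ℝ → ℂ) 1 (volume.restrict (Ici α)) ≤ ENNReal.ofReal ε :=
      (le_iSup₂ (f := fun j l => eLpNorm (C j l z : ℝ → ℂ) 1 (volume.restrict (Ici α))) j l).trans h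
    rw [eLpNorm_one_eq_lintegral_enorm] at h1
    rw [integral_norm_eq_lintegral_enorm (C j l z).measurable.aestronglyMeasurable]
    exact ENNReal.toReal_le_of_le_ofReal hε h1
  unfold entrySum
  rw [integral_finsetSum _ fun j _ => integrable_finsetSum _ fun l _ => hi j l]
  calc _ ≤ ∑ _j : Fin n, ∑ _l : Fin n, ε := by
        refine Finset.sum_le_sum fun j _ => ?_
        rw [integral_finsetSum _ fun l _ => hi j l]
        exact Finset.sum_le_sum fun l _ => hb j l
    _ = (n : ℝ) ^ 2 * ε := by
        simp only [Finset.sum_const, Finset.card_univ, Fintype.card_fin, nsmul_eq_mul]; ring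

theorem tailNorm_le {C : Fin n → Fin n → ℂ → HalfLineL1} {α : ℝ} (hα : 0 ≤ α) (z : ℂ) :
    tailNorm C α z ≤ tailNorm C 0 z :=
  iSup₂_mono fun _ _ => eLpNorm_mono_measure _ (Measure.restrict_mono (Ici_subset_Ici.2 hα) le_rfl)

theorem exists_integral_entrySum_le {C : Fin n → Fin n → ℂ → HalfLineL1}
    (hC : Tendsto (tailNorm C 0) (Bornology.cobounded ℂ) (𝓝 0)) {α : ℝ} (hα : 0 ≤ α) {ε : ℝ}
    (hε : 0 < ε) :
    ∃ r : ℝ, ∀ z : ℂ, r ≤ ‖z‖ → ∫ t in Ici α, entrySum (fun j l => C j l z) t ≤ ε := by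
  obtain ⟨δ, hδ, hδε⟩ := exists_pos_mul_lt hε ((n : ℝ) ^ 2)
  have h := hC.eventually_lt_const (ENNReal.ofReal_pos.2 hδ)
  obtain ⟨r, -, hr⟩ := (hasBasis_cobounded_norm (E := ℂ)).eventually_iff.1 h
  exact ⟨r, fun z hz => (integral_entrySum_le_of_tailNorm_le hα hδ.le
    ((tailNorm_le hα z).trans (hr hz).le)).trans hδε.le⟩

theorem tendsto_integral_Ici_zero {f : ℝ → ℝ} (hf : IntegrableOn f (Ici 0)) :
    Tendsto (fun α => ∫ t in Ici α, f t) atTop (𝓝 0) := by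
  have h1 := intervalIntegral_tendsto_integral_Ioi 0 (hf.mono_set Ioi_subset_Ici_self) tendsto_id
  have h2 := h1.const_sub (∫ t in Ioi 0, f t)
  rw [sub_self] at h2
  refine h2.congr' ?_
  filter_upwards [eventually_ge_atTop 0] with α hα
  rw [id, integral_Ici_eq_integral_Ioi]
  have := intervalIntegral.integral_Ioi_sub_Ioi (hf.mono_set Ioi_subset_Ici_self) hα
  rw [← this]; ring

end Tails

/-! ### Uniqueness for the matrix initial-value problem. -/

section Uniqueness

variable {n : ℕ}

theorem IsMatrixIVPSolution.eqOn {G M N : ℝ → Matrix (Fin n) (Fin n) ℂ} {α : ℝ}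
    (hG : ∀ j l, IntegrableOn (fun x => G x j l) (Ici 0)) (hα : 0 ≤ α)
    (hM : IsMatrixIVPSolution G α M) (hN : IsMatrixIVPSolution G α N) : EqOn N M (Ici 0) := by
  intro x hx
  ext j k
  have h := eq_zero_of_linear_system hG (y := fun x j => N x j k - M x j k) (fun T hT j => by
    refine ((hasACDeriv_of_isSolution hG (hN.1 k) T hT j).sub
      (hasACDeriv_of_isSolution hG (hM.1 k) T hT j)).congr_deriv (Eventually.of_forall fun t _ => ?_)
    rw [← Finset.sum_sub_distrib]
    exact Finset.sum_congr rfl fun l _ => by ring) hα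
    (by funext j; rw [hM.2, hN.2, sub_self]; rfl) hx
  exact sub_eq_zero.1 (congrFun h j)

end Uniqueness

/-! ### The two sources of contraction: large λ and small tails. -/

section Contraction

variable {n : ℕ} {ρ p : ℝ → ℝ} {α : ℝ} {b : Fin n → ℂ} {Q : Fin n → Fin n → HalfLineL1}
  {P : Fin n → Fin n → ℂ → HalfLineL1} {Γ : Set ℂ}

/-- The contraction property for large values of the spectral parameter. -/
theorem exists_contractionData (hρ_int : ∀ T > 0, IntegrableOn ρ (Ico 0 T))
    (hρ_pos : ∀ᵐ x ∂(volume.restrict (Ici (0 : ℝ))), 0 < ρ x) (hp : IsPhase ρ p) (hα : 0 ≤ α)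
    (hQ : ∀ j l, b j = b l → Q j l = 0)
    (hP : ∀ ε > 0, ∃ r : ℝ, ∀ z : ℂ, r ≤ ‖z‖ → ∫ t in Ici α, entrySum (fun j l => P j l z) t ≤ ε)
    (hb : ∀ z ∈ closure Γ, ∀ j k : Fin n, j ≤ k → (z * b k).re ≤ (z * b j).re) :
    ∃ r N₀ : ℝ, 0 < r ∧ ContractionData b p α (fun j l z => Q j l + P j l z)
      {z | z ∈ closure Γ ∧ r ≤ ‖z‖} N₀ := by
  set q := ∫ t in Ici α, entrySum (fun j l => Q j l) t with hq
  have hq0 : 0 ≤ q := integral_nonneg fun _ => entrySum_nonneg _ _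
  have hN : 0 < q + 1 := by linarith
  -- Oscillation error, 2K/|z| and the tail of P each contribute at most this amount. Their sum
  -- 1/(4(q + 1)) times the total coefficient, at most q + 1, is 1/4.
  have hε : 0 < 1 / (12 * (q + 1)) := by positivity
  obtain ⟨K, hK, h⟩ := exists_halfKernel_contraction hρ_int hρ_pos hp hα hQ hε
  obtain ⟨r₁, hr₁⟩ := hP 1 one_pos
  obtain ⟨r₂, hr₂⟩ := hP _ hε
  have hbound : ∀ z : ℂ, r₁ ≤ ‖z‖ →
      ∫ t in Ici α, entrySum (fun j l => (Q j l + P j l z : HalfLineL1)) t ≤ q + 1 := fun z hz =>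
    (integral_entrySum_add_le Q (fun j l => P j l z) hα).trans (add_le_add le_rfl (hr₁ z hz))
  -- The four thresholds give, in turn, z ≠ 0, a tail of P below 1, a tail of P below 1/(12(q + 1)),
  -- and the bound on 2K/|z|.
  refine ⟨max 1 (max (max r₁ r₂) (24 * K * (q + 1))), q + 1, lt_of_lt_of_le one_pos (le_max_left _ _),
    ⟨fun z hz => hb z hz.1, fun z hz => hbound z ?_, ?_⟩⟩
  · exact (((le_max_left _ _).trans (le_max_left _ _)).trans (le_max_right _ _)).trans hz.2
  · intro z hz k w W hw hW x hx j
    have h1 : 1 ≤ ‖z‖ := (le_max_left _ _).trans hz.2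
    have h2 : r₁ ≤ ‖z‖ :=
      (((le_max_left _ _).trans (le_max_left _ _)).trans (le_max_right _ _)).trans hz.2
    have h3 : r₂ ≤ ‖z‖ :=
      (((le_max_right _ _).trans (le_max_left _ _)).trans (le_max_right _ _)).trans hz.2
    have h4 : 24 * K * (q + 1) ≤ ‖z‖ := ((le_max_right _ _).trans (le_max_right _ _)).trans hz.2
    have hz0 : z ≠ 0 := norm_pos_iff.1 (one_pos.trans_le h1)
    have hW0 : 0 ≤ W := (norm_nonneg _).trans (hW x hx j)
    refine ((h (fun j l => P j l z) z k hz0 (hb z hz.1)).2 w W hw hW x hx j).trans ?_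
    have h5 : 2 * K / ‖z‖ ≤ 1 / (12 * (q + 1)) := by
      rw [div_le_div_iff₀ (one_pos.trans_le h1) (by positivity)]
      linarith
    have h6 := hr₂ z h3
    have h7 : 1 / (12 * (q + 1)) + 2 * K / ‖z‖ + ∫ t in Ici α, entrySum (fun j l => P j l z) t ≤
        1 / (4 * (q + 1)) := by
      have : 1 / (4 * (q + 1)) = 1 / (12 * (q + 1)) + 1 / (12 * (q + 1)) + 1 / (12 * (q + 1)) := by
        field_simp; norm_num
      linarith
    refine (mul_le_mul h7 (mul_le_mul_of_nonneg_right (hbound z h2) hW0)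
      (mul_nonneg (integral_nonneg fun _ => entrySum_nonneg _ _) hW0) (by positivity)).trans ?_
    exact le_of_eq (by field_simp)

/-- The contraction property under a smallness condition on the coefficients. -/
theorem contractionData_of_small (hp : IsPhase ρ p) (hα : 0 ≤ α) {r : ℝ}
    (hQ : ∫ t in Ici α, entrySum (fun j l => Q j l) t ≤ 1 / 4)
    (hP : ∀ z : ℂ, r ≤ ‖z‖ → ∫ t in Ici α, entrySum (fun j l => P j l z) t ≤ 1 / 4)
    (hb : ∀ z ∈ closure Γ, ∀ j k : Fin n, j ≤ k → (z * b k).re ≤ (z * b j).re) :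
    ContractionData b p α (fun j l z => Q j l + P j l z) {z | z ∈ closure Γ ∧ r ≤ ‖z‖} (1 / 2) := by
  have hbound : ∀ z : ℂ, r ≤ ‖z‖ →
      ∫ t in Ici α, entrySum (fun j l => (Q j l + P j l z : HalfLineL1)) t ≤ 1 / 2 := fun z hz => by
    have := integral_entrySum_add_le Q (fun j l => P j l z) hα
    have := hP z hz
    linarith
  refine ⟨fun z hz => hb z hz.1, fun z hz => hbound z hz.2, fun z hz k w W _ hW x hx j => ?_⟩
  have hW0 : 0 ≤ W := (norm_nonneg _).trans (hW x hx j)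
  -- Here the operator itself has norm at most 1/2, so its square is a 1/4-contraction without any
  -- use of oscillation.
  have key : ∀ (v : ℝ → Fin n → ℂ) (V : ℝ), (∀ x, α ≤ x → ∀ j, ‖v x j‖ ≤ V) → 0 ≤ V →
      ∀ x, α ≤ x → ∀ j, ‖kernelOp (halfKernel b p α k z)
        (fun j l => (Q j l + P j l z : HalfLineL1)) v x j‖ ≤ 1 / 2 * V := by
    intro v V hv hV x hx j
    refine (norm_kernelOp_halfKernel_le (R := fun j l => (Q j l + P j l z : HalfLineL1)) hα
      hp.monotone (hb z hz.1) (fun j l => HalfLineL1.integrableOn _) hv hx j).trans ?_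
    exact mul_le_mul_of_nonneg_right (hbound z hz.2) hV
  refine (key _ _ (key w W hW hW0) (by positivity) x hx j).trans (le_of_eq (by ring))

/-- Oscillation, K/|z| and the tail of P take ε/3 each. This limit rests on the oscillation estimate
even when the contraction comes from small tails. -/
theorem exists_norm_kernelOp_unitColumn_le (hρ_int : ∀ T > 0, IntegrableOn ρ (Ico 0 T))
    (hρ_pos : ∀ᵐ x ∂(volume.restrict (Ici (0 : ℝ))), 0 < ρ x) (hp : IsPhase ρ p) (hα : 0 ≤ α)
    (hQ : ∀ j l, b j = b l → Q j l = 0)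
    (hP : ∀ ε > 0, ∃ r : ℝ, ∀ z : ℂ, r ≤ ‖z‖ → ∫ t in Ici α, entrySum (fun j l => P j l z) t ≤ ε)
    (hb : ∀ z ∈ closure Γ, ∀ j k : Fin n, j ≤ k → (z * b k).re ≤ (z * b j).re) {ε : ℝ}
    (hε : 0 < ε) :
    ∃ r₀ : ℝ, ∀ z, z ∈ closure Γ → r₀ ≤ ‖z‖ → ∀ (k : Fin n) (x : ℝ), α ≤ x →
      ∀ j, ‖kernelOp (halfKernel b p α k z) (fun j l => (Q j l + P j l z : HalfLineL1))
        (unitColumn k) x j‖ ≤ ε := by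
  have hε3 : 0 < ε / 3 := by positivity
  obtain ⟨K, hK, h⟩ := exists_halfKernel_contraction hρ_int hρ_pos hp hα hQ hε3
  obtain ⟨r, hr⟩ := hP _ hε3
  refine ⟨max 1 (max r (3 * K / ε)), fun z hz hzr k x hx j => ?_⟩
  have h1 : 1 ≤ ‖z‖ := (le_max_left _ _).trans hzr
  have hz0 : 0 < ‖z‖ := one_pos.trans_le h1
  have h2 : r ≤ ‖z‖ := ((le_max_left _ _).trans (le_max_right _ _)).trans hzr
  have h3 : 3 * K / ε ≤ ‖z‖ := ((le_max_right _ _).trans (le_max_right _ _)).trans hzr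
  have h4 : K / ‖z‖ ≤ ε / 3 := by
    rw [div_le_iff₀ hε] at h3
    rw [div_le_iff₀ hz0]
    linarith
  have h5 := (h (fun j l => P j l z) z k (norm_pos_iff.1 hz0) (hb z hz)).1 x hx j
  have h6 := hr z h2
  linarith

end Contraction

/-! ### Assembly of the theorem. -/

section Main

variable {n : ℕ}

/-- The assertions on the fundamental systems of solutions, for one initial point `α`, one matrix
`M` and one radius `r`. -/
def HasSolutionFamily (b : Fin n → ℂ) (ρ : ℝ → ℝ) (A : ℝ → Matrix (Fin n) (Fin n) ℂ)
    (C : Fin n → Fin n → ℂ → HalfLineL1) (Γ : Set ℂ) (α : ℝ) (M : ℝ → Matrix (Fin n) (Fin n) ℂ)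
    (r : ℝ) : Prop :=
  ∃ Y S : ℝ → ℂ → Matrix (Fin n) (Fin n) ℂ,
    (∀ z ∈ closure (truncatedSector Γ r),
      IsFundamentalSystem (systemMatrix ρ b A C z) (fun x => Y x z)) ∧
    (∀ j k, ∀ z ∈ closure (truncatedSector Γ r), ∀ x, α ≤ x →
      Y x z j k =
        Complex.exp (z * b k * ((primitiveFun ρ x - primitiveFun ρ α : ℝ) : ℂ)) *
          (M x j k + S x z j k)) ∧
    (∀ j k, TendstoUniformlyOn (fun (z : ℂ) (x : ℝ) => S x z j k) (fun _ => 0)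
      (Bornology.cobounded ℂ ⊓ 𝓟 (closure (truncatedSector Γ r))) (Ici α)) ∧
    (∀ x, 0 ≤ x → ∀ j k,
      ContinuousOn (fun z => Y x z j k) (closure (truncatedSector Γ r)) ∧
      AnalyticOnNhd ℂ (fun z => Y x z j k) (truncatedSector Γ r)) ∧
    (∀ z ∈ closure (truncatedSector Γ r), ∀ j k : Fin n, k ≤ j →
      Y α z j k = if j = k then 1 else 0)

/-- M is fixed before the radius, so the radius obtained from large λ and any radius obtained from
small tails refer to the same matrix, and the choice between them can be made for each α afterwards.
-/
theorem exists_solutionFamily {b : Fin n → ℂ} {ρ : ℝ → ℝ}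
    {A : ℝ → Matrix (Fin n) (Fin n) ℂ} {C : Fin n → Fin n → ℂ → HalfLineL1}
    (hρ_int : ∀ T > 0, IntegrableOn ρ (Ico 0 T))
    (hρ_pos : ∀ᵐ x ∂(volume.restrict (Ici (0 : ℝ))), 0 < ρ x)
    (hA : ∀ j k, IntegrableOn (fun x => A x j k) (Ici 0))
    (hC_hol : ∀ j k, DifferentiableOn ℂ (C j k) {0}ᶜ)
    (hC_lim : Tendsto (tailNorm C 0) (Bornology.cobounded ℂ) (𝓝 0))
    {Γ : Set ℂ} (hΓ : IsSector b Γ)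
    (hb : ∀ z ∈ closure Γ, ∀ j k : Fin n, j ≤ k → (z * b k).re ≤ (z * b j).re)
    {α : ℝ} (hα : 0 ≤ α) :
    ∃ M : ℝ → Matrix (Fin n) (Fin n) ℂ, IsMatrixIVPSolution (blockPart b A) α M ∧
      (∃ r > 0, HasSolutionFamily b ρ A C Γ α M r) ∧
      ∀ r > 0, (n : ℝ) ^ 2 * gaugeConstant A ^ 2 *
          ∫ t in Ici α, entrySum (fun j l t => A t j l) t ≤ 1 / 4 →
        (∀ z : ℂ, r ≤ ‖z‖ → (n : ℝ) ^ 2 * gaugeConstant A ^ 2 *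
          ∫ t in Ici α, entrySum (fun j l => C j l z) t ≤ 1 / 4) →
        HasSolutionFamily b ρ A C Γ α M r := by
  obtain ⟨M, N, Q, P, hM1, hMN, hM0, hML, hM, hQ0, hPd, hR, hQA, hPC⟩ :=
    exists_gauged_system (b := b) hA hC_hol hα
  have hp := isPhase_primitiveFun hρ_int hρ_pos
  have hP : ∀ ε > 0, ∃ r : ℝ, ∀ z : ℂ, r ≤ ‖z‖ →
      ∫ t in Ici α, entrySum (fun j l => P j l z) t ≤ ε := by
    intro ε hε
    obtain ⟨δ, hδ, hδε⟩ := exists_pos_mul_lt hε ((n : ℝ) ^ 2 * gaugeConstant A ^ 2)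
    obtain ⟨r, hr⟩ := exists_integral_entrySum_le hC_lim hα hδ
    exact ⟨r, fun z hz => (hPC z).trans ((mul_le_mul_of_nonneg_left (hr z hz)
      (by positivity)).trans hδε.le)⟩
  have hRe : ∀ z, ∀ᵐ t ∂(volume.restrict (Ici (0 : ℝ))), ∀ j l,
      (Q j l + P j l z : HalfLineL1) t =
        (N t * (A t - blockPart b A t + Matrix.of fun j k => C j k z t) * M t) j l := by
    intro z
    have h : ∀ᵐ t ∂(volume.restrict (Ici (0 : ℝ))), ∀ j l,
        (Q j l + P j l z : HalfLineL1) t = Q j l t + P j l z t := by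
      rw [ae_all_iff]; intro j; rw [ae_all_iff]; intro l
      exact Lp.coeFn_add (Q j l) (P j l z)
    filter_upwards [h, hR z] with t h1 h2 j l
    rw [h1, h2]
  have hfam : ∀ r > 0, ∀ N₀, ContractionData b (fun x => primitiveFun ρ (max x 0)) α
      (fun j l z => Q j l + P j l z) {z | z ∈ closure Γ ∧ r ≤ ‖z‖} N₀ →
      HasSolutionFamily b ρ A C Γ α M r := fun r hr N₀ hcd =>
    exists_family_of_contraction (R := fun j l z => Q j l + P j l z) hp
      (fun x hx => by rw [max_eq_left hx]) hα hM1 hMN hM0 hML hM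
      (fun j k => (differentiableOn_const (Q j k)).add (hPd j k)) hRe hΓ.isOpen hr hcd
      (fun ε hε => exists_norm_kernelOp_unitColumn_le hρ_int hρ_pos hp hα hQ0 hP hb hε)
  refine ⟨M, ⟨fun k => isSolution_of_hasACDeriv (fun T hT j => hM T hT j k)
    (Eventually.of_forall fun _ _ => rfl), hM1⟩, ?_, fun r hr hAs hCs => ?_⟩
  · obtain ⟨r, N₀, hr, hcd⟩ := exists_contractionData hρ_int hρ_pos hp hα hQ0 hP hb
    exact ⟨r, hr, hfam r hr N₀ hcd⟩
  · exact hfam r hr _ (contractionData_of_small hp hα (hQA.trans hAs)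
      (fun z hz => (hPC z).trans (hCs z hz)) hb)

end Main

theorem mainTheorem1 (n : ℕ) (b : Fin n → ℂ) (ρ : ℝ → ℝ)
    (A : ℝ → Matrix (Fin n) (Fin n) ℂ) (C : Fin n → Fin n → ℂ → HalfLineL1)
    (hρ_int : ∀ T > 0, IntegrableOn ρ (Ico 0 T))
    (hρ_pos : ∀ᵐ x ∂(volume.restrict (Ici (0 : ℝ))), 0 < ρ x)
    (hA : ∀ j k, IntegrableOn (fun x => A x j k) (Ici 0))
    (hC_hol : ∀ j k, DifferentiableOn ℂ (C j k) {0}ᶜ)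
    (hC_lim : Tendsto (tailNorm C 0) (Bornology.cobounded ℂ) (𝓝 0))
    (Γ : Set ℂ) (hΓ : IsSector b Γ)
    (hb : ∀ z ∈ closure Γ, ∀ j k : Fin n, j ≤ k → (z * b k).re ≤ (z * b j).re) :
    ∃ M : ℝ → ℝ → Matrix (Fin n) (Fin n) ℂ,
      (∀ α, 0 ≤ α → IsMatrixIVPSolution (blockPart b A) α (M α) ∧
        ∀ N, IsMatrixIVPSolution (blockPart b A) α N → EqOn N (M α) (Ici 0)) ∧
      ∃ lam : ℝ → ℝ,
        (∀ α, 0 ≤ α → 0 < lam α ∧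
          ∃ Y S : ℝ → ℂ → Matrix (Fin n) (Fin n) ℂ,
            (∀ z ∈ closure (truncatedSector Γ (lam α)),
              IsFundamentalSystem (systemMatrix ρ b A C z) (fun x => Y x z)) ∧
            (∀ j k, ∀ z ∈ closure (truncatedSector Γ (lam α)), ∀ x, α ≤ x →
              Y x z j k =
                Complex.exp (z * b k * ((primitiveFun ρ x - primitiveFun ρ α : ℝ) : ℂ)) *
                  (M α x j k + S x z j k)) ∧
            (∀ j k, TendstoUniformlyOn (fun (z : ℂ) (x : ℝ) => S x z j k) (fun _ => 0)
              (Bornology.cobounded ℂ ⊓ 𝓟 (closure (truncatedSector Γ (lam α)))) (Ici α)) ∧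
            (∀ x, 0 ≤ x → ∀ j k,
              ContinuousOn (fun z => Y x z j k) (closure (truncatedSector Γ (lam α))) ∧
              AnalyticOnNhd ℂ (fun z => Y x z j k) (truncatedSector Γ (lam α))) ∧
            (∀ z ∈ closure (truncatedSector Γ (lam α)), ∀ j k : Fin n, k ≤ j →
              Y α z j k = if j = k then 1 else 0)) ∧
        (TailCondition C → Tendsto lam atTop (𝓝 0)) := by
  have hloc := fun (α : ℝ) (hα : 0 ≤ α) =>
    exists_solutionFamily hρ_int hρ_pos hA hC_hol hC_lim hΓ hb hα
  choose! M hIVP hex hsmall using hloc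
  refine ⟨M, fun α hα => ⟨hIVP α hα, fun N hN =>
    (hIVP α hα).eqOn (integrableOn_blockPart hA) hα hN⟩, ?_⟩
  suffices H : ∃ lam : ℝ → ℝ,
      (∀ α, 0 ≤ α → 0 < lam α ∧ HasSolutionFamily b ρ A C Γ α (M α) (lam α)) ∧
      (TailCondition C → Tendsto lam atTop (𝓝 0)) from H
  -- The radii have to be chosen before the tail condition appears as a hypothesis. If it fails, the
  -- final claim is vacuous and any admissible radii serve.
  by_cases hT : TailCondition C
  · obtain ⟨φ, hφ0, hφ, hφC⟩ := hT
    have hev : ∀ᶠ α in atTop, HasSolutionFamily b ρ A C Γ α (M α) (φ α) := by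
      have h1 := (tendsto_integral_Ici_zero (integrableOn_entrySum hA)).const_mul
        ((n : ℝ) ^ 2 * gaugeConstant A ^ 2)
      rw [mul_zero] at h1
      -- The first n² comes from the conjugation bound, the last from summing n² entries each
      -- bounded by the maximum norm.
      obtain ⟨δ, hδ, hδε⟩ := exists_pos_mul_lt (show (0 : ℝ) < 1 / 4 by norm_num)
        ((n : ℝ) ^ 2 * gaugeConstant A ^ 2 * (n : ℝ) ^ 2)
      filter_upwards [eventually_ge_atTop 0, h1.eventually_le_const (show (0 : ℝ) < 1 / 4 by norm_num),
        hφC.eventually_le_const (ENNReal.ofReal_pos.2 hδ)] with α hα hαA hαC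
      refine hsmall α hα (φ α) (hφ0 α hα) hαA fun z hz => ?_
      have h2 : tailNorm C α z ≤ ENNReal.ofReal δ :=
        (le_iSup₂ (f := fun (z : ℂ) (_ : φ α ≤ ‖z‖) => tailNorm C α z) z hz).trans hαC
      refine (mul_le_mul_of_nonneg_left (integral_entrySum_le_of_tailNorm_le hα hδ.le h2)
        (by positivity)).trans ?_
      rw [← mul_assoc]
      exact hδε.le
    obtain ⟨a, ha⟩ := eventually_atTop.1 hev
    -- The radius φ(α) is used from the threshold a on; below it any radius from the large-λ
    -- argument will do, since only the limit at infinity matters.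
    have hr : ∀ α, 0 ≤ α → ∃ r : ℝ, (0 < r ∧ HasSolutionFamily b ρ A C Γ α (M α) r) ∧
        (a ≤ α → r = φ α) := by
      intro α hα
      by_cases haα : a ≤ α
      · exact ⟨φ α, ⟨hφ0 α hα, ha α haα⟩, fun _ => rfl⟩
      · obtain ⟨r, hr, hr'⟩ := hex α hα
        exact ⟨r, ⟨hr, hr'⟩, fun h => absurd h haα⟩
    choose! lam hlam hlamφ using hr
    refine ⟨lam, hlam, fun _ => hφ.congr' ?_⟩
    filter_upwards [eventually_ge_atTop 0, eventually_ge_atTop a] with α hα haα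
    exact (hlamφ α hα haα).symm
  · choose! lam hlam using hex
    exact ⟨lam, hlam, fun h => absurd h hT⟩
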